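/- Let $n\ge 4$. A *metric tree* on a finite label set $L$ is a finite tree without nodes of degree two whose leaves (nodes of degree one) are labelled bijectively by $L$, with nonnegative edge lengths, where interior edges (those not ending in a leaf) have positive length; adding lengths along paths gives distances between the leaves. An *arrangement of $n$ metric trees* is a tuple $T=(T_1,\dots,T_n)$ of metric trees, $T_i$ with leaf labels $[n]\setminus\{i\}$ and leaf distances $\delta_i$, such that $\delta_i(j,k)=\delta_j(k,i)=\delta_k(i,j)$ for all pairwise distinct $i,j,k\in[n]$. Two arrangements $T,T'$ are *equivalent* if for every $i$ there is an isomorphism of trees $T_i\to T_i'$ (ignoring edge lengths) that preserves the leaf labels. For $X\subseteq[n]$ let $e_X=\sum_{i\in X}e_i\in\mathbb R^n$, and let $\Delta(3,n)=\operatorname{conv}\{e_X : X\in\binom{[n]}{3}\}$. A weight vector $\lambda\in\mathbb R^{\binom{[n]}{3}}$ induces the *regular subdivision* of $\Delta(3,n)$ whose cells are the projections to $\mathbb R^n$ of the lower faces of $\operatorname{conv}\{(e_X,\lambda(X)) : X\in\binom{[n]}{3}\}\subset\mathbb R^{n+1}$. It is a *matroid subdivision* if each of its cells is a matroid polytope,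 that is, of the form $\operatorname{conv}\{e_X : X\in\mathcal M\}$ with $\emptyset\ne\mathcal M\subseteq\binom{[n]}{3}$ and all edges parallel to edges of $\Delta(3,n)$. 1. Assigning to an arrangement $T$ the regular subdivision of $\Delta(3,n)$ induced by the weight vector $\{i,j,k\}\mapsto-\delta_i(j,k)$ gives a well-defined bijection from the equivalence classes of arrangements of $n$ metric trees onto the regular matroid subdivisions of $\Delta(3,n)$. 2. Let $\mathbb K$ be a field. For a polynomial $f\in\mathbb K[p_X : X\in\binom{[n]}{3}]$ let $\operatorname{in}_\lambda(f)$ be the sum of the terms of $f$ of lowest $\lambda$-weight. The *Dressian* $\mathrm{Dr}(3,n)$ is the set of all $\lambda\in\mathbb R^{\binom{[n]}{3}}$ such that, for every three term Plücker relation $p_{hij}p_{hkl}-p_{hik}p_{hjl}+p_{hil}p_{hjk}$ ($h,i,j,k,l\in[n]$ pairwise distinct), the initial form with respect to $\lambda$ has at least two terms. The *Plücker fan structure* on $\mathrm{Dr}(3,n)$ has as its relatively open cones the classes of those $\lambda\in\mathrm{Dr}(3,n)$ that specify the same initial form for every three term Plücker relation. The *secondary fan structure* has as its relatively open cones the sets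 of all weight vectors that induce a fixed regular matroid subdivision of $\Delta(3,n)$. These two fan structures coincide: they have the same cones (and, in particular, the same support). -/

import Mathlib

open scoped Matrix

noncomputable section

/-! ### Hypersimplices, matroid polytopes, regular subdivisions -/

/-- The `d`-element subsets of `[n]`. -/
abbrev DSubset (d n : ℕ) : Type := {X : Finset (Fin n) // X.card = d}

/-- The vector `e_X = ∑_{i ∈ X} e_i` of `ℝⁿ`. -/
def indVec {n : ℕ} (X : Finset (Fin n)) : Fin n → ℝ := ∑ i ∈ X, Pi.single i 1

/-- The polytope `conv {e_X | X ∈ M}` for a collection `M` of `d`-subsets of `[n]`. -/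
def setPolytope {d n : ℕ} (M : Set (DSubset d n)) : Set (Fin n → ℝ) :=
  convexHull ℝ ((fun X : DSubset d n => indVec X.1) '' M)

/-- The hypersimplex `Δ(d,n)`. -/
def hypersimplex (d n : ℕ) : Set (Fin n → ℝ) := setPolytope (Set.univ : Set (DSubset d n))

/-- `E` is an edge (a one-dimensional face) of the polytope `P`. -/
def IsEdge {n : ℕ} (P E : Set (Fin n → ℝ)) : Prop :=
  IsExposed ℝ P E ∧ Module.finrank ℝ (vectorSpan ℝ E) = 1

/-- `M` is (the set of bases of) a matroid of rank `d` on `[n]`: it is nonempty, and every edge of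
its polytope is parallel to an edge of the hypersimplex. -/
def IsMatroidBases {d n : ℕ} (M : Set (DSubset d n)) : Prop :=
  M.Nonempty ∧ ∀ E, IsEdge (setPolytope M) E →
    ∃ E', IsEdge (hypersimplex d n) E' ∧ (affineSpan ℝ E).Parallel (affineSpan ℝ E')

/-- `Q` is the polytope of a matroid of rank `d` on `[n]`. -/
def IsMatroidPolytope (d : ℕ) {n : ℕ} (Q : Set (Fin n → ℝ)) : Prop :=
  ∃ M : Set (DSubset d n), IsMatroidBases M ∧ Q = setPolytope M

/-- The polytope `conv {(e_X, w X)}` in `ℝⁿ × ℝ` obtained by lifting the vertices of `Δ(d,n)`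
to the heights `w`. -/
def liftedPolytope {d n : ℕ} (w : DSubset d n → ℝ) : Set ((Fin n → ℝ) × ℝ) :=
  convexHull ℝ (Set.range fun X : DSubset d n => (indVec X.1, w X))

/-- The lower face of the lifted polytope on which the linear functional `(x, t) ↦ a · x + t`
is minimal. -/
def lowerFace {d n : ℕ} (w : DSubset d n → ℝ) (a : Fin n → ℝ) : Set ((Fin n → ℝ) × ℝ) :=
  {p | p ∈ liftedPolytope w ∧ ∀ q ∈ liftedPolytope w, a ⬝ᵥ p.1 + p.2 ≤ a ⬝ᵥ q.1 + q.2}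

/-- The regular subdivision of `Δ(d,n)` induced by `w`, as the set of all its nonempty cells (of
all dimensions): these are the projections to `ℝⁿ` of the lower faces of the lifted polytope. -/
def regularSubdivision {d n : ℕ} (w : DSubset d n → ℝ) : Set (Set (Fin n → ℝ)) :=
  Set.range fun a : Fin n → ℝ => Prod.fst '' lowerFace w a

/-- All cells are matroid polytopes. -/
def AllCellsMatroidal (d : ℕ) {n : ℕ} (S : Set (Set (Fin n → ℝ))) : Prop :=
  ∀ Q ∈ S, IsMatroidPolytope d Q

/-- The regular matroid subdivisions of `Δ(d,n)`. -/
def RegularMatroidSubdivision (d n : ℕ) : Type :=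
  {S : Set (Set (Fin n → ℝ)) //
    (∃ w : DSubset d n → ℝ, S = regularSubdivision w) ∧ AllCellsMatroidal d S}

/-- The fan of all secondary cones of `Δ(d,n)` that belong to matroid subdivisions, given by its
relatively open cones: a cone consists of all weights that induce one fixed subdivision. -/
def secondaryFan (d n : ℕ) : Set (Set (DSubset d n → ℝ)) :=
  {C | ∃ S : RegularMatroidSubdivision d n, C = {w | regularSubdivision w = S.1}}

/-! ### The Dressian and its Plücker fan structure -/

open Classical in
/-- The initial form of `f` with respect to `w`: the sum of the terms of `f` of lowest weight. -/
def initialForm {σ K : Type*} [Field K] (w : σ → ℝ) (f : MvPolynomial σ K) : MvPolynomial σ K :=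
  ∑ m ∈ f.support with ∀ m' ∈ f.support, Finsupp.weight w m ≤ Finsupp.weight w m',
    MvPolynomial.monomial m (f.coeff m)

/-- The Plücker variable `p_X` (used only for `X` of cardinality `d`). -/
def pluckerVar (K : Type*) [Field K] (d : ℕ) {n : ℕ} (X : Finset (Fin n)) :
    MvPolynomial (DSubset d n) K :=
  if h : X.card = d then MvPolynomial.X ⟨X, h⟩ else 0

/-- The three term Plücker relations `p_{Sij} p_{Skl} - p_{Sik} p_{Sjl} + p_{Sil} p_{Sjk}`, where
`S` is a `(d-2)`-subset of `[n]` and `i, j, k, l ∉ S` are pairwise distinct. -/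
def threeTermRelations (K : Type*) [Field K] (d n : ℕ) : Set (MvPolynomial (DSubset d n) K) :=
  {f | ∃ (S : Finset (Fin n)) (i j k l : Fin n), S.card + 2 = d ∧
    i ∉ S ∧ j ∉ S ∧ k ∉ S ∧ l ∉ S ∧ [i, j, k, l].Nodup ∧
    f = pluckerVar K d (S ∪ {i, j}) * pluckerVar K d (S ∪ {k, l})
      - pluckerVar K d (S ∪ {i, k}) * pluckerVar K d (S ∪ {j, l})
      + pluckerVar K d (S ∪ {i, l}) * pluckerVar K d (S ∪ {j, k})}

/-- The Dressian `Dr(d,n)`: the tropical prevariety of the three term Plücker relations, that is,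
the set of all weights for which no initial form of such a relation is a monomial. -/
def dressian (K : Type*) [Field K] (d n : ℕ) : Set (DSubset d n → ℝ) :=
  {w | ∀ f ∈ threeTermRelations K d n, 2 ≤ (initialForm w f).support.card}

/-- The Plücker fan structure on `Dr(d,n)`, given by its relatively open cones: two points of the
Dressian are in the same cone if they specify the same initial form of each three term relation. -/
def pluckerFan (K : Type*) [Field K] (d n : ℕ) : Set (Set (DSubset d n → ℝ)) :=
  {C | ∃ w ∈ dressian K d n, C = {w' | w' ∈ dressian K d n ∧
    ∀ f ∈ threeTermRelations K d n, initialForm w' f = initialForm w f}}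

/-! ### Metric trees and their arrangements -/

/-- A finite tree whose leaves (the nodes of degree one) are labelled bijectively by `L`, without
nodes of degree two. -/
structure LeafTree (L : Type) where
  V : Type
  finite_V : Finite V
  G : SimpleGraph V
  isTree : G.IsTree
  leaf : L → V
  leaf_injective : Function.Injective leaf
  mem_range_leaf_iff : ∀ v, v ∈ Set.range leaf ↔ (G.neighborSet v).ncard = 1
  ncard_ne_two : ∀ v, (G.neighborSet v).ncard ≠ 2

/-- Two trees are the same abstract tree: there is an isomorphism that respects the labels of the
leaves. -/
def LeafTree.Same {L : Type} (A B : LeafTree L) : Prop :=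
  ∃ φ : A.G ≃g B.G, ∀ j, φ (A.leaf j) = B.leaf j

/-- A metric tree: edges have nonnegative lengths, and an interior edge (one that does not end in
a leaf) has positive length, as it would be contracted otherwise. Only the values of `len` on the
edges of the tree matter. -/
structure MetricTree (L : Type) extends LeafTree L where
  len : Sym2 V → ℝ
  len_nonneg : ∀ e ∈ G.edgeSet, 0 ≤ len e
  len_pos : ∀ u v, G.Adj u v → u ∉ Set.range leaf → v ∉ Set.range leaf → 0 < len s(u, v)

/-- The path between two nodes of a tree. -/
def LeafTree.path {L : Type} (A : LeafTree L) (u v : A.V) : A.G.Walk u v :=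
  (A.isTree.existsUnique_path u v).choose

/-- The distance of two leaves: the sum of the lengths of the edges on the path between them. -/
def MetricTree.dist {L : Type} (A : MetricTree L) (j k : L) : ℝ :=
  ((A.path (A.leaf j) (A.leaf k)).edges.map A.len).sum

/-- An arrangement of `n` metric trees: the tree `T_i` has the set of leaves `[n] \ {i}`, and
`δ_i(j,k) = δ_j(k,i) = δ_k(i,j)` for all pairwise distinct `i, j, k`. -/
structure TreeArrangement (n : ℕ) where
  tree : ∀ i : Fin n, MetricTree {j : Fin n // j ≠ i}
  compat : ∀ (i j k : Fin n) (hij : i ≠ j) (hjk : j ≠ k) (hki : k ≠ i),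
    (tree i).dist ⟨j, hij.symm⟩ ⟨k, hki⟩ = (tree j).dist ⟨k, hjk.symm⟩ ⟨i, hij⟩ ∧
    (tree j).dist ⟨k, hjk.symm⟩ ⟨i, hij⟩ = (tree k).dist ⟨i, hki.symm⟩ ⟨j, hjk⟩

/-- Two arrangements are equivalent if they induce the same abstract trees. -/
def TreeArrangement.setoid (n : ℕ) : Setoid (TreeArrangement n) where
  r T T' := ∀ i, (T.tree i).toLeafTree.Same (T'.tree i).toLeafTree
  iseqv :=
    { refl := fun _ _ => ⟨RelIso.refl _, fun _ => rfl⟩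
      symm := fun h i => by
        obtain ⟨φ, hφ⟩ := h i
        exact ⟨φ.symm, fun j => by rw [← hφ j]; exact φ.symm_apply_apply _⟩
      trans := fun h h' i => by
        obtain ⟨φ, hφ⟩ := h i
        obtain ⟨ψ, hψ⟩ := h' i
        exact ⟨φ.trans ψ, fun j => by rw [← hψ j, ← hφ j]; rfl⟩ }

/-- The equivalence classes of arrangements of `n` metric trees. -/
def TreeArrangementClass (n : ℕ) : Type 1 := Quotient (TreeArrangement.setoid n)

/-- The equivalence class of an arrangement. -/
def TreeArrangement.toClass {n : ℕ} (T : TreeArrangement n) : TreeArrangementClass n :=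
  Quotient.mk (TreeArrangement.setoid n) T

/-- The weight vector `{i < j < k} ↦ -δ_i(j,k)` of an arrangement. The sign is there because tree
metrics are described by maxima, whereas initial forms and lower faces are described by minima. -/
def TreeArrangement.weight {n : ℕ} (T : TreeArrangement n) (X : DSubset 3 n) : ℝ :=
  -(T.tree (X.1.orderEmbOfFin X.2 0)).dist
    ⟨X.1.orderEmbOfFin X.2 1, (X.1.orderEmbOfFin X.2).injective.ne (by decide)⟩
    ⟨X.1.orderEmbOfFin X.2 2, (X.1.orderEmbOfFin X.2).injective.ne (by decide)⟩

end

set_option linter.unusedSimpArgs false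

noncomputable section

/-! Everything is read through one condition on a weight, `ThreeTerm`: in each three term relation
the lowest of the three sums is attained at least twice. It describes the Dressian
(`mem_dressian_iff`), the weights all of whose cells are matroid polytopes (`allCellsMatroidal_iff`)
and, up to an additive constant, the weights of tree arrangements
(`TreeArrangement.threeTerm_val_weight`, `TreeArrangement.exists_weight_eq`).

Matroid cells. The triples made of h and two of i, j, k, l are the vertices of an octahedral face,
whose three diagonals are the terms of a relation. A unique lowest diagonal is an edge of the
subdivision in a forbidden direction (`isCell_pair`). Conversely, after a linear function is added,
a cell is the zero set of a nonnegative weight. In rank three the condition forces basis exchange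
there (`ThreeTerm.exchange`); applied to two-vertex cells, this shows that every edge of a cell is a
single exchange.

Fans. The core is `regularSubdivision_eq_iff_sameMin`: the subdivision is determined by which terms
are lowest. Join two weights with the same lowest terms by a segment. Its direction is balanced on
tied lowest terms (`Tangent`), and such a direction is linear on every cell
(`Tangent.exists_shift`): otherwise, corrected by a linear function, it would be nonnegative on the
cell and vanish on a proper face, and `exists_larger_face` would enlarge this face forever. Hence no
cell breaks along the segment (`IsCell.of_segment`).

Trees. For fixed h the negated weight is a function of pairs with the four point condition.
Distances in a tree are sums over the splits given by its edges, so the lowest terms at h tell which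
quartets are separated. Quartets determine the splits (`IsSplitSystem.subset_of_separates`) and
splits determine the tree, by Buneman's construction (`LeafTree.same_iff`). Conversely
`exists_splitDist_eq` turns a four point function plus a large constant into a tree metric. One
constant serves all trees, and it cancels when sums of two values are compared. -/

/-! ### The three term condition -/

/-- A function of triples satisfies the three term condition if, for every octahedral quintuple, the
minimum of the three sums is attained at least twice. -/
def ThreeTerm {ι : Type*} (f : ι → ι → ι → ℝ) : Prop :=
  ∀ h i j k l, [h, i, j, k, l].Nodup →
    f h i k + f h j l ≤ f h i j + f h k l ∨ f h i l + f h j k ≤ f h i j + f h k l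

/-- In the relation through `y j` that pairs two elements of `x` with the other two of `y`, the
triple `y` contributes zero. One of the other terms is therefore at most the mixed value on the
right, and each of its triples has one element of `x` and two of `y`. -/
lemma ThreeTerm.no_far_pair_aux {ι : Type*} {f : ι → ι → ι → ℝ} (hf : ThreeTerm f)
    (s12 : ∀ i j k, f i j k = f j i k) (s23 : ∀ i j k, f i j k = f i k j)
    {x y : Fin 3 → ι} (hx : Function.Injective x) (hy : Function.Injective y)
    (hxy : ∀ i j, x i ≠ y j) (h0 : f (y 0) (y 1) (y 2) = 0) (i j : Fin 3) :
    ∃ i1 j1 i2 j2, f (x i1) (y (j1 + 1)) (y (j1 + 2)) + f (x i2) (y (j2 + 1)) (y (j2 + 2))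
      ≤ f (y j) (x (i + 1)) (x (i + 2)) := by
  have nd : [y j, x (i + 1), x (i + 2), y (j + 1), y (j + 2)].Nodup := by
    have a1 : j ≠ j + 1 := by revert j; decide
    have a2 : j ≠ j + 2 := by revert j; decide
    have a3 : j + 1 ≠ j + 2 := by revert j; decide
    have a4 : i + 1 ≠ i + 2 := by revert i; decide
    simp [hx.eq_iff, hy.eq_iff, a1, a2, a3, hxy, fun i j => (hxy i j).symm]
  have key := hf _ _ _ _ _ nd
  have h0' : f (y j) (y (j + 1)) (y (j + 2)) = 0 := by
    rw [← h0]
    fin_cases j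
    · rfl
    · change f (y 1) (y 2) (y 0) = _
      rw [s23, s12]
    · change f (y 2) (y 0) (y 1) = _
      rw [s12, s23]
  rw [h0', add_zero] at key
  have e1 : j + 2 + 1 = j := by clear * -; revert j; decide
  have e2 : j + 2 + 2 = j + 1 := by clear * -; revert j; decide
  have e3 : j + 1 + 1 = j + 2 := by clear * -; revert j; decide
  have e4 : j + 1 + 2 = j := by clear * -; revert j; decide
  rcases key with key | key
  · refine ⟨i + 1, j + 2, i + 2, j + 1, ?_⟩
    rw [e1, e2, e3, e4]
    convert key using 2
    · rw [s12]
    · rw [s12, s23, s12, s23, s12]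
  · refine ⟨i + 1, j + 1, i + 2, j + 2, ?_⟩
    rw [e1, e2, e3, e4]
    convert key using 2
    · rw [s23, s12]
    · rw [s12]

/-- Two disjoint triples are never the only minimisers among the triples in their union. -/
lemma ThreeTerm.no_far_pair {ι : Type*} {f : ι → ι → ι → ℝ} (hf : ThreeTerm f)
    (s12 : ∀ i j k, f i j k = f j i k) (s23 : ∀ i j k, f i j k = f i k j)
    {x y : Fin 3 → ι} (hx : Function.Injective x) (hy : Function.Injective y)
    (hxy : ∀ i j, x i ≠ y j) (hx0 : f (x 0) (x 1) (x 2) = 0) (hy0 : f (y 0) (y 1) (y 2) = 0)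
    (hα : ∀ i j, 0 < f (y j) (x (i + 1)) (x (i + 2)))
    (hβ : ∀ i j, 0 < f (x i) (y (j + 1)) (y (j + 2))) : False := by
  -- Let α and β be the smallest values on the two kinds of mixed triples. The auxiliary lemma, used
  -- in both directions, gives α ≥ 2β and β ≥ 2α, which is impossible for positive numbers.
  obtain ⟨p, -, hp⟩ := Finset.exists_min_image Finset.univ
    (fun p : Fin 3 × Fin 3 => f (y p.2) (x (p.1 + 1)) (x (p.1 + 2))) ⟨(0, 0), Finset.mem_univ _⟩
  obtain ⟨q, -, hq⟩ := Finset.exists_min_image Finset.univ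
    (fun p : Fin 3 × Fin 3 => f (x p.1) (y (p.2 + 1)) (y (p.2 + 2))) ⟨(0, 0), Finset.mem_univ _⟩
  obtain ⟨i1, j1, i2, j2, h1⟩ := hf.no_far_pair_aux s12 s23 hx hy hxy hy0 p.1 p.2
  obtain ⟨i3, j3, i4, j4, h2⟩ :=
    hf.no_far_pair_aux s12 s23 hy hx (fun i j => (hxy j i).symm) hx0 q.2 q.1
  have a1 := hq (i1, j1) (Finset.mem_univ _)
  have a2 := hq (i2, j2) (Finset.mem_univ _)
  have a3 := hp (j3, i3) (Finset.mem_univ _)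
  have a4 := hp (j4, i4) (Finset.mem_univ _)
  have a5 := hα p.1 p.2
  have a6 := hβ q.1 q.2
  simp only at a1 a2 a3 a4
  linarith

/-- The three term condition does not change under the addition of a linear function. -/
lemma ThreeTerm.add_linear {ι : Type*} {f : ι → ι → ι → ℝ} (hf : ThreeTerm f) (c : ι → ℝ) :
    ThreeTerm fun i j k => f i j k + (c i + c j + c k) := by
  intro h i j k l nd
  rcases hf h i j k l nd with H | H
  · left; linarith
  · right; linarith

/-- If no element of `y` can replace `x 0`, a small linear perturbation makes all mixed triples
positive while both triples stay at zero, against `ThreeTerm.no_far_pair`. -/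
lemma ThreeTerm.exchange_disjoint {ι : Type*} {f : ι → ι → ι → ℝ} (hf : ThreeTerm f)
    (s12 : ∀ i j k, f i j k = f j i k) (s23 : ∀ i j k, f i j k = f i k j)
    (hnn : ∀ i j k, 0 ≤ f i j k)
    {x y : Fin 3 → ι} (hx : Function.Injective x) (hy : Function.Injective y)
    (hxy : ∀ i j, x i ≠ y j) (hx0 : f (x 0) (x 1) (x 2) = 0) (hy0 : f (y 0) (y 1) (y 2) = 0) :
    ∃ j, f (y j) (x 1) (x 2) = 0 := by
  classical
  by_contra! hne
  have hα : ∀ j, 0 < f (y j) (x 1) (x 2) := fun j => (hnn _ _ _).lt_of_ne (hne j).symm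
  have j12 : ∀ j : Fin 3, j + 1 ≠ j + 2 := by decide
  -- In the relation through `x 1`, both competing terms contain a triple made of `x 1`, `x 2` and
  -- an element of `y`, which is positive by `hα`; so this value cannot vanish.
  have hβ1 : ∀ j, 0 < f (x 1) (y (j + 1)) (y (j + 2)) := by
    intro j
    refine (hnn _ _ _).lt_of_ne fun h0 => ?_
    have nd : [x 1, x 0, x 2, y (j + 1), y (j + 2)].Nodup := by
      simp [hx.eq_iff, hy.eq_iff, hxy, j12]
    have b1 := hα (j + 1)
    have b2 := hα (j + 2)
    have b3 := hnn (x 1) (x 0) (y (j + 1))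
    have b4 := hnn (x 1) (x 0) (y (j + 2))
    have e : f (x 1) (x 0) (x 2) = 0 := by rw [s12, hx0]
    have c1 : f (x 1) (x 2) (y (j + 1)) = f (y (j + 1)) (x 1) (x 2) := by rw [s23, s12]
    have c2 : f (x 1) (x 2) (y (j + 2)) = f (y (j + 2)) (x 1) (x 2) := by rw [s23, s12]
    rcases hf _ _ _ _ _ nd with H | H <;> linarith
  have hβ2 : ∀ j, 0 < f (x 2) (y (j + 1)) (y (j + 2)) := by
    intro j
    refine (hnn _ _ _).lt_of_ne fun h0 => ?_
    have nd : [x 2, x 0, x 1, y (j + 1), y (j + 2)].Nodup := by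
      simp [hx.eq_iff, hy.eq_iff, hxy, j12]
    have b1 := hα (j + 1)
    have b2 := hα (j + 2)
    have b3 := hnn (x 2) (x 0) (y (j + 1))
    have b4 := hnn (x 2) (x 0) (y (j + 2))
    have e : f (x 2) (x 0) (x 1) = 0 := by rw [s12, s23, hx0]
    have c1 : f (x 2) (x 1) (y (j + 1)) = f (y (j + 1)) (x 1) (x 2) := by rw [s23, s12, s23]
    have c2 : f (x 2) (x 1) (y (j + 2)) = f (y (j + 2)) (x 1) (x 2) := by rw [s23, s12, s23]
    rcases hf _ _ _ _ _ nd with H | H <;> linarith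
  obtain ⟨p, -, hp⟩ := Finset.exists_min_image Finset.univ
    (fun j => f (y j) (x 1) (x 2)) ⟨0, Finset.mem_univ _⟩
  obtain ⟨q, -, hq⟩ := Finset.exists_min_image Finset.univ
    (fun j : Fin 3 => f (x 1) (y (j + 1)) (y (j + 2))) ⟨0, Finset.mem_univ _⟩
  obtain ⟨r, -, hr⟩ := Finset.exists_min_image Finset.univ
    (fun j : Fin 3 => f (x 2) (y (j + 1)) (y (j + 2))) ⟨0, Finset.mem_univ _⟩
  have := hα p
  have := hβ1 q
  have := hβ2 r
  obtain ⟨η, hη, h1, h2, h3⟩ : ∃ η > 0, 2 * η < f (y p) (x 1) (x 2) ∧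
      η < f (x 1) (y (q + 1)) (y (q + 2)) ∧ η < f (x 2) (y (r + 1)) (y (r + 2)) := by
    refine ⟨min (f (y p) (x 1) (x 2)) (min (f (x 1) (y (q + 1)) (y (q + 2)))
      (f (x 2) (y (r + 1)) (y (r + 2)))) / 3, by positivity, ?_, ?_, ?_⟩
    · have := min_le_left (f (y p) (x 1) (x 2)) (min (f (x 1) (y (q + 1)) (y (q + 2)))
        (f (x 2) (y (r + 1)) (y (r + 2))))
      linarith
    · have := (min_le_right (f (y p) (x 1) (x 2)) (min (f (x 1) (y (q + 1)) (y (q + 2)))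
        (f (x 2) (y (r + 1)) (y (r + 2))))).trans (min_le_left _ _)
      linarith
    · have := (min_le_right (f (y p) (x 1) (x 2)) (min (f (x 1) (y (q + 1)) (y (q + 2)))
        (f (x 2) (y (r + 1)) (y (r + 2))))).trans (min_le_right _ _)
      linarith
  -- The perturbation sums to zero on `x` and on `y`. It lowers only triples that contain `x 1` or
  -- `x 2` but not `x 0`, and those have been shown to exceed the loss.
  set c : ι → ℝ := fun a => if a = x 0 then 2 * η else if a = x 1 ∨ a = x 2 then -η else 0 with hc
  have cx0 : c (x 0) = 2 * η := by simp [hc]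
  have cx1 : c (x 1) = -η := by simp [hc, hx.eq_iff]
  have cx2 : c (x 2) = -η := by simp [hc, hx.eq_iff]
  have cy : ∀ j, c (y j) = 0 := fun j => by simp [hc, fun i j => (hxy i j).symm]
  refine (hf.add_linear c).no_far_pair (fun i j k => ?_) (fun i j k => ?_) hx hy hxy ?_ ?_
    (fun i j => ?_) (fun i j => ?_)
  · rw [s12, add_comm (c i)]
  · rw [s23, add_right_comm (c i)]
  · rw [hx0, cx0, cx1, cx2]; ring
  · rw [hy0, cy, cy, cy]; ring
  · rw [cy]
    have h0 := hp j (Finset.mem_univ _)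
    have h5 := hnn (y j) (x (i + 1)) (x (i + 2))
    fin_cases i
    · simp only [Fin.mk_zero, zero_add, Fin.isValue, cx1, cx2] at *
      linarith
    · have e1 : (1 : Fin 3) + 1 = 2 := rfl
      have e2 : (1 : Fin 3) + 2 = 0 := rfl
      simp only [Fin.mk_one, Fin.isValue, e1, e2, cx0, cx2] at *
      linarith
    · have e1 : (2 : Fin 3) + 1 = 0 := rfl
      have e2 : (2 : Fin 3) + 2 = 1 := rfl
      simp only [Fin.reduceFinMk, Fin.isValue, e1, e2, cx0, cx1] at *
      linarith
  · rw [cy, cy]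
    have h0 := hq j (Finset.mem_univ _)
    have h0' := hr j (Finset.mem_univ _)
    have h5 := hnn (x i) (y (j + 1)) (y (j + 2))
    fin_cases i
    · simp only [Fin.mk_zero, Fin.isValue, cx0] at *
      linarith
    · simp only [Fin.mk_one, Fin.isValue, cx1] at *
      linarith
    · simp only [Fin.reduceFinMk, Fin.isValue, cx2] at *
      linarith

/-! ### Weights on triples -/

/-- The value of a weight on the triple `{i, j, k}`, and zero if `i, j, k` are not distinct. -/
def val {n : ℕ} (g : DSubset 3 n → ℝ) (i j k : Fin n) : ℝ :=
  if h : ({i, j, k} : Finset (Fin n)).card = 3 then g ⟨{i, j, k}, h⟩ else 0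

/-- The linear weight `X ↦ ∑ i ∈ X, a i`. -/
def shift {n : ℕ} (a : Fin n → ℝ) (X : DSubset 3 n) : ℝ := ∑ i ∈ X.1, a i

lemma val_eq {n : ℕ} (g : DSubset 3 n → ℝ) {i j k : Fin n} {X : DSubset 3 n}
    (h : X.1 = {i, j, k}) : val g i j k = g X := by
  obtain ⟨X, hX⟩ := X
  subst h
  simp [val, hX]

lemma val_swap_left {n : ℕ} (g : DSubset 3 n → ℝ) (i j k : Fin n) :
    val g i j k = val g j i k := by
  simp only [val, Finset.insert_comm i j]

lemma val_swap_right {n : ℕ} (g : DSubset 3 n → ℝ) (i j k : Fin n) :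
    val g i j k = val g i k j := by
  simp only [val, Finset.pair_comm j k]

lemma exists_triple {n : ℕ} {i j k : Fin n} (hij : i ≠ j) (hik : i ≠ k) (hjk : j ≠ k) :
    ∃ X : DSubset 3 n, X.1 = {i, j, k} :=
  ⟨⟨{i, j, k}, Finset.card_eq_three.2 ⟨i, j, k, hij, hik, hjk, rfl⟩⟩, rfl⟩

lemma val_nonneg {n : ℕ} {g : DSubset 3 n → ℝ} (hg : ∀ X, 0 ≤ g X) (i j k : Fin n) :
    0 ≤ val g i j k := by
  unfold val
  split_ifs
  exacts [hg _, le_rfl]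

lemma val_add {n : ℕ} (g g' : DSubset 3 n → ℝ) (i j k : Fin n) :
    val (fun X => g X + g' X) i j k = val g i j k + val g' i j k := by
  unfold val
  split_ifs <;> simp

lemma val_smul {n : ℕ} (t : ℝ) (g : DSubset 3 n → ℝ) (i j k : Fin n) :
    val (fun X => t * g X) i j k = t * val g i j k := by
  unfold val
  split_ifs <;> simp

lemma shift_eq {n : ℕ} (a : Fin n → ℝ) {X : DSubset 3 n} {i j k : Fin n} (hij : i ≠ j)
    (hik : i ≠ k) (hjk : j ≠ k) (h : X.1 = {i, j, k}) : shift a X = a i + a j + a k := by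
  rw [shift, h, Finset.sum_insert (by simp [hij, hik]), Finset.sum_pair hjk, add_assoc]

lemma val_shift {n : ℕ} (a : Fin n → ℝ) {i j k : Fin n} (hij : i ≠ j) (hik : i ≠ k)
    (hjk : j ≠ k) : val (shift a) i j k = a i + a j + a k := by
  obtain ⟨X, hX⟩ := exists_triple hij hik hjk
  rw [val_eq _ hX, shift_eq a hij hik hjk hX]

lemma shift_add {n : ℕ} (a b : Fin n → ℝ) (X : DSubset 3 n) :
    shift (fun i => a i + b i) X = shift a X + shift b X := Finset.sum_add_distrib

lemma shift_mul {n : ℕ} (t : ℝ) (a : Fin n → ℝ) (X : DSubset 3 n) :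
    shift (fun i => t * a i) X = t * shift a X := (Finset.mul_sum _ _ _).symm

lemma shift_sub {n : ℕ} (a b : Fin n → ℝ) (X : DSubset 3 n) :
    shift (fun i => a i - b i) X = shift a X - shift b X := Finset.sum_sub_distrib _ _

lemma shift_const {n : ℕ} (t : ℝ) (X : DSubset 3 n) :
    shift (fun _ => t) X = 3 * t := by simp [shift, X.2]

lemma ThreeTerm.val_add_shift {n : ℕ} {g : DSubset 3 n → ℝ} (hg : ThreeTerm (val g))
    (a : Fin n → ℝ) : ThreeTerm (val fun X => g X + shift a X) := by
  intro h i j k l nd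
  have := hg.add_linear a h i j k l nd
  simp only [List.nodup_cons, List.mem_cons, not_or, List.not_mem_nil, not_false_eq_true] at nd
  obtain ⟨⟨h1, h2, h3, h4, -⟩, ⟨i1, i2, i3, -⟩, ⟨j1, j2, -⟩, ⟨k1, -⟩, -⟩ := nd
  simp only [val_add]
  rwa [val_shift a h1 h3 i2, val_shift a h2 h4 j2, val_shift a h1 h2 i1, val_shift a h3 h4 k1,
    val_shift a h1 h4 i3, val_shift a h2 h3 j1]

/-- The zero set of a nonnegative weight with the three term property has the exchange property of
the bases of a matroid. -/
lemma ThreeTerm.exchange {n : ℕ} {g : DSubset 3 n → ℝ} (hg : ThreeTerm (val g))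
    (hnn : ∀ X, 0 ≤ g X) {B X : DSubset 3 n} (hB : g B = 0) (hX : g X = 0) {i : Fin n}
    (hi : i ∈ B.1) (hi' : i ∉ X.1) :
    ∃ j ∈ X.1, j ∉ B.1 ∧ ∃ Z, g Z = 0 ∧ Z.1 = insert j (B.1.erase i) := by
  have hc : (B.1.erase i).card = 2 := by rw [Finset.card_erase_of_mem hi, B.2]
  have hnnv := val_nonneg hnn
  obtain ⟨b, c, hbc, hbce⟩ := Finset.card_eq_two.1 hc
  have hBe : B.1 = {i, b, c} := by rw [← hbce, Finset.insert_erase hi]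
  have hib : i ≠ b := by
    rintro rfl
    exact Finset.notMem_erase i B.1 (hbce ▸ Finset.mem_insert_self _ _)
  have hic : i ≠ c := by
    rintro rfl
    exact Finset.notMem_erase i B.1 (hbce ▸ by simp)
  rw [← val_eq g hBe] at hB
  have finish : ∀ j ∈ X.1, j ∉ B.1 → val g j b c = 0 →
      ∃ j ∈ X.1, j ∉ B.1 ∧ ∃ Z, g Z = 0 ∧ Z.1 = insert j (B.1.erase i) := by
    intro j hj hjB h0
    have hjB' := hjB
    simp only [hBe, Finset.mem_insert, Finset.mem_singleton, not_or] at hjB'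
    obtain ⟨Z, hZ⟩ := exists_triple hjB'.2.1 hjB'.2.2 hbc
    exact ⟨j, hj, hjB, Z, by rw [← val_eq g hZ, h0], by rw [hZ, hbce]⟩
  -- If exactly one element of `B` other than `i` lies in `X`, the relation through that element has
  -- `B` and `X` as one term, with value zero. So another term vanishes, and it contains the
  -- exchanged triple.
  have one : ∀ b' c' : Fin n, i ≠ b' → i ≠ c' → b' ≠ c' → B.1 = {i, b', c'} →
      (∀ j, val g j b c = val g j b' c') → b' ∈ X.1 → c' ∉ X.1 →
      ∃ j ∈ X.1, j ∉ B.1 ∧ ∃ Z, g Z = 0 ∧ Z.1 = insert j (B.1.erase i) := by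
    intro b' c' hib' hic' hbc' hBe' hv hb' hc'
    have : (X.1.erase b').card = 2 := by rw [Finset.card_erase_of_mem hb', X.2]
    obtain ⟨p, q, hpq, hpqe⟩ := Finset.card_eq_two.1 this
    have hXe : X.1 = {b', p, q} := by rw [← hpqe, Finset.insert_erase hb']
    have hp : p ∈ X.1.erase b' := by simp [hpqe]
    have hq : q ∈ X.1.erase b' := by simp [hpqe]
    rw [Finset.mem_erase] at hp hq
    have hip : i ≠ p := fun h => hi' (h ▸ hp.2)
    have hiq : i ≠ q := fun h => hi' (h ▸ hq.2)
    have hcp : c' ≠ p := fun h => hc' (h ▸ hp.2)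
    have hcq : c' ≠ q := fun h => hc' (h ▸ hq.2)
    have hB0 : val g b' i c' = 0 := by
      rw [val_swap_left, val_eq g hBe', ← val_eq g hBe, hB]
    have hX0 : val g b' p q = 0 := by rw [val_eq g hXe, hX]
    have hpB : p ∉ B.1 := by simp [hBe', hip.symm, hp.1, hcp.symm]
    have hqB : q ∉ B.1 := by simp [hBe', hiq.symm, hq.1, hcq.symm]
    have nd : [b', i, c', p, q].Nodup := by
      simp [hib'.symm, hic', hbc', hip, hiq, hcp, hcq, hpq, hp.1.symm, hq.1.symm]
    have n1 := hnnv b' i p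
    have n2 := hnnv b' c' q
    have n3 := hnnv b' i q
    have n4 := hnnv b' c' p
    rcases hg _ _ _ _ _ nd with H | H
    · refine finish q hq.2 hqB ?_
      rw [hv, val_swap_left, val_swap_right]
      linarith
    · refine finish p hp.2 hpB ?_
      rw [hv, val_swap_left, val_swap_right]
      linarith
  by_cases hb : b ∈ X.1
  · by_cases hc : c ∈ X.1
    · have h1 : ((X.1.erase b).erase c).card = 1 := by
        rw [Finset.card_erase_of_mem (by simp [hc, hbc.symm]), Finset.card_erase_of_mem hb, X.2]
      obtain ⟨j, hj⟩ := Finset.card_eq_one.1 h1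
      have hjm : j ∈ (X.1.erase b).erase c := by simp [hj]
      simp only [Finset.mem_erase] at hjm
      refine finish j hjm.2.2 ?_ ?_
      · simp only [hBe, Finset.mem_insert, Finset.mem_singleton, not_or]
        exact ⟨fun h => hi' (h ▸ hjm.2.2), hjm.2.1, hjm.1⟩
      · rw [val_eq g (X := X), hX]
        refine (Finset.eq_of_subset_of_card_le ?_ ?_).symm
        · simp [Finset.insert_subset_iff, hb, hc, hjm]
        · rw [X.2, Finset.card_eq_three.2 ⟨j, b, c, hjm.2.1, hjm.1, hbc, rfl⟩]
    · exact one b c hib hic hbc hBe (fun _ => rfl) hb hc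
  · by_cases hc : c ∈ X.1
    · exact one c b hic hib hbc.symm (by rw [hBe, Finset.pair_comm])
        (fun j => val_swap_right _ _ _ _) hc hb
    · obtain ⟨p, q, r, hpq, hpr, hqr, hXe⟩ := Finset.card_eq_three.1 X.2
      have hx : Function.Injective ![i, b, c] := by
        intro s t; fin_cases s <;> fin_cases t <;> simp [hib, hic, hbc, hib.symm, hic.symm, hbc.symm]
      have hy : Function.Injective ![p, q, r] := by
        intro s t; fin_cases s <;> fin_cases t <;> simp [hpq, hpr, hqr, hpq.symm, hpr.symm, hqr.symm]
      have hyX : ∀ t, ![p, q, r] t ∈ X.1 := by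
        intro t; fin_cases t <;> simp [hXe]
      have hxy : ∀ s t, ![i, b, c] s ≠ ![p, q, r] t := by
        intro s t h
        have := hyX t
        rw [← h] at this
        fin_cases s
        exacts [hi' this, hb this, hc this]
      obtain ⟨t, ht⟩ := hg.exchange_disjoint (val_swap_left g) (val_swap_right g) hnnv hx hy hxy hB
        (by rw [← hX]; exact val_eq g hXe)
      refine finish _ (hyX t) ?_ ht
      simp only [hBe, Finset.mem_insert, Finset.mem_singleton, not_or]
      exact ⟨(hxy 0 t).symm, (hxy 1 t).symm, (hxy 2 t).symm⟩

/-! ### Faces of a cell on which a tangent direction is minimal -/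

/-- Four triples of the octahedron at `i2` are zeros of `g`, so `v` is balanced on them. It vanishes
on three of them, hence on the fourth. In the exchange graph of the basis `{i, i1, i2}` this closes
the path i, j1, i1, j by the edge from i to j. -/
lemma no_short_path {n : ℕ} {g k v : DSubset 3 n → ℝ} (hk : ThreeTerm (val k))
    (hknn : ∀ X, 0 ≤ k X) (hkgv : ∀ X, k X = 0 ↔ g X = 0 ∧ v X = 0)
    (hv : ∀ h i j k l, [h, i, j, k, l].Nodup → val g h i j = 0 → val g h k l = 0 →
      val g h i k = 0 → val g h j l = 0 → val v h i j + val v h k l = val v h i k + val v h j l)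
    {i i1 i2 j j1 : Fin n} (nd : [i, i1, i2, j1, j].Nodup)
    (h0 : val k i i1 i2 = 0) (h1 : val k j1 i1 i2 = 0) (h2 : val k i j1 i2 = 0)
    (h3 : val k i j i2 = 0) (h4 : val g j i1 i2 = 0) : val k j i1 i2 = 0 := by
  have hkv : ∀ i j l, val k i j l = 0 ↔ val g i j l = 0 ∧ val v i j l = 0 := by
    intro i j l
    unfold val
    split_ifs
    · exact hkgv _
    · simp
  by_contra hne
  have nd1 : [i2, j1, i1, i, j].Nodup := by
    simp only [List.nodup_cons, List.mem_cons, not_or, List.not_mem_nil, not_false_eq_true,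
      and_true, List.nodup_nil] at nd ⊢
    grind
  have nd2 : [i2, j1, i, i1, j].Nodup := by
    simp only [List.nodup_cons, List.mem_cons, not_or, List.not_mem_nil, not_false_eq_true,
      and_true, List.nodup_nil] at nd ⊢
    grind
  have hpos : 0 < val k j i1 i2 := (val_nonneg hknn _ _ _).lt_of_ne (Ne.symm hne)
  have key := hk _ _ _ _ _ nd1
  have t := hv _ _ _ _ _ nd2
  have n1 := val_nonneg hknn i2 j1 i
  have n2 := val_nonneg hknn i2 j1 j
  have n3 := val_nonneg hknn i2 i1 i
  have e : val k j1 j i2 = 0 := by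
    simp only [val_swap_left, val_swap_right] at key n1 n2 n3 h0 h1 h2 h3 hpos ⊢
    rcases key with key | key <;> linarith
  have a0 := (hkv _ _ _).1 h0
  have a1 := (hkv _ _ _).1 h1
  have a2 := (hkv _ _ _).1 h2
  have a3 := (hkv _ _ _).1 h3
  have a5 := (hkv _ _ _).1 e
  apply hne
  rw [hkv]
  refine ⟨h4, ?_⟩
  simp only [val_swap_left, val_swap_right] at t h4 a0 a1 a2 a3 a5 ⊢
  have := t a2.1 h4 a1.1 a3.1
  linarith

/-- The path in the exchange graph is now i, j1, i1, j2, i2, j. If the conclusion fails,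
`no_short_path` excludes the shortcuts. After the basis is replaced by `{i, j1, i2}` the path
shortens to i, j2, i2, j, and `no_short_path` applies there. -/
lemma no_long_path {n : ℕ} {g k v : DSubset 3 n → ℝ} (hk : ThreeTerm (val k))
    (hknn : ∀ X, 0 ≤ k X) (hg : ThreeTerm (val g)) (hgnn : ∀ X, 0 ≤ g X)
    (hkgv : ∀ X, k X = 0 ↔ g X = 0 ∧ v X = 0)
    (hv : ∀ h i j k l, [h, i, j, k, l].Nodup → val g h i j = 0 → val g h k l = 0 →
      val g h i k = 0 → val g h j l = 0 → val v h i j + val v h k l = val v h i k + val v h j l)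
    {i i1 i2 j j1 j2 : Fin n} (nd : [i, i1, i2, j1, j2, j].Nodup)
    (h0 : val k i i1 i2 = 0) (h1 : val k j1 i1 i2 = 0) (h2 : val k i j1 i2 = 0)
    (h3 : val k i j2 i2 = 0) (h4 : val k i i1 j2 = 0) (h5 : val k i i1 j = 0)
    (h6 : val g j i1 i2 = 0) : val k j i1 i2 = 0 := by
  have hkv : ∀ i j l, val k i j l = 0 ↔ val g i j l = 0 ∧ val v i j l = 0 := by
    intro i j l
    unfold val
    split_ifs
    · exact hkgv _
    · simp
  have P := fun {i i1 i2 j j1} => @no_short_path n g k v hk hknn hkgv hv i i1 i2 j j1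
  have K := val_nonneg hknn
  have G := val_nonneg hgnn
  by_contra hne
  have a : val k i j i2 ≠ 0 := fun h => hne (P (by clear * - nd; grind) h0 h1 h2 h h6)
  have b : val g i j i2 ≠ 0 := by
    intro h
    apply a
    have := @P i1 i2 i j j2 (by clear * - nd; grind) (by rw [← h0]; simp only [val_swap_left, val_swap_right]) (by rw [← h3]; simp only [val_swap_left, val_swap_right])
      (by rw [← h4]; simp only [val_swap_left, val_swap_right]) (by rw [← h5]; simp only [val_swap_left, val_swap_right]) (by rw [← h]; simp only [val_swap_left, val_swap_right])
    rw [← this]; simp only [val_swap_left, val_swap_right]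
  have c : val k j2 i1 i2 ≠ 0 := by
    intro h
    apply hne
    have := @P i i2 i1 j j2 (by clear * - nd; grind) (by rw [← h0]; simp only [val_swap_left, val_swap_right]) (by rw [← h]; simp only [val_swap_left, val_swap_right])
      (by rw [← h4]; simp only [val_swap_left, val_swap_right]) (by rw [← h5]; simp only [val_swap_left, val_swap_right]) (by rw [← h6]; simp only [val_swap_left, val_swap_right])
    rw [← this]; simp only [val_swap_left, val_swap_right]
  have d : val k i i1 j1 ≠ 0 := by
    intro h
    apply hne
    have := @P i i2 i1 j j1 (by clear * - nd; grind) (by rw [← h0]; simp only [val_swap_left, val_swap_right]) (by rw [← h1]; simp only [val_swap_left, val_swap_right])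
      (by rw [← h]; simp only [val_swap_left, val_swap_right]) (by rw [← h5]; simp only [val_swap_left, val_swap_right]) (by rw [← h6]; simp only [val_swap_left, val_swap_right])
    rw [← this]; simp only [val_swap_left, val_swap_right]
  have b' := (G _ _ _).lt_of_ne b.symm
  have c' := (K _ _ _).lt_of_ne c.symm
  have d' := (K _ _ _).lt_of_ne d.symm
  have e : val g j j1 i2 = 0 := by
    have n1 := G i2 i1 j1
    have n2 := G i2 i1 i
    have n3 := G j j1 i2
    have q := ((hkv _ _ _).1 h2).1
    have nd' : [i2, i1, j, i, j1].Nodup := by clear * - nd; grind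
    rcases hg _ _ _ _ _ nd' with H | H <;>
      simp only [val_swap_left, val_swap_right] at H n1 n2 n3 b' q h6 ⊢ <;> linarith
  -- Balance at `i2` carries the value of `v` from the old basis to the new one, so that vanishing
  -- at the new one is enough.
  have f : val v j j1 i2 = val v j i1 i2 := by
    have nd' : [i2, i1, j, i, j1].Nodup := by clear * - nd; grind
    have q0 := (hkv _ _ _).1 h0
    have q2 := (hkv _ _ _).1 h2
    have := hv _ _ _ _ _ nd' (by rw [← h6]; simp only [val_swap_left, val_swap_right]) (by rw [← q2.1]; simp only [val_swap_left, val_swap_right])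
      (by rw [← q0.1]; simp only [val_swap_left, val_swap_right]) (by rw [← e]; simp only [val_swap_left, val_swap_right])
    simp only [val_swap_left, val_swap_right] at this q0 q2 ⊢
    linarith
  have e1 : val k j2 i2 j1 = 0 := by
    have nd' : [i2, j1, i1, i, j2].Nodup := by clear * - nd; grind
    have n1 := K i2 j1 i
    have n2 := K i2 i1 i
    have n3 := K j2 i2 j1
    rcases hk _ _ _ _ _ nd' with H | H <;>
      simp only [val_swap_left, val_swap_right] at H n1 n2 n3 c' h1 h3 ⊢ <;> linarith
  have e2 : val k i j2 j1 = 0 := by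
    have nd' : [i, j1, i2, i1, j2].Nodup := by clear * - nd; grind
    have n1 := K i i2 j2
    have n2 := K i i2 i1
    have n3 := K i j2 j1
    rcases hk _ _ _ _ _ nd' with H | H <;>
      simp only [val_swap_left, val_swap_right] at H n1 n2 n3 d' h2 h4 ⊢ <;> linarith
  have e3 : val k i j j1 = 0 := by
    have nd' : [i, j1, i2, i1, j].Nodup := by clear * - nd; grind
    have n1 := K i i2 j
    have n2 := K i i2 i1
    have n3 := K i j j1
    rcases hk _ _ _ _ _ nd' with H | H <;>
      simp only [val_swap_left, val_swap_right] at H n1 n2 n3 d' h2 h5 ⊢ <;> linarith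
  have fin := @P i i2 j1 j j2 (by clear * - nd; grind) (by rw [← h2]; simp only [val_swap_left, val_swap_right]) e1 e2 e3 (by rw [← e]; simp only [val_swap_left, val_swap_right])
  have fin' := ((hkv _ _ _).1 fin).2
  refine hne ((hkv _ _ _).2 ⟨h6, ?_⟩)
  rw [← f, ← fin']; simp only [val_swap_left, val_swap_right]

/-- A set that is closed under the exchange relation at a basis meets all bases in equally many
elements. -/
lemma card_inter_eq_of_closed {n : ℕ} {N : Set (DSubset 3 n)}
    (hN : ∀ B ∈ N, ∀ X ∈ N, ∀ i ∈ B.1, i ∉ X.1 →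
      ∃ j ∈ X.1, j ∉ B.1 ∧ ∃ Z ∈ N, Z.1 = insert j (B.1.erase i))
    {B : DSubset 3 n} (hB : B ∈ N) {C : Finset (Fin n)}
    (hC : ∀ i ∈ B.1, ∀ j ∉ B.1, (∃ Z ∈ N, Z.1 = insert j (B.1.erase i)) → (i ∈ C ↔ j ∈ C))
    {X : DSubset 3 n} (hX : X ∈ N) : (X.1 ∩ C).card = (B.1 ∩ C).card := by
  induction hm : (X.1 \ B.1).card using Nat.strong_induction_on generalizing X with
  | _ m ih =>
  subst hm
  -- Exchanging `x` for an element of `B` brings `X` closer to `B`, so the new set already meets `C`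
  -- correctly. If `X` meets `C` too little, all of `X` outside `B` must then avoid `C`; but an
  -- element of `B ∩ C` outside `X` exchanges with one of these, against `hC`. The other case is
  -- dual.
  have step : ∀ x ∈ X.1, x ∉ B.1 → ∃ b ∈ B.1, b ∉ X.1 ∧
      (insert b (X.1.erase x) ∩ C).card = (B.1 ∩ C).card := by
    intro x hx hxB
    obtain ⟨b, hb, hbX, Z, hZ, hZe⟩ := hN X hX B hB x hx hxB
    refine ⟨b, hb, hbX, ?_⟩
    rw [← hZe]
    refine ih _ ?_ hZ rfl
    apply Finset.card_lt_card
    rw [hZe, Finset.ssubset_iff_of_subset (by grind)]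
    exact ⟨x, by grind, by grind⟩
  have cX := Finset.card_inter_add_card_sdiff X.1 C
  have cB := Finset.card_inter_add_card_sdiff B.1 C
  rw [X.2] at cX
  rw [B.2] at cB
  rcases lt_trichotomy (X.1 ∩ C).card (B.1 ∩ C).card with hlt | heq | hgt
  · exfalso
    have hX' : ∀ x ∈ X.1, x ∉ B.1 → x ∉ C := by
      intro x hx hxB hxC
      obtain ⟨b, hb, hbX, e⟩ := step x hx hxB
      have : (insert b (X.1.erase x) ∩ C).card ≤ (insert b ((X.1 ∩ C).erase x)).card :=
        Finset.card_le_card (by grind)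
      have h2 := Finset.card_insert_le b ((X.1 ∩ C).erase x)
      have h3 := Finset.card_erase_add_one (s := X.1 ∩ C) (a := x) (by grind)
      omega
    obtain ⟨i, hi, hiX⟩ := Finset.exists_mem_notMem_of_card_lt_card hlt
    rw [Finset.mem_inter] at hi
    obtain ⟨j, hj, hjB, hZ⟩ := hN B hB X hX i hi.1 (by grind)
    exact hX' j hj hjB ((hC i hi.1 j hjB hZ).1 hi.2)
  · exact heq
  · exfalso
    have hX' : ∀ x ∈ X.1, x ∉ B.1 → x ∈ C := by
      intro x hx hxB
      by_contra hxC
      obtain ⟨b, hb, hbX, e⟩ := step x hx hxB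
      have : (X.1 ∩ C).card ≤ (insert b (X.1.erase x) ∩ C).card :=
        Finset.card_le_card (by grind)
      omega
    have : (X.1 \ C).card < (B.1 \ C).card := by omega
    obtain ⟨i, hi, hiX⟩ := Finset.exists_mem_notMem_of_card_lt_card this
    rw [Finset.mem_sdiff] at hi
    obtain ⟨j, hj, hjB, hZ⟩ := hN B hB X hX i hi.1 (by grind)
    exact hi.2 ((hC i hi.1 j hjB hZ).2 (hX' j hj hjB))
-- Tangent directions are linear on cells
open Filter Topology in
lemma eventually_add_mul_lt {x y : ℝ} (h : x < y) (p q : ℝ) :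
    ∀ᶠ ε in 𝓝[>] (0 : ℝ), x + ε * p < y + ε * q := by
  apply Filter.Eventually.filter_mono nhdsWithin_le_nhds
  have h1 : Tendsto (fun ε : ℝ => x + ε * p) (𝓝 0) (𝓝 (x + 0 * p)) :=
    (Continuous.tendsto (by fun_prop) 0)
  have h2 : Tendsto (fun ε : ℝ => y + ε * q) (𝓝 0) (𝓝 (y + 0 * q)) :=
    (Continuous.tendsto (by fun_prop) 0)
  exact h1.eventually_lt h2 (by simpa using h)

/-- `u` takes equal values on any two terms of a three term relation that are minimal for `g`. -/
def Tangent {n : ℕ} (g u : DSubset 3 n → ℝ) : Prop :=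
  ∀ h i j k l, [h, i, j, k, l].Nodup →
    val g h i j + val g h k l = val g h i k + val g h j l →
    val g h i j + val g h k l ≤ val g h i l + val g h j k →
    val u h i j + val u h k l = val u h i k + val u h j l

open Filter Topology in
-- Strict inequalities between the sums survive a small step. If the first sum is minimal, it is
-- tied with another one, and tangency keeps this tie.
lemma Tangent.eventually_threeTerm {n : ℕ} {g u : DSubset 3 n → ℝ} (hu : Tangent g u)
    (hg : ThreeTerm (val g)) :
    ∀ᶠ ε in 𝓝[>] (0 : ℝ), ThreeTerm (val fun X => g X + ε * u X) := by
  unfold ThreeTerm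
  simp only [eventually_all]
  intro h i j k l nd
  have nd' : [h, i, j, l, k].Nodup := by clear * - nd; grind
  have H1 := hu h i j k l nd
  have H2 := hu h i j l k nd'
  have H3 := hg h i j k l nd
  rw [val_swap_right g h l k, val_swap_right u h l k] at H2
  simp only [val_add, val_smul]
  by_cases c1 : val g h i k + val g h j l < val g h i j + val g h k l
  · filter_upwards [eventually_add_mul_lt c1 (val u h i k + val u h j l)
      (val u h i j + val u h k l)] with ε hε
    left; linarith
  by_cases c2 : val g h i l + val g h j k < val g h i j + val g h k l
  · filter_upwards [eventually_add_mul_lt c2 (val u h i l + val u h j k)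
      (val u h i j + val u h k l)] with ε hε
    right; linarith
  push Not at c1 c2
  refine Eventually.of_forall fun ε => ?_
  rcases H3 with H3 | H3
  · left
    have := H1 (by linarith) c2
    have e : ε * val u h i k + ε * val u h j l = ε * val u h i j + ε * val u h k l := by
      rw [← mul_add, ← mul_add, this]
    linarith
  · right
    have := H2 (by linarith) c1
    have e : ε * val u h i l + ε * val u h j k = ε * val u h i j + ε * val u h k l := by
      rw [← mul_add, ← mul_add, this]
    linarith

/-- The contribution of the linear function is symmetric in the last four indices, so it is the same
for all three terms of a relation and never affects their comparison. -/
lemma val_add_shift_pair {n : ℕ} (g : DSubset 3 n → ℝ) (a : Fin n → ℝ) {h i j k l : Fin n}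
    (nd : [h, i, j, k, l].Nodup) :
    val (fun X => g X + shift a X) h i j + val (fun X => g X + shift a X) h k l =
      val g h i j + val g h k l + (2 * a h + a i + a j + a k + a l) := by
  simp only [List.nodup_cons, List.mem_cons, not_or, List.not_mem_nil, not_false_eq_true] at nd
  obtain ⟨⟨h1, h2, h3, h4, -⟩, ⟨i1, i2, i3, -⟩, ⟨j1, j2, -⟩, ⟨k1, -⟩, -⟩ := nd
  simp only [val_add]
  rw [val_shift a h1 h2 i1, val_shift a h3 h4 k1]
  ring

lemma Tangent.add_shift {n : ℕ} {g u : DSubset 3 n → ℝ} (hu : Tangent g u) (a b : Fin n → ℝ) :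
    Tangent (fun X => g X + shift a X) (fun X => u X + shift b X) := by
  intro h i j k l nd h1 h2
  have nd' : [h, i, k, j, l].Nodup := by clear * - nd; grind
  have nd'' : [h, i, l, j, k].Nodup := by clear * - nd; grind
  rw [val_add_shift_pair g a nd, val_add_shift_pair g a nd'] at h1
  rw [val_add_shift_pair g a nd, val_add_shift_pair g a nd''] at h2
  rw [val_add_shift_pair u b nd, val_add_shift_pair u b nd']
  have := hu h i j k l nd (by linarith) (by linarith)
  linarith

/-- In the exchange graph of the zero `{i, b, c}` of `k`, the set `C` is closed and separates `j`
from `i`. A path between them can pass only through `b` and `c` on the inner side, so it has length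
one, three or five; these are excluded by `hne`, `no_short_path` and `no_long_path`. -/
lemma exists_closed_of_adj {n : ℕ} {g k v : DSubset 3 n → ℝ} (hk : ThreeTerm (val k))
    (hknn : ∀ X, 0 ≤ k X) (hg : ThreeTerm (val g)) (hgnn : ∀ X, 0 ≤ g X)
    (hkgv : ∀ X, k X = 0 ↔ g X = 0 ∧ v X = 0)
    (hv : ∀ h i j k l, [h, i, j, k, l].Nodup → val g h i j = 0 → val g h k l = 0 →
      val g h i k = 0 → val g h j l = 0 → val v h i j + val v h k l = val v h i k + val v h j l)
    {i b c j : Fin n} (nd : [i, b, c, j].Nodup)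
    (h0 : val k i b c = 0) (hj : val g j b c = 0) (hne : val k j b c ≠ 0)
    (hb : val k i j c = 0) :
    ∃ C : Finset (Fin n), j ∈ C ∧ i ∉ C ∧ ∀ y, y ≠ i → y ≠ b → y ≠ c →
      (val k y b c = 0 → (i ∈ C ↔ y ∈ C)) ∧ (val k i y c = 0 → (b ∈ C ↔ y ∈ C)) ∧
      (val k i b y = 0 → (c ∈ C ↔ y ∈ C)) := by
  classical
  have P := fun {i i1 i2 j j1} => @no_short_path n g k v hk hknn hkgv hv i i1 i2 j j1
  have L := fun {i i1 i2 j j1 j2} =>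
    @no_long_path n g k v hk hknn hg hgnn hkgv hv i i1 i2 j j1 j2
  have nd0 := nd
  simp only [List.nodup_cons, List.mem_cons, not_or, List.not_mem_nil, not_false_eq_true] at nd0
  obtain ⟨⟨ib, ic, ij, -⟩, ⟨bc, bj, -⟩, ⟨cj, -⟩, -⟩ := nd0
  have hib : ∀ y, y ≠ i → y ≠ b → y ≠ c → val k y b c = 0 → val k i y c = 0 → False := by
    intro y yi yb yc h1 h2
    by_cases yj : y = j
    · exact hne (yj ▸ h1)
    · exact hne (P (j1 := y) (by simp [*, Ne.symm, yi.symm, yb.symm, yc.symm]) h0 h1 h2 hb hj)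
  by_cases hx : ∃ x, x ≠ i ∧ x ≠ b ∧ x ≠ c ∧ val k i x c = 0 ∧ val k i b x = 0
  -- Here `b` and `c` have the common neighbour `x`, so `C` consists of both and all their
  -- neighbours. In the other case `b` with its neighbours is already closed.
  · obtain ⟨x, xi, xb, xc, hx1, hx2⟩ := hx
    refine ⟨Finset.univ.filter fun y => y = b ∨ y = c ∨
      (y ≠ i ∧ y ≠ b ∧ y ≠ c ∧ (val k i y c = 0 ∨ val k i b y = 0)), ?_, ?_, ?_⟩
    · simp [Ne.symm ij, Ne.symm bj, Ne.symm cj, hb]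
    · simp [ib, ic]
    · intro y yi yb yc
      refine ⟨fun hy => ?_, fun hy => by simp [yi, yb, yc, hy], fun hy => by simp [yi, yb, yc, hy]⟩
      simp only [Finset.mem_filter, Finset.mem_univ, true_and, ib, ic, yi, yb, yc, ne_eq,
        not_true_eq_false, false_and, or_self, not_false_eq_true, false_or, false_iff, not_or]
      refine ⟨hib y yi yb yc hy, fun hy2 => ?_⟩
      by_cases yj : y = j
      · exact hne (yj ▸ hy)
      by_cases cj' : val k i b j = 0
      · have := @P i c b j y (by simp [*, yi.symm, yb.symm, yc.symm, Ne.symm bc])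
          (by rw [val_swap_right, h0]) (by rw [val_swap_right, hy]) (by rw [val_swap_right, hy2])
          (by rw [val_swap_right, cj']) (by rw [val_swap_right, hj])
        exact hne (by rw [val_swap_right, this])
      have xj : x ≠ j := fun h => cj' (h ▸ hx2)
      have xy : x ≠ y := fun h => hib x xi xb xc (h ▸ hy) hx1
      have := @L i c b j y x
        (by simp [*, yi.symm, yb.symm, yc.symm, Ne.symm bc, xi.symm, xb.symm, xc.symm, xy.symm])
        (by rw [val_swap_right, h0]) (by rw [val_swap_right, hy]) (by rw [val_swap_right, hy2])
        (by rw [val_swap_right, hx2]) (by rw [val_swap_right, hx1]) (by rw [val_swap_right, hb])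
        (by rw [val_swap_right, hj])
      exact hne (by rw [val_swap_right, this])
  · push Not at hx
    refine ⟨Finset.univ.filter fun y => y = b ∨
      (y ≠ i ∧ y ≠ b ∧ y ≠ c ∧ val k i y c = 0), ?_, ?_, ?_⟩
    · simp [Ne.symm ij, Ne.symm bj, Ne.symm cj, hb]
    · simp [ib, ic]
    · intro y yi yb yc
      refine ⟨fun hy => ?_, fun hy => by simp [yi, yb, yc, hy], fun hy => ?_⟩
      · simp only [Finset.mem_filter, Finset.mem_univ, true_and, ib, ic, yi, yb, yc, ne_eq,
          not_true_eq_false, false_and, or_self, not_false_eq_true, false_or, false_iff]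
        exact hib y yi yb yc hy
      · have := fun h => hx y yi yb yc h hy
        simpa [yi, yb, yc, Ne.symm bc] using this

/-- The time `τ` is the least ratio `f x / d x` over the points with `d x` positive. -/
lemma exists_first_hit {α : Type*} [Finite α] {f d : α → ℝ} (hf : ∀ x, 0 ≤ f x)
    (hd : ∀ x, 0 < d x → 0 < f x) (hex : ∃ x, 0 < d x) :
    ∃ τ > 0, (∀ x, 0 ≤ f x - τ * d x) ∧ ∃ x, 0 < d x ∧ f x - τ * d x = 0 := by
  obtain ⟨x0, hx0, hmin⟩ := Set.exists_min_image {x | 0 < d x} (fun x => f x / d x)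
    (Set.toFinite _) hex
  refine ⟨f x0 / d x0, div_pos (hd x0 hx0) hx0, fun x => ?_, x0, hx0, ?_⟩
  · by_cases hx : 0 < d x
    · have := hmin x hx
      rw [div_le_div_iff₀ hx0 hx] at this
      rw [sub_nonneg, div_mul_eq_mul_div, div_le_iff₀ hx0]
      exact this
    · have h1 : f x0 / d x0 * d x ≤ 0 :=
        mul_nonpos_of_nonneg_of_nonpos (div_pos (hd x0 hx0) hx0).le (not_lt.1 hx)
      linarith [hf x]
  · have : d x0 ≠ 0 := ne_of_gt hx0
    field_simp
    ring

open Filter Topology in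
/-- If the direction `u + b` is nonnegative but not identically zero on the zero set of `g`, its
zero set there can be enlarged. -/
lemma exists_larger_face {n : ℕ} {g u : DSubset 3 n → ℝ} (hg : ThreeTerm (val g))
    (hgnn : ∀ X, 0 ≤ g X) (hu : Tangent g u) {b : Fin n → ℝ}
    (hb : ∀ X, g X = 0 → 0 ≤ u X + shift b X) (hb0 : ∃ X, g X = 0 ∧ u X + shift b X = 0)
    (hne : ∃ X, g X = 0 ∧ u X + shift b X ≠ 0) :
    ∃ b' : Fin n → ℝ, (∀ X, g X = 0 → 0 ≤ u X + shift b' X) ∧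
      {X | g X = 0 ∧ u X + shift b X = 0} ⊂ {X | g X = 0 ∧ u X + shift b' X = 0} := by
  set v : DSubset 3 n → ℝ := fun X => u X + shift b X with hvdef
  have hv : Tangent g v := by
    have := hu.add_shift (fun _ => 0) b
    simpa only [shift_const, mul_zero, add_zero] using this
  have hv0 : ∀ h i j k l, [h, i, j, k, l].Nodup → val g h i j = 0 → val g h k l = 0 →
      val g h i k = 0 → val g h j l = 0 →
      val v h i j + val v h k l = val v h i k + val v h j l := by
    intro h i j k l nd h1 h2 h3 h4
    refine hv h i j k l nd (by rw [h1, h2, h3, h4]) ?_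
    have := val_nonneg hgnn h i l
    have := val_nonneg hgnn h j k
    linarith
  -- A small step along `v` preserves the three term condition and creates no new zeros. The zero
  -- set of `k` is thus the face of the cell on which `v` vanishes, and this face has the exchange
  -- property too.
  obtain ⟨ε, hε, hk, hpos⟩ : ∃ ε > 0, ThreeTerm (val fun X => g X + ε * v X) ∧
      ∀ X, 0 < g X → 0 < g X + ε * v X := by
    have h1 := hv.eventually_threeTerm hg
    have h2 : ∀ᶠ ε in 𝓝[>] (0 : ℝ), ∀ X, 0 < g X → 0 < g X + ε * v X := by
      simp only [eventually_all]
      intro X hX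
      simpa using eventually_add_mul_lt hX 0 (v X)
    have h3 : ∀ᶠ ε in 𝓝[>] (0 : ℝ), ε ∈ Set.Ioi (0 : ℝ) := self_mem_nhdsWithin
    obtain ⟨ε, h1, h2, h3⟩ := (h1.and (h2.and h3)).exists
    exact ⟨ε, h3, h1, h2⟩
  set k : DSubset 3 n → ℝ := fun X => g X + ε * v X with hkdef
  have hknn : ∀ X, 0 ≤ k X := by
    intro X
    rcases (hgnn X).eq_or_lt with h | h
    · have := mul_nonneg hε.le (hb X h.symm)
      simp only [hkdef, ← h, zero_add]
      exact this
    · exact (hpos X h).le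
  have hkgv : ∀ X, k X = 0 ↔ g X = 0 ∧ v X = 0 := by
    intro X
    refine ⟨fun h => ?_, fun h => by simp [hkdef, h.1, h.2]⟩
    rcases (hgnn X).eq_or_lt with h' | h'
    · refine ⟨h'.symm, ?_⟩
      simp only [hkdef, ← h', zero_add] at h
      exact (mul_eq_zero.1 h).resolve_left hε.ne'
    · exact absurd h (hpos X h').ne'
  obtain ⟨B0, hB0⟩ := hb0
  rw [← hkgv] at hB0
  -- Take a zero of `g` off the face, as close as possible to `B0`. An exchange towards `B0` must
  -- land in the face, which gives neighbours `B` in the face and `B'` outside it.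
  obtain ⟨B', ⟨hB'g, hB'v⟩, hmin⟩ := Set.exists_min_image {X | g X = 0 ∧ v X ≠ 0}
    (fun X => (X.1 \ B0.1).card) (Set.toFinite _) hne
  have hB'B0 : ∃ x ∈ B'.1, x ∉ B0.1 := by
    by_contra! hsub
    have : B' = B0 := Subtype.ext (Finset.eq_of_subset_of_card_le hsub (by rw [B'.2, B0.2]))
    exact hB'v (this ▸ ((hkgv B0).1 hB0).2)
  obtain ⟨j, hjB', hjB0⟩ := hB'B0
  obtain ⟨i, hiB0, hiB', B, hBg, hBe⟩ := hg.exchange hgnn hB'g ((hkgv B0).1 hB0).1 hjB' hjB0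
  have hBv : v B = 0 := by
    by_contra hBv
    have h1 := hmin B ⟨hBg, hBv⟩
    have h2 : (B.1 \ B0.1).card < (B'.1 \ B0.1).card := by
      apply Finset.card_lt_card
      rw [hBe, Finset.ssubset_iff_of_subset (by grind)]
      exact ⟨j, by grind, by grind⟩
    omega
  have hBk : k B = 0 := (hkgv B).2 ⟨hBg, hBv⟩
  have hc2 : (B'.1.erase j).card = 2 := by rw [Finset.card_erase_of_mem hjB', B'.2]
  obtain ⟨p, q, hpq, hpqe⟩ := Finset.card_eq_two.1 hc2
  have hBe' : B.1 = {i, p, q} := by rw [hBe, hpqe]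
  have hB'e : B'.1 = {j, p, q} := by rw [← hpqe, Finset.insert_erase hjB']
  have hip : i ≠ p := by rintro rfl; exact hiB' (by simp [hB'e])
  have hiq : i ≠ q := by rintro rfl; exact hiB' (by simp [hB'e])
  have hij : i ≠ j := by rintro rfl; exact hiB' (by simp [hB'e])
  have hjp : j ≠ p := by
    rintro rfl; exact Finset.notMem_erase j B'.1 (by rw [hpqe]; simp)
  have hjq : j ≠ q := by
    rintro rfl; exact Finset.notMem_erase j B'.1 (by rw [hpqe]; simp)
  have k0 : val k i p q = 0 := by rw [val_eq k hBe', hBk]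
  have g0 : val g j p q = 0 := by rw [val_eq g hB'e, hB'g]
  have k1 : val k j p q ≠ 0 := by
    rw [val_eq k hB'e]
    exact fun h => hB'v ((hkgv _).1 h).2
  -- A closed set of the exchange graph at `B` that contains `j` but not `i`; if `j` is isolated,
  -- `{j}` itself works.
  obtain ⟨C, hjC, hiC, hC⟩ : ∃ C : Finset (Fin n), j ∈ C ∧ i ∉ C ∧ ∀ y, y ≠ i → y ≠ p → y ≠ q →
      (val k y p q = 0 → (i ∈ C ↔ y ∈ C)) ∧ (val k i y q = 0 → (p ∈ C ↔ y ∈ C)) ∧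
      (val k i p y = 0 → (q ∈ C ↔ y ∈ C)) := by
    by_cases hp : val k i j q = 0
    · exact exists_closed_of_adj hk hknn hg hgnn hkgv hv0 (by simp [*, hjp.symm, hjq.symm])
        k0 g0 k1 hp
    by_cases hq : val k i p j = 0
    · obtain ⟨C, hjC, hiC, hC⟩ := @exists_closed_of_adj n g k v hk hknn hg hgnn hkgv hv0 i q p j
        (by simp [*, hjp.symm, hjq.symm, hpq.symm])
        (by rw [val_swap_right, k0]) (by rw [val_swap_right, g0]) (by rwa [val_swap_right])
        (by rw [val_swap_right, hq])
      refine ⟨C, hjC, hiC, fun y y1 y2 y3 => ?_⟩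
      obtain ⟨c1, c2, c3⟩ := hC y y1 y3 y2
      exact ⟨by rwa [val_swap_right], by rwa [val_swap_right], by rwa [val_swap_right]⟩
    · refine ⟨{j}, by simp, by simp [hij], fun y y1 y2 y3 => ⟨fun h => ?_, fun h => ?_, fun h => ?_⟩⟩
      · have : y ≠ j := fun e => k1 (e ▸ h)
        simp [hij, this]
      · have : y ≠ j := fun e => hp (e ▸ h)
        simp [hjp.symm, this]
      · have : y ≠ j := fun e => hq (e ▸ h)
        simp [hjq.symm, this]
  have hcount : ∀ X, k X = 0 → (X.1 ∩ C).card = (B.1 ∩ C).card := by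
    intro X hX
    refine card_inter_eq_of_closed (N := {X | k X = 0}) (fun B hB X hX i hi hi' =>
      hk.exchange hknn hB hX hi hi') hBk ?_ hX
    rintro x hx y hy ⟨Z, hZ, hZe⟩
    have hZ' : k Z = 0 := hZ
    simp only [hBe', Finset.mem_insert, Finset.mem_singleton, not_or] at hx hy
    obtain ⟨c1, c2, c3⟩ := hC y hy.1 hy.2.1 hy.2.2
    rcases hx with rfl | rfl | rfl
    · refine c1 ?_
      rw [val_eq k (X := Z), hZ']
      rw [hZe, hBe']; ext z; grind
    · refine c2 ?_
      rw [val_eq k (X := Z), hZ']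
      rw [hZe, hBe']; ext z; grind
    · refine c3 ?_
      rw [val_eq k (X := Z), hZ']
      rw [hZe, hBe']; ext z; grind
  set m := (B.1 ∩ C).card with hm
  classical
  -- Every triple in the face meets `C` in `m` elements. Taking `m / 3` off each coordinate makes
  -- the linear function vanish on the face; on `B'` it is one.
  set c : Fin n → ℝ := fun y => (if y ∈ C then 1 else 0) - m / 3 with hcdef
  have hshift : ∀ X : DSubset 3 n, shift c X = ((X.1 ∩ C).card : ℝ) - m := by
    intro X
    simp only [hcdef, shift, Finset.sum_sub_distrib, Finset.sum_const, X.2, Finset.sum_ite_mem]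
    simp
    ring
  have hcB' : shift c B' = 1 := by
    have : (B'.1 ∩ C).card = m + 1 := by
      have e1 : B'.1 ∩ C = insert j (B.1 ∩ C) := by
        rw [hB'e, hBe']; ext z; simp only [Finset.mem_inter, Finset.mem_insert,
          Finset.mem_singleton]; grind
      rw [e1, Finset.card_insert_of_notMem]
      rw [hBe']
      simp [hij.symm, hjp, hjq]
    rw [hshift, this]
    push_cast
    ring
  -- Subtract `c` until a new zero `X0` appears. There `c` is positive, so `X0` was not in the face,
  -- while the face keeps its zeros.
  obtain ⟨τ, hτ, h1, ⟨X0, hX0g⟩, hX0, h2⟩ := exists_first_hit (α := {X : DSubset 3 n // g X = 0})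
    (f := fun X => v X.1) (d := fun X => shift c X.1) (fun X => hb X.1 X.2) (by
      rintro ⟨X, hX⟩ hd
      refine (hb X hX).lt_of_ne fun h0 => ?_
      have := hcount X ((hkgv X).2 ⟨hX, h0.symm⟩)
      simp only [hshift, this, sub_self, lt_self_iff_false] at hd) ⟨⟨B', hB'g⟩, by
        simp only [hcB']; norm_num⟩
  have hval : ∀ X, u X + shift (fun i => b i - τ * c i) X = v X - τ * shift c X := by
    intro X
    rw [shift_sub, shift_mul]
    simp only [hvdef]
    ring
  refine ⟨fun i => b i - τ * c i, fun X hX => ?_, ?_⟩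
  · rw [hval]
    exact h1 ⟨X, hX⟩
  · rw [Set.ssubset_iff_of_subset]
    · refine ⟨X0, ⟨hX0g, by rw [hval]; exact h2⟩, fun h => ?_⟩
      have := hcount X0 ((hkgv X0).2 h)
      simp only [hshift, this, sub_self, lt_self_iff_false] at hX0
    · rintro X ⟨hX, hX'⟩
      refine ⟨hX, ?_⟩
      have := hcount X ((hkgv X).2 ⟨hX, hX'⟩)
      rw [hval, hshift, this, sub_self, mul_zero, sub_zero]
      exact hX'

/-- A tangent direction is a linear function on the zero set of `g`. -/
lemma Tangent.exists_shift {n : ℕ} {g u : DSubset 3 n → ℝ} (hg : ThreeTerm (val g))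
    (hgnn : ∀ X, 0 ≤ g X) (hg0 : ∃ X, g X = 0) (hu : Tangent g u) :
    ∃ b : Fin n → ℝ, ∀ X, g X = 0 → u X + shift b X = 0 := by
  by_contra! hne
  -- Start with the constant that makes the minimum on the cell zero. As long as `u + shift b` is
  -- not identically zero there, its zero set can be enlarged, beyond the number of all triples.
  have key : ∀ m : ℕ, ∃ b : Fin n → ℝ, (∀ X, g X = 0 → 0 ≤ u X + shift b X) ∧
      (∃ X, g X = 0 ∧ u X + shift b X = 0) ∧
      m ≤ {X | g X = 0 ∧ u X + shift b X = 0}.ncard := by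
    intro m
    induction m with
    | zero =>
      obtain ⟨X0, hX0, hmin⟩ := Set.exists_min_image {X | g X = 0} u (Set.toFinite _) hg0
      refine ⟨fun _ => -(u X0 / 3), fun X hX => ?_, ⟨X0, hX0, ?_⟩, Nat.zero_le _⟩
      · rw [shift_const]
        linarith [hmin X hX]
      · rw [shift_const]
        ring
    | succ m ih =>
      obtain ⟨b, h1, h2, h3⟩ := ih
      obtain ⟨b', h1', h2'⟩ := exists_larger_face hg hgnn hu h1 h2 (hne b)
      obtain ⟨X, hX⟩ := h2
      exact ⟨b', h1', ⟨X, h2'.subset hX⟩, h3.trans_lt (Set.ncard_lt_ncard h2' (Set.toFinite _))⟩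
  obtain ⟨b, -, -, h⟩ := key (Nat.card (DSubset 3 n) + 1)
  have := Set.ncard_le_card {X | g X = 0 ∧ u X + shift b X = 0}
  omega

/-! ### Cells along a segment -/

/-- `M` is the set of vertices of a cell of the regular subdivision induced by `w`. -/
def IsCell {n : ℕ} (w : DSubset 3 n → ℝ) (M : Set (DSubset 3 n)) : Prop :=
  ∃ a : Fin n → ℝ, (∀ X, 0 ≤ w X + shift a X) ∧ M.Nonempty ∧ ∀ X, X ∈ M ↔ w X + shift a X = 0

open Filter Topology in
-- On `M'` the two weights differ by a linear function. The functional `a - b`, which cuts out `M`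
-- inside `M'`, therefore does so for `w'` too after being scaled by a small `ε`.
lemma IsCell.face {n : ℕ} {w w' : DSubset 3 n → ℝ} {M M' : Set (DSubset 3 n)}
    (h1 : IsCell w M) (h2 : IsCell w M') (h3 : IsCell w' M') (h : M ⊆ M') : IsCell w' M := by
  obtain ⟨a, ha, hne, ha'⟩ := h1
  obtain ⟨b, hb, -, hb'⟩ := h2
  obtain ⟨c, hc, -, hc'⟩ := h3
  obtain ⟨ε, hε, hpos⟩ : ∃ ε > 0, ∀ X, 0 < w' X + shift c X →
      0 < w' X + shift c X + ε * (shift a X - shift b X) := by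
    have h2 : ∀ᶠ ε in 𝓝[>] (0 : ℝ), ∀ X, 0 < w' X + shift c X →
        0 < w' X + shift c X + ε * (shift a X - shift b X) := by
      simp only [eventually_all]
      intro X hX
      simpa using eventually_add_mul_lt hX 0 (shift a X - shift b X)
    have h3 : ∀ᶠ ε in 𝓝[>] (0 : ℝ), ε ∈ Set.Ioi (0 : ℝ) := self_mem_nhdsWithin
    obtain ⟨ε, h2, h3⟩ := (h2.and h3).exists
    exact ⟨ε, h3, h2⟩
  have hs : ∀ X, w' X + shift (fun i => c i + ε * (a i - b i)) X =
      w' X + shift c X + ε * (shift a X - shift b X) := by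
    intro X
    rw [shift_add, shift_mul, shift_sub, add_assoc]
  have hM' : ∀ X, X ∈ M' → w' X + shift c X + ε * (shift a X - shift b X) =
      ε * (w X + shift a X) := by
    intro X hX
    rw [(hc' X).1 hX]
    linear_combination (-ε) * (hb' X).1 hX
  refine ⟨fun i => c i + ε * (a i - b i), fun X => ?_, hne, fun X => ?_⟩ <;> rw [hs] <;>
    by_cases hX : X ∈ M'
  · rw [hM' X hX]
    exact mul_nonneg hε.le (ha X)
  · exact (hpos X ((hc X).lt_of_ne fun h => hX ((hc' X).2 h.symm))).le
  · rw [hM' X hX, ha', mul_eq_zero]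
    simp [hε.ne']
  · have := hpos X ((hc X).lt_of_ne fun h => hX ((hc' X).2 h.symm))
    exact ⟨fun hXM => absurd (h hXM) hX, fun h0 => absurd h0 this.ne'⟩

/-- Since `u` is linear on `M`, the supporting function of `M` can be carried along the segment. If
another triple touches it on the way, a larger cell has appeared. By induction on the number of
triples outside, the larger cell exists at both ends, and `M` is a face of it. -/
lemma IsCell.of_segment {n : ℕ} {w u : DSubset 3 n → ℝ} {I : Set ℝ} (hI : Convex ℝ I)
    (hw : ∀ s ∈ I, ThreeTerm (val fun X => w X + s * u X))
    (hu : ∀ s ∈ I, Tangent (fun X => w X + s * u X) u) {s t : ℝ} (hs : s ∈ I) (ht : t ∈ I)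
    {M : Set (DSubset 3 n)} (hM : IsCell (fun X => w X + s * u X) M) :
    IsCell (fun X => w X + t * u X) M := by
  induction hm : Nat.card (DSubset 3 n) - M.ncard using Nat.strong_induction_on
    generalizing M s t with
  | _ m ih =>
  subst hm
  have hM0 := hM
  obtain ⟨a, ha, hne, ha'⟩ := hM
  obtain ⟨b, hb⟩ := Tangent.exists_shift ((hw s hs).val_add_shift a) ha
    (hne.imp fun X hX => (ha' X).1 hX) ((hu s hs).add_shift a 0)
  simp only [shift, Pi.zero_apply, Finset.sum_const_zero, add_zero] at hb
  change ∀ X, w X + s * u X + shift a X = 0 → u X + shift b X = 0 at hb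
  have hform : ∀ r X, w X + (s + r) * u X + shift (fun i => a i + r * b i) X =
      (w X + s * u X + shift a X) - r * -(u X + shift b X) := by
    intro r X
    rw [shift_add, shift_mul]
    ring
  by_cases hall : ∀ X, X ∉ M → 0 < (w X + s * u X + shift a X) - (t - s) * -(u X + shift b X)
  · have hMt : ∀ X, X ∈ M →
        (w X + s * u X + shift a X) - (t - s) * -(u X + shift b X) = 0 := by
      intro X hX
      rw [hb X ((ha' X).1 hX), (ha' X).1 hX]
      ring
    have e : s + (t - s) = t := by ring
    refine ⟨fun i => a i + (t - s) * b i, fun X => ?_, hne, fun X => ?_⟩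
    · have := hform (t - s) X
      rw [e] at this
      rw [this]
      by_cases hX : X ∈ M
      · exact (hMt X hX).ge
      · exact (hall X hX).le
    · have := hform (t - s) X
      rw [e] at this
      rw [this]
      exact ⟨hMt X, fun h0 => by_contra fun hX => (hall X hX).ne' h0⟩
  · push Not at hall
    obtain ⟨X1, hX1, hX1'⟩ := hall
    have hgpos : ∀ X, X ∉ M → 0 < w X + s * u X + shift a X := fun X hX =>
      (ha X).lt_of_ne fun h => hX ((ha' X).2 h.symm)
    -- The first moment at which the moving supporting function vanishes at a triple outside `M`, as
    -- a fraction of the way from `s` to `t`.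
    obtain ⟨τ, hτ, h1, X0, hX0, h2⟩ := exists_first_hit
      (f := fun X => w X + s * u X + shift a X) (d := fun X => (t - s) * -(u X + shift b X)) ha
      (fun X hd => hgpos X fun hX => by
        simp only [hb X ((ha' X).1 hX), neg_zero, mul_zero, lt_self_iff_false] at hd)
      ⟨X1, by have := hgpos X1 hX1; linarith⟩
    have hτ1 : τ ≤ 1 := by
      have := h1 X1
      have h3 := hgpos X1 hX1
      by_contra! hlt
      have h4 : 1 * ((t - s) * -(u X1 + shift b X1)) < τ * ((t - s) * -(u X1 + shift b X1)) :=
        mul_lt_mul_of_pos_right hlt (by linarith)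
      linarith
    have hr : s + τ * (t - s) ∈ I := by
      have := hI hs ht (sub_nonneg.2 hτ1) hτ.le (by ring)
      convert this using 1
      simp only [smul_eq_mul]
      ring
    have hform' : ∀ X, w X + (s + τ * (t - s)) * u X + shift (fun i => a i + τ * (t - s) * b i) X
        = w X + s * u X + shift a X - τ * ((t - s) * -(u X + shift b X)) := by
      intro X
      rw [hform, mul_assoc]
    have hcell : IsCell (fun X => w X + (s + τ * (t - s)) * u X)
        {X | w X + s * u X + shift a X - τ * ((t - s) * -(u X + shift b X)) = 0} := by
      refine ⟨fun i => a i + τ * (t - s) * b i, fun X => ?_, ⟨X0, h2⟩, fun X => ?_⟩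
      · rw [hform']; exact h1 X
      · rw [hform']; rfl
    have hsub : M ⊂ {X | w X + s * u X + shift a X - τ * ((t - s) * -(u X + shift b X)) = 0} := by
      rw [Set.ssubset_iff_of_subset]
      · refine ⟨X0, h2, fun hX => ?_⟩
        simp only [hb X0 ((ha' X0).1 hX), neg_zero, mul_zero, lt_self_iff_false] at hX0
      · intro X hX
        have h0 := (ha' X).1 hX
        simp only at h0
        simp only [Set.mem_ofPred_eq, hb X h0, h0]
        ring
    have hlt := Set.ncard_lt_ncard hsub (Set.toFinite _)
    have hle := Set.ncard_le_card
      {X | w X + s * u X + shift a X - τ * ((t - s) * -(u X + shift b X)) = 0}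
    have c1 := ih _ (by omega) hr hs hcell rfl
    have c2 := ih _ (by omega) hr ht hcell rfl
    exact hM0.face c1 c2 hsub.subset

/-- The same terms of all three term relations are minimal for `w` and for `w'`. -/
def SameMin {n : ℕ} (w w' : DSubset 3 n → ℝ) : Prop :=
  ∀ h i j k l, [h, i, j, k, l].Nodup →
    ((val w h i j + val w h k l ≤ val w h i k + val w h j l ∧
      val w h i j + val w h k l ≤ val w h i l + val w h j k) ↔
    (val w' h i j + val w' h k l ≤ val w' h i k + val w' h j l ∧
      val w' h i j + val w' h k l ≤ val w' h i l + val w' h j k))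

lemma SameMin.symm {n : ℕ} {w w' : DSubset 3 n → ℝ} (h : SameMin w w') : SameMin w' w :=
  fun i j k l m nd => (h i j k l m nd).symm

lemma convex_three_threeTerm {a b c a' b' c' s : ℝ} (h0 : 0 ≤ s) (h1 : s ≤ 1)
    (h : b ≤ a ∨ c ≤ a)
    (eb : (b ≤ a ∧ b ≤ c) ↔ (b' ≤ a' ∧ b' ≤ c')) (ec : (c ≤ a ∧ c ≤ b) ↔ (c' ≤ a' ∧ c' ≤ b')) :
    b + s * (b' - b) ≤ a + s * (a' - a) ∨ c + s * (c' - c) ≤ a + s * (a' - a) := by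
  have key : ∀ {x x' y y' : ℝ}, x ≤ y → x' ≤ y' → x + s * (x' - x) ≤ y + s * (y' - y) := by
    intro x x' y y' hx hx'
    nlinarith
  by_cases hbc : b ≤ a ∧ b ≤ c
  · exact Or.inl (key hbc.1 (eb.1 hbc).1)
  by_cases hcb : c ≤ a ∧ c ≤ b
  · exact Or.inr (key hcb.1 (ec.1 hcb).1)
  · exfalso
    rcases h with h | h <;> rcases le_total b c with h2 | h2 <;> grind

/-- Because the lowest terms are the same at both ends, they are the same all along the segment.
Terms tied for the minimum at `s` are then tied at both ends, so they change at equal rates. -/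
lemma convex_three_tangent {a b c a' b' c' s : ℝ} (h0 : 0 ≤ s) (h1 : s ≤ 1)
    (ea : (a ≤ b ∧ a ≤ c) ↔ (a' ≤ b' ∧ a' ≤ c'))
    (eb : (b ≤ a ∧ b ≤ c) ↔ (b' ≤ a' ∧ b' ≤ c')) (ec : (c ≤ a ∧ c ≤ b) ↔ (c' ≤ a' ∧ c' ≤ b'))
    (h : a + s * (a' - a) = b + s * (b' - b)) (h' : a + s * (a' - a) ≤ c + s * (c' - c)) :
    a' - a = b' - b := by
  have key : ∀ {d d' x x' : ℝ}, d ≤ x → d' ≤ x' → x + s * (x' - x) ≤ d + s * (d' - d) →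
      x ≤ d ∨ x' ≤ d' := by
    intro d d' x x' h1 h2 h3
    by_contra! hne
    rcases h0.eq_or_lt with rfl | h0
    · linarith
    · nlinarith
  by_cases h1 : a ≤ b ∧ a ≤ c
  · have h1' := ea.1 h1
    rcases key h1.1 h1'.1 h.ge with e | e
    · have := eb.1 ⟨e, by linarith⟩
      linarith
    · have := eb.2 ⟨e, by linarith⟩
      linarith
  by_cases h2 : b ≤ a ∧ b ≤ c
  · have h2' := eb.1 h2
    rcases key h2.1 h2'.1 h.le with e | e
    · have := ea.1 ⟨e, by linarith⟩
      linarith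
    · have := ea.2 ⟨e, by linarith⟩
      linarith
  have h3 : c ≤ a ∧ c ≤ b := by
    push Not at h1 h2
    rcases le_total a b with h4 | h4
    · have := h1 h4; constructor <;> linarith
    · have := h2 h4; constructor <;> linarith
  have h3' := ec.1 h3
  rcases key h3.1 h3'.1 h' with e | e
  · exact absurd ⟨by linarith, e⟩ h1
  · exact absurd (ea.2 ⟨by linarith, e⟩) h1

lemma IsCell.of_sameMin {n : ℕ} {w w' : DSubset 3 n → ℝ} (hw : ThreeTerm (val w))
    (hw' : ThreeTerm (val w')) (hs : SameMin w w') {M : Set (DSubset 3 n)} (hM : IsCell w M) :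
    IsCell w' M := by
  have hval : ∀ s i j k, val (fun X => w X + s * (w' X - w X)) i j k =
      val w i j k + s * (val w' i j k - val w i j k) := by
    intro s i j k
    unfold val
    split_ifs <;> simp
  have hval' : ∀ i j k, val (fun X => w' X - w X) i j k = val w' i j k - val w i j k := by
    intro i j k
    unfold val
    split_ifs <;> simp
  have hperm : ∀ h i j k l, [h, i, j, k, l].Nodup → _ := fun h i j k l nd =>
    (⟨hs h i j k l nd, hs h i k j l (by clear * - nd; grind),
      hs h i l j k (by clear * - nd; grind)⟩ : _ ∧ _ ∧ _)
  have h3 : ∀ s ∈ Set.Icc (0 : ℝ) 1, ThreeTerm (val fun X => w X + s * (w' X - w X)) := by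
    rintro s ⟨hs0, hs1⟩ h i j k l nd
    obtain ⟨e1, e2, e3⟩ := hperm h i j k l nd
    rw [val_swap_right w h k j, val_swap_right w' h k j] at e2
    rw [val_swap_right w h l k, val_swap_right w' h l k, val_swap_right w h l j,
      val_swap_right w' h l j] at e3
    have := convex_three_threeTerm hs0 hs1 (hw h i j k l nd) e2 e3
    simp only [hval]
    rcases this with h | h
    · left; linarith
    · right; linarith
  have ht : ∀ s ∈ Set.Icc (0 : ℝ) 1,
      Tangent (fun X => w X + s * (w' X - w X)) (fun X => w' X - w X) := by
    rintro s ⟨hs0, hs1⟩ h i j k l nd h1 h2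
    obtain ⟨e1, e2, e3⟩ := hperm h i j k l nd
    rw [val_swap_right w h k j, val_swap_right w' h k j] at e2
    rw [val_swap_right w h l k, val_swap_right w' h l k, val_swap_right w h l j,
      val_swap_right w' h l j] at e3
    simp only [hval] at h1 h2
    have := convex_three_tangent hs0 hs1 e1 e2 e3 (by linarith) (by linarith)
    simp only [hval']
    linarith
  have := IsCell.of_segment (convex_Icc (0 : ℝ) 1) h3 ht (s := 0) (t := 1) (by simp) (by simp)
    (M := M) (by simpa using hM)
  simpa using this

lemma isCell_iff_of_sameMin {n : ℕ} {w w' : DSubset 3 n → ℝ} (hw : ThreeTerm (val w))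
    (hw' : ThreeTerm (val w')) (hs : SameMin w w') (M : Set (DSubset 3 n)) :
    IsCell w M ↔ IsCell w' M :=
  ⟨fun h => h.of_sameMin hw hw' hs, fun h => h.of_sameMin hw' hw hs.symm⟩

/-! ### Cells as polytopes -/

lemma indVec_apply {n : ℕ} (X : Finset (Fin n)) (i : Fin n) :
    indVec X i = if i ∈ X then 1 else 0 := by
  simp [indVec, Finset.sum_apply, Pi.single_apply]

lemma linear_indVec {n : ℕ} (l : (Fin n → ℝ) →ₗ[ℝ] ℝ) (X : Finset (Fin n)) :
    l (indVec X) = ∑ i ∈ X, l (Pi.single i 1) := by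
  simp [indVec]

lemma dotProduct_indVec {n : ℕ} (a : Fin n → ℝ) (X : DSubset 3 n) :
    a ⬝ᵥ indVec X.1 = shift a X := by
  simp [dotProduct, indVec_apply, shift]

/-- The face of a convex hull on which a linear functional is minimal. -/
lemma convexHull_face {E : Type*} [AddCommGroup E] [Module ℝ E] (S : Set E) (l : E →ₗ[ℝ] ℝ) :
    {p ∈ convexHull ℝ S | ∀ q ∈ convexHull ℝ S, l p ≤ l q} =
      convexHull ℝ {p ∈ S | ∀ q ∈ S, l p ≤ l q} := by
  apply Set.Subset.antisymm
  · rintro p ⟨hp, hmin⟩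
    obtain ⟨ι, _, c, z, hc0, hc1, hz, rfl⟩ := mem_convexHull_iff_exists_fintype.1 hp
    set p := ∑ i, c i • z i with hpdef
    -- A weighted mean of nonnegative excesses is zero, so only minimising points carry positive
    -- weight.
    have hle : ∀ i, 0 ≤ c i * (l (z i) - l p) := fun i =>
      mul_nonneg (hc0 i) (sub_nonneg.2 (hmin _ (subset_convexHull ℝ S (hz i))))
    have hsum : ∑ i, c i * (l (z i) - l p) = 0 := by
      simp only [mul_sub, Finset.sum_sub_distrib, ← Finset.sum_mul, hc1, one_mul]
      rw [hpdef, map_sum]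
      simp
    have hz0 := (Finset.sum_eq_zero_iff_of_nonneg fun i _ => hle i).1 hsum
    have hzm : ∀ i, c i ≠ 0 → z i ∈ {p ∈ S | ∀ q ∈ S, l p ≤ l q} := by
      intro i hi
      have := (mul_eq_zero.1 (hz0 i (Finset.mem_univ _))).resolve_left hi
      refine ⟨hz i, fun q hq => ?_⟩
      have := hmin q (subset_convexHull ℝ S hq)
      linarith
    have hp' : p = (Finset.univ.filter fun i => c i ≠ 0).centerMass c z := by
      rw [Finset.centerMass_filter_ne_zero, Finset.centerMass_eq_of_sum_1 _ _ hc1]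
    rw [hp']
    apply Finset.centerMass_mem_convexHull
    · exact fun i _ => hc0 i
    · rw [Finset.sum_filter_ne_zero, hc1]; norm_num
    · intro i hi
      exact hzm i (Finset.mem_filter.1 hi).2
  · intro p hp
    have hsub : {p ∈ S | ∀ q ∈ S, l p ≤ l q} ⊆ S := fun p hp => hp.1
    refine ⟨convexHull_mono hsub hp, fun q hq => ?_⟩
    have h1 : ∀ x ∈ S, l p ≤ l x := by
      intro x hx
      have : convexHull ℝ {p ∈ S | ∀ q ∈ S, l p ≤ l q} ⊆ {y | l y ≤ l x} :=
        convexHull_min (fun y hy => hy.2 x hx) (convex_halfSpace_le l.isLinear _)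
      exact this hp
    have : convexHull ℝ S ⊆ {y | l p ≤ l y} :=
      convexHull_min (fun y hy => h1 y hy) (convex_halfSpace_ge l.isLinear _)
    exact this hq

/-- The sum of the coordinates in `X` is three at the vertex of `X` and at most two at all other
vertices. -/
lemma indVec_mem_setPolytope {n : ℕ} {M : Set (DSubset 3 n)} {X : DSubset 3 n} :
    indVec X.1 ∈ setPolytope M ↔ X ∈ M := by
  refine ⟨fun h => ?_, fun h => subset_convexHull ℝ _ ⟨X, h, rfl⟩⟩
  by_contra hX
  classical
  set l : (Fin n → ℝ) →ₗ[ℝ] ℝ := ∑ i ∈ X.1, LinearMap.proj i with hl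
  have hlY : ∀ Y : DSubset 3 n, l (indVec Y.1) = (X.1 ∩ Y.1).card := by
    intro Y
    simp [hl, indVec_apply, LinearMap.sum_apply]
  have : setPolytope M ⊆ {y | l y ≤ 2} := by
    refine convexHull_min ?_ (convex_halfSpace_le l.isLinear _)
    rintro _ ⟨Y, hY, rfl⟩
    change l (indVec Y.1) ≤ 2
    rw [hlY]
    have hne : X.1 ∩ Y.1 ≠ X.1 := by
      intro e
      have : X = Y := Subtype.ext (Finset.eq_of_subset_of_card_le
        (Finset.inter_eq_left.1 e) (by rw [X.2, Y.2]))
      exact hX (this ▸ hY)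
    have := Finset.card_lt_card (Finset.inter_subset_left.ssubset_of_ne hne)
    rw [X.2] at this
    exact_mod_cast Nat.lt_succ_iff.1 this
  have h3 : l (indVec X.1) ≤ 2 := this h
  rw [hlY, Finset.inter_self, X.2] at h3
  norm_num at h3

lemma setPolytope_injective {n : ℕ} :
    Function.Injective (setPolytope : Set (DSubset 3 n) → Set (Fin n → ℝ)) := by
  intro M M' h
  ext X
  rw [← indVec_mem_setPolytope, h, indVec_mem_setPolytope]

lemma indVec_injective {n : ℕ} : Function.Injective (indVec : Finset (Fin n) → Fin n → ℝ) := by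
  intro X Y h
  ext i
  have := congrFun h i
  simp only [indVec_apply] at this
  by_cases h1 : i ∈ X <;> by_cases h2 : i ∈ Y <;> simp_all

/-- A face of `setPolytope M` is `setPolytope` of the minimisers of the functional. -/
lemma setPolytope_face {n : ℕ} (M : Set (DSubset 3 n)) (l : (Fin n → ℝ) →ₗ[ℝ] ℝ) :
    {p ∈ setPolytope M | ∀ q ∈ setPolytope M, l p ≤ l q} =
      setPolytope {X ∈ M | ∀ Y ∈ M, l (indVec X.1) ≤ l (indVec Y.1)} := by
  unfold setPolytope
  rw [convexHull_face]
  congr 1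
  ext p
  constructor
  · rintro ⟨⟨X, hX, rfl⟩, h⟩
    exact ⟨X, ⟨hX, fun Y hY => h _ ⟨Y, hY, rfl⟩⟩, rfl⟩
  · rintro ⟨X, ⟨hX, h⟩, rfl⟩
    refine ⟨⟨X, hX, rfl⟩, ?_⟩
    rintro _ ⟨Y, hY, rfl⟩
    exact h Y hY

lemma fst_image_lowerFace {n : ℕ} (w : DSubset 3 n → ℝ) (a : Fin n → ℝ) :
    Prod.fst '' lowerFace w a = setPolytope {X | ∀ Y, w X + shift a X ≤ w Y + shift a Y} := by
  set l : ((Fin n → ℝ) × ℝ) →ₗ[ℝ] ℝ :=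
    (∑ i, a i • LinearMap.proj i).comp (LinearMap.fst ℝ _ ℝ) + LinearMap.snd ℝ _ ℝ with hl
  have hla : ∀ p, l p = a ⬝ᵥ p.1 + p.2 := by
    intro p
    simp [hl, dotProduct, LinearMap.sum_apply]
  have h1 : lowerFace w a = convexHull ℝ
      {p ∈ Set.range fun X : DSubset 3 n => (indVec X.1, w X) |
        ∀ q ∈ Set.range fun X : DSubset 3 n => (indVec X.1, w X), l p ≤ l q} := by
    rw [← convexHull_face]
    simp only [lowerFace, hla]
    rfl
  rw [h1, setPolytope]
  change (LinearMap.fst ℝ (Fin n → ℝ) ℝ) '' _ = _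
  rw [LinearMap.image_convexHull]
  congr 1
  ext p
  constructor
  · rintro ⟨_, ⟨⟨X, rfl⟩, h⟩, rfl⟩
    refine ⟨X, fun Y => ?_, rfl⟩
    have := h _ ⟨Y, rfl⟩
    simp only [hla, dotProduct_indVec] at this
    linarith
  · rintro ⟨X, h, rfl⟩
    refine ⟨_, ⟨⟨X, rfl⟩, ?_⟩, rfl⟩
    rintro _ ⟨Y, rfl⟩
    simp only [hla, dotProduct_indVec]
    linarith [h Y]

lemma regularSubdivision_eq {n : ℕ} (hn : 3 ≤ n) (w : DSubset 3 n → ℝ) :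
    regularSubdivision w = setPolytope '' {M | IsCell w M} := by
  have hne : Nonempty (DSubset 3 n) := by
    obtain ⟨s, -, hs⟩ := Finset.exists_subset_card_eq (s := (Finset.univ : Finset (Fin n))) (n := 3)
      (by simpa using hn)
    exact ⟨s, hs⟩
  ext Q
  constructor
  · rintro ⟨a, rfl⟩
    refine ⟨_, ?_, (fst_image_lowerFace w a).symm⟩
    -- `IsCell` asks for minimum zero. Each triple has three elements, so a third of the minimum is
    -- subtracted from every coordinate.
    obtain ⟨X0, hX0⟩ := Finite.exists_min fun X => w X + shift a X
    have hs : ∀ X, w X + shift (fun i => a i + -((w X0 + shift a X0) / 3)) X =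
        (w X + shift a X) - (w X0 + shift a X0) := by
      intro X
      rw [shift_add, shift_const]
      ring
    refine ⟨fun i => a i + -((w X0 + shift a X0) / 3), fun X => ?_, ⟨X0, hX0⟩, fun X => ?_⟩
    · rw [hs]; exact sub_nonneg.2 (hX0 X)
    · rw [hs, sub_eq_zero]
      exact ⟨fun h => le_antisymm (h X0) (hX0 X), fun h Y => h ▸ hX0 Y⟩
  · rintro ⟨M, ⟨a, ha, hM, hM'⟩, rfl⟩
    refine ⟨a, ?_⟩
    simp only [fst_image_lowerFace]
    congr 1
    ext X
    rw [hM']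
    constructor
    · intro h
      obtain ⟨X0, hX0⟩ := hM
      exact le_antisymm (((hM' X0).1 hX0) ▸ h X0) (ha X)
    · intro h Y
      rw [h]
      exact ha Y

lemma regularSubdivision_eq_iff {n : ℕ} (hn : 3 ≤ n) (w w' : DSubset 3 n → ℝ) :
    regularSubdivision w = regularSubdivision w' ↔ ∀ M, IsCell w M ↔ IsCell w' M := by
  rw [regularSubdivision_eq hn, regularSubdivision_eq hn,
    (Set.image_injective.2 setPolytope_injective).eq_iff, Set.ext_iff]
  rfl

/-! ### Edges of cells and the matroid condition -/

open Filter Topology in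
lemma IsCell.exposed {n : ℕ} {w : DSubset 3 n → ℝ} {M : Set (DSubset 3 n)} (h : IsCell w M)
    (c : Fin n → ℝ) (hN : {X ∈ M | ∀ Y ∈ M, shift c X ≤ shift c Y}.Nonempty) :
    IsCell w {X ∈ M | ∀ Y ∈ M, shift c X ≤ shift c Y} := by
  obtain ⟨a, ha, -, haM⟩ := h
  obtain ⟨X0, hX0, hmin⟩ := hN
  obtain ⟨ε, hε, hpos⟩ : ∃ ε > 0, ∀ X, 0 < w X + shift a X →
      0 < w X + shift a X + ε * (shift c X - shift c X0) := by
    have h2 : ∀ᶠ ε in 𝓝[>] (0 : ℝ), ∀ X, 0 < w X + shift a X →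
        0 < w X + shift a X + ε * (shift c X - shift c X0) := by
      simp only [eventually_all]
      intro X hX
      simpa using eventually_add_mul_lt hX 0 (shift c X - shift c X0)
    have h3 : ∀ᶠ ε in 𝓝[>] (0 : ℝ), ε ∈ Set.Ioi (0 : ℝ) := self_mem_nhdsWithin
    obtain ⟨ε, h2, h3⟩ := (h2.and h3).exists
    exact ⟨ε, h3, h2⟩
  have hs : ∀ X, w X + shift (fun i => a i + ε * (c i - shift c X0 / 3)) X =
      w X + shift a X + ε * (shift c X - shift c X0) := by
    intro X
    rw [shift_add, shift_mul, shift_sub, shift_const]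
    ring
  refine ⟨fun i => a i + ε * (c i - shift c X0 / 3), fun X => ?_, ⟨X0, hX0, hmin⟩, fun X => ?_⟩ <;>
    rw [hs] <;> by_cases hX : X ∈ M
  · rw [(haM X).1 hX, zero_add]
    exact mul_nonneg hε.le (sub_nonneg.2 (hmin X hX))
  · exact (hpos X ((ha X).lt_of_ne fun h => hX ((haM X).2 h.symm))).le
  · rw [(haM X).1 hX, zero_add, mul_eq_zero, or_iff_right hε.ne', sub_eq_zero]
    exact ⟨fun h => le_antisymm (h.2 X0 hX0) (hmin X hX), fun h => ⟨hX, fun Y hY => h ▸ hmin Y hY⟩⟩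
  · have := hpos X ((ha X).lt_of_ne fun h => hX ((haM X).2 h.symm))
    exact ⟨fun h => absurd h.1 hX, fun h => absurd h this.ne'⟩

lemma vectorSpan_setPolytope {n : ℕ} (M : Set (DSubset 3 n)) :
    vectorSpan ℝ (setPolytope M) =
      vectorSpan ℝ ((fun X : DSubset 3 n => indVec X.1) '' M) := by
  rw [setPolytope, ← direction_affineSpan, affineSpan_convexHull, direction_affineSpan]

lemma vectorSpan_setPolytope_pair {n : ℕ} (X Y : DSubset 3 n) :
    vectorSpan ℝ (setPolytope {X, Y}) = Submodule.span ℝ {indVec X.1 - indVec Y.1} := by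
  rw [vectorSpan_setPolytope, Set.image_pair, vectorSpan_pair, vsub_eq_sub]

lemma finrank_vectorSpan_pair {n : ℕ} {X Y : DSubset 3 n} (h : X ≠ Y) :
    Module.finrank ℝ (vectorSpan ℝ (setPolytope {X, Y})) = 1 := by
  rw [vectorSpan_setPolytope_pair]
  exact finrank_span_singleton (sub_ne_zero.2 fun e => h (Subtype.ext (indVec_injective e)))

/-- A face of dimension one is spanned by two vertices. -/
lemma exists_pair_of_finrank_eq_one {n : ℕ} {N : Set (DSubset 3 n)}
    (h : Module.finrank ℝ (vectorSpan ℝ (setPolytope N)) = 1) : ∃ X Y, X ≠ Y ∧ N = {X, Y} := by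
  rw [vectorSpan_setPolytope] at h
  have h2 : ∃ X ∈ N, ∃ Y ∈ N, X ≠ Y := by
    by_contra! hs
    have : ((fun X : DSubset 3 n => indVec X.1) '' N).Subsingleton := by
      rintro _ ⟨X, hX, rfl⟩ _ ⟨Y, hY, rfl⟩
      rw [hs X hX Y hY]
    rw [vectorSpan_of_subsingleton ℝ this, finrank_bot] at h
    exact zero_ne_one h
  obtain ⟨X, hX, Y, hY, hXY⟩ := h2
  refine ⟨X, Y, hXY, Set.Subset.antisymm (fun Z hZ => ?_) (by simp [Set.insert_subset_iff, hX, hY])⟩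
  by_contra hne
  simp only [Set.mem_insert_iff, Set.mem_singleton_iff, not_or] at hne
  have m1 : indVec Y.1 - indVec X.1 ∈ vectorSpan ℝ ((fun X : DSubset 3 n => indVec X.1) '' N) :=
    vsub_mem_vectorSpan ℝ ⟨Y, hY, rfl⟩ ⟨X, hX, rfl⟩
  have m2 : indVec Z.1 - indVec X.1 ∈ vectorSpan ℝ ((fun X : DSubset 3 n => indVec X.1) '' N) :=
    vsub_mem_vectorSpan ℝ ⟨Z, hZ, rfl⟩ ⟨X, hX, rfl⟩
  obtain ⟨r, hr⟩ := exists_smul_eq_of_finrank_eq_one h (x := ⟨_, m1⟩) (by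
    intro e
    have := congrArg Subtype.val e
    exact hXY (Subtype.ext (indVec_injective (sub_eq_zero.1 this))).symm) ⟨_, m2⟩
  have hr' : r • (indVec Y.1 - indVec X.1) = indVec Z.1 - indVec X.1 := congrArg Subtype.val hr
  -- A third vertex would lie on the line through the first two. A coordinate in `Z` but not in `X`
  -- forces the ratio to be one, so the vertex is that of `Y`.
  have hZX : ∃ i ∈ Z.1, i ∉ X.1 := by
    by_contra! hsub
    exact hne.1 (Subtype.ext (Finset.eq_of_subset_of_card_le hsub (by rw [X.2, Z.2])))
  obtain ⟨i, hi, hi'⟩ := hZX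
  have hri := congrFun hr' i
  simp only [Pi.smul_apply, Pi.sub_apply, indVec_apply, hi, hi', if_true, if_false, sub_zero,
    smul_eq_mul] at hri
  have hr1 : r = 1 := by
    split_ifs at hri
    · linarith
    · norm_num at hri
  rw [hr1, one_smul, sub_left_inj] at hr'
  exact hne.2 (Subtype.ext (indVec_injective hr')).symm

/-- The edges of a cell are cells. -/
lemma IsCell.edge {n : ℕ} {w : DSubset 3 n → ℝ} {M : Set (DSubset 3 n)} (h : IsCell w M)
    {E : Set (Fin n → ℝ)} (hE : IsEdge (setPolytope M) E) :
    ∃ X Y, X ≠ Y ∧ E = setPolytope {X, Y} ∧ IsCell w {X, Y} := by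
  obtain ⟨hexp, hrank⟩ := hE
  have hne : E.Nonempty := by
    rw [Set.nonempty_iff_ne_empty]
    rintro rfl
    rw [vectorSpan_empty, finrank_bot] at hrank
    exact zero_ne_one hrank
  obtain ⟨l, rfl⟩ := hexp hne
  -- Exposed faces are defined by maxima, cells by minima.
  set l' : (Fin n → ℝ) →ₗ[ℝ] ℝ := -(l : (Fin n → ℝ) →ₗ[ℝ] ℝ) with hl'
  have e1 : {x ∈ setPolytope M | ∀ y ∈ setPolytope M, l y ≤ l x} =
      setPolytope {X ∈ M | ∀ Y ∈ M, l' (indVec X.1) ≤ l' (indVec Y.1)} := by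
    rw [← setPolytope_face]
    simp [hl']
  have e2 : {X ∈ M | ∀ Y ∈ M, l' (indVec X.1) ≤ l' (indVec Y.1)} =
      {X ∈ M | ∀ Y ∈ M, shift (fun i => l' (Pi.single i 1)) X ≤
        shift (fun i => l' (Pi.single i 1)) Y} := by
    simp only [linear_indVec, shift]
  rw [e1, e2] at hrank ⊢
  obtain ⟨X, Y, hXY, hN⟩ := exists_pair_of_finrank_eq_one hrank
  refine ⟨X, Y, hXY, by rw [hN], ?_⟩
  have := h.exposed (fun i => l' (Pi.single i 1)) (by rw [hN]; simp)
  rwa [hN] at this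

/-- The exchange property stays inside the zero set `{X, Y}`, so the exchanged triple can only be
`Y`. -/
lemma IsCell.pair_exchange {n : ℕ} {w : DSubset 3 n → ℝ} (hw : ThreeTerm (val w))
    {X Y : DSubset 3 n} (hXY : X ≠ Y) (h : IsCell w {X, Y}) :
    ∃ i j, i ∈ X.1 ∧ j ∉ X.1 ∧ Y.1 = insert j (X.1.erase i) := by
  obtain ⟨a, ha, -, haM⟩ := h
  have hi : ∃ i ∈ X.1, i ∉ Y.1 := by
    by_contra! hsub
    exact hXY (Subtype.ext (Finset.eq_of_subset_of_card_le hsub (by rw [X.2, Y.2])))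
  obtain ⟨i, hi, hi'⟩ := hi
  obtain ⟨j, hj, hj', Z, hZ, hZe⟩ := (hw.val_add_shift a).exchange ha
    ((haM X).1 (by simp)) ((haM Y).1 (by simp)) hi hi'
  have hZ' : Z = X ∨ Z = Y := by simpa using (haM Z).2 hZ
  rcases hZ' with rfl | rfl
  · exact absurd (hZe ▸ Finset.mem_insert_self _ _) hj'
  · exact ⟨i, j, hi, hj', hZe⟩

/-- The functional adding the intersection sizes with `X` and with `Y` is 3 + 2 at these two
vertices and at most 2 + 2 at every other one. -/
lemma isEdge_hypersimplex {n : ℕ} {X Y : DSubset 3 n} {i j : Fin n} (hi : i ∈ X.1) (hj : j ∉ X.1)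
    (hY : Y.1 = insert j (X.1.erase i)) : IsEdge (hypersimplex 3 n) (setPolytope {X, Y}) := by
  classical
  have hXY : X ≠ Y := by
    rintro rfl
    exact hj (hY ▸ Finset.mem_insert_self _ _)
  refine ⟨fun _ => ?_, finrank_vectorSpan_pair hXY⟩
  set l : (Fin n → ℝ) →ₗ[ℝ] ℝ := -(∑ i ∈ X.1, LinearMap.proj i + ∑ i ∈ Y.1, LinearMap.proj i)
    with hl
  refine ⟨LinearMap.toContinuousLinearMap (-l), ?_⟩
  have e1 : {x ∈ hypersimplex 3 n | ∀ y ∈ hypersimplex 3 n,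
      LinearMap.toContinuousLinearMap (-l) y ≤ LinearMap.toContinuousLinearMap (-l) x} =
      {x ∈ hypersimplex 3 n | ∀ y ∈ hypersimplex 3 n, l x ≤ l y} := by
    simp
  rw [e1, hypersimplex, setPolytope_face]
  have hlZ : ∀ Z : DSubset 3 n, l (indVec Z.1) =
      -(((X.1 ∩ Z.1).card : ℝ) + ((Y.1 ∩ Z.1).card : ℝ)) := by
    intro Z
    simp only [hl, LinearMap.neg_apply, LinearMap.add_apply, LinearMap.sum_apply,
      LinearMap.proj_apply, indVec_apply, Finset.sum_ite_mem]
    simp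
  have hXYc : (X.1 ∩ Y.1).card = 2 := by
    have : X.1 ∩ Y.1 = X.1.erase i := by rw [hY]; ext z; grind
    rw [this, Finset.card_erase_of_mem hi, X.2]
  have hlt : ∀ Z W : DSubset 3 n, Z ≠ W → (W.1 ∩ Z.1).card ≤ 2 := by
    intro Z W hne
    by_contra! hgt
    have h3 : W.1 ⊆ W.1 ∩ Z.1 :=
      (Finset.eq_of_subset_of_card_le Finset.inter_subset_left (by rw [W.2]; omega)).ge
    exact hne (Subtype.ext (Finset.eq_of_subset_of_card_le
      (h3.trans Finset.inter_subset_right) (by rw [W.2, Z.2])).symm)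
  congr 1
  ext Z
  simp only [Set.mem_insert_iff, Set.mem_singleton_iff, Set.mem_sep_iff, Set.mem_univ, true_and,
    hlZ, forall_true_left]
  have hmin : ∀ W : DSubset 3 n, (X.1 ∩ W.1).card + (Y.1 ∩ W.1).card ≤ 5 := by
    intro W
    by_cases h1 : W = X
    · subst h1
      rw [Finset.inter_self, W.2, Finset.inter_comm, hXYc]
    · have := hlt W X h1
      have := Finset.card_le_card (Finset.inter_subset_left : Y.1 ∩ W.1 ⊆ _)
      rw [Y.2] at this
      omega
  constructor
  · rintro (rfl | rfl) W
    · have := hmin W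
      rw [Finset.inter_self, Z.2, Finset.inter_comm Y.1 Z.1, hXYc]
      have : ((Z.1 ∩ W.1).card : ℝ) + ((Y.1 ∩ W.1).card : ℝ) ≤ 5 := by exact_mod_cast this
      push_cast
      linarith
    · have := hmin W
      rw [Finset.inter_self, Z.2, hXYc]
      have : ((X.1 ∩ W.1).card : ℝ) + ((Z.1 ∩ W.1).card : ℝ) ≤ 5 := by exact_mod_cast this
      push_cast
      linarith
  · intro h
    by_contra! hne
    have h1 := hlt Z X hne.1
    have h2 := hlt Z Y hne.2
    have h3 := h X
    rw [Finset.inter_self, X.2, Finset.inter_comm Y.1 X.1, hXYc] at h3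
    have : ((X.1 ∩ Z.1).card : ℝ) + ((Y.1 ∩ Z.1).card : ℝ) ≤ 4 := by
      exact_mod_cast (by omega : (X.1 ∩ Z.1).card + (Y.1 ∩ Z.1).card ≤ 4)
    push_cast at h3
    linarith

/-- The cells of the subdivision of a point of the Dressian are matroid polytopes. -/
lemma IsCell.isMatroidBases {n : ℕ} {w : DSubset 3 n → ℝ} (hw : ThreeTerm (val w))
    {M : Set (DSubset 3 n)} (h : IsCell w M) : IsMatroidBases M := by
  have hne : M.Nonempty := by
    obtain ⟨a, -, hne, -⟩ := h
    exact hne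
  refine ⟨hne, fun E hE => ?_⟩
  obtain ⟨X, Y, hXY, rfl, hc⟩ := h.edge hE
  obtain ⟨i, j, hi, hj, hY⟩ := hc.pair_exchange hw hXY
  exact ⟨_, isEdge_hypersimplex hi hj hY, AffineSubspace.Parallel.refl _⟩

lemma threeTerm_zero {n : ℕ} : ThreeTerm (val (fun _ : DSubset 3 n => 0)) := by
  intro h i j k l _
  left
  simp [val]

/-- A pair of sets at distance two is not a matroid. -/
lemma not_isMatroidBases_pair {n : ℕ} {h i j k l : Fin n} (nd : [h, i, j, k, l].Nodup)
    {P Q : DSubset 3 n} (hP : P.1 = {h, i, j}) (hQ : Q.1 = {h, k, l}) :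
    ¬ IsMatroidBases {P, Q} := by
  rintro ⟨-, hM⟩
  simp only [List.nodup_cons, List.mem_cons, not_or, List.not_mem_nil, not_false_eq_true] at nd
  obtain ⟨⟨h1, h2, h3, h4, -⟩, ⟨i1, i2, i3, -⟩, ⟨j1, j2, -⟩, ⟨k1, -⟩, -⟩ := nd
  have hPQ : P ≠ Q := by
    rintro rfl
    have : i ∈ P.1 := by simp [hP]
    rw [hQ] at this
    simp [Ne.symm h1, i2, i3] at this
  obtain ⟨E', hE', hpar⟩ := hM _ ⟨IsExposed.refl _, finrank_vectorSpan_pair hPQ⟩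
  -- The hypersimplex is the cell of all triples for the zero weight, so the results on edges of
  -- cells show that its edges are single exchanges.
  have hu : IsCell (fun _ : DSubset 3 n => 0) Set.univ :=
    ⟨fun _ => 0, fun X => by simp [shift], ⟨P, trivial⟩, fun X => by simp [shift]⟩
  obtain ⟨X, Y, hXY, rfl, hc⟩ := hu.edge hE'
  obtain ⟨p, q, hp, hq, hY⟩ := hc.pair_exchange threeTerm_zero hXY
  have hspan := hpar.vectorSpan_eq
  rw [vectorSpan_setPolytope_pair, vectorSpan_setPolytope_pair] at hspan
  have hmem : indVec P.1 - indVec Q.1 ∈ Submodule.span ℝ {indVec X.1 - indVec Y.1} := by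
    rw [← hspan]
    exact Submodule.mem_span_singleton_self _
  obtain ⟨r, hr⟩ := Submodule.mem_span_singleton.1 hmem
  have hcoord : ∀ x, x ∈ P.1 → x ∉ Q.1 → x = p ∨ x = q := by
    intro x hxP hxQ
    by_contra! hne
    have := congrFun hr x
    simp only [Pi.smul_apply, Pi.sub_apply, indVec_apply, hY, Finset.mem_insert, Finset.mem_erase,
      hne.1, hne.2, false_or, ne_eq, not_false_eq_true, true_and, sub_self, smul_eq_mul, mul_zero,
      hxP, hxQ, if_true, if_false, sub_zero] at this
    norm_num at this
  have hcoord' : ∀ x, x ∈ Q.1 → x ∉ P.1 → x = p ∨ x = q := by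
    intro x hxP hxQ
    by_contra! hne
    have := congrFun hr x
    simp only [Pi.smul_apply, Pi.sub_apply, indVec_apply, hY, Finset.mem_insert, Finset.mem_erase,
      hne.1, hne.2, false_or, ne_eq, not_false_eq_true, true_and, sub_self, smul_eq_mul, mul_zero,
      hxP, hxQ, if_true, if_false, zero_sub] at this
    norm_num at this
  have c1 := hcoord i (by simp [hP]) (by simp [hQ, Ne.symm h1, i2, i3])
  have c2 := hcoord j (by simp [hP]) (by simp [hQ, Ne.symm h2, j1, j2])
  have c3 := hcoord' k (by simp [hQ]) (by simp [hP, Ne.symm h3, Ne.symm i2, Ne.symm j1])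
  grind

/-- A weight that violates a three term relation has a one-dimensional cell that is not a matroid
polytope. -/
lemma isCell_pair {n : ℕ} {w : DSubset 3 n → ℝ} {h i j k l : Fin n} (nd : [h, i, j, k, l].Nodup)
    {P Q : DSubset 3 n} (hP : P.1 = {h, i, j}) (hQ : Q.1 = {h, k, l})
    (hB : val w h i j + val w h k l ≤ val w h i k + val w h j l)
    (hC : val w h i j + val w h k l ≤ val w h i l + val w h j k) :
    ∃ M, IsCell w M ∧ P ∈ M ∧ Q ∈ M ∧
      (val w h i j + val w h k l < val w h i k + val w h j l →
       val w h i j + val w h k l < val w h i l + val w h j k → M = {P, Q}) := by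
  simp only [List.nodup_cons, List.mem_cons, not_or, List.not_mem_nil, not_false_eq_true] at nd
  obtain ⟨⟨h1, h2, h3, h4, -⟩, ⟨i1, i2, i3, -⟩, ⟨j1, j2, -⟩, ⟨k1, -⟩, -⟩ := nd
  set A := val w h i j + val w h k l with hA
  -- These constants make `a` level the octahedron: on each of the three diagonals both ends get the
  -- same height, half of their sum.
  set r := (val w h k l - val w h i j) / 4 with hr
  set p := (val w h j l - val w h i k) / 2 with hp
  set q := (val w h j k - val w h i l) / 2 with hq
  set a : Fin n → ℝ := fun x => if x = i then r + (p + q) / 2 else if x = j then r - (p + q) / 2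
    else if x = k then -r + (p - q) / 2 else if x = l then -r - (p - q) / 2 else 0 with ha
  have ah : a h = 0 := by simp [ha, h1, h2, h3, h4]
  have ai : a i = r + (p + q) / 2 := by simp [ha]
  have aj : a j = r - (p + q) / 2 := by simp [ha, Ne.symm i1]
  have ak : a k = -r + (p - q) / 2 := by simp [ha, Ne.symm i2, Ne.symm j1]
  have al : a l = -r - (p - q) / 2 := by simp [ha, Ne.symm i3, Ne.symm j2, Ne.symm k1]
  have hf : ∀ {x y} {X : DSubset 3 n}, h ≠ x → h ≠ y → x ≠ y → X.1 = {h, x, y} →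
      w X + shift a X = val w h x y + a x + a y := by
    intro x y X hx hy hxy hX
    rw [← val_eq w hX, shift_eq a hx hy hxy hX, ah]
    ring
  have fP : w P + shift a P = A / 2 := by
    rw [hf h1 h2 i1 hP, ai, aj, hA, hr]; ring
  have fQ : w Q + shift a Q = A / 2 := by
    rw [hf h3 h4 k1 hQ, ak, al, hA, hr]; ring
  have hoct : ∀ X : DSubset 3 n, h ∈ X.1 → (∀ x ∈ X.1, x = h ∨ x = i ∨ x = j ∨ x = k ∨ x = l) →
      A / 2 ≤ w X + shift a X ∧ (A < val w h i k + val w h j l → A < val w h i l + val w h j k →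
        w X + shift a X = A / 2 → X = P ∨ X = Q) := by
    intro X hX hsub
    have hc2 : (X.1.erase h).card = 2 := by rw [Finset.card_erase_of_mem hX, X.2]
    obtain ⟨x, y, hxy, hxye⟩ := Finset.card_eq_two.1 hc2
    have hXe : X.1 = {h, x, y} := by rw [← hxye, Finset.insert_erase hX]
    have hx : x ∈ X.1.erase h := by simp [hxye]
    have hy : y ∈ X.1.erase h := by simp [hxye]
    rw [Finset.mem_erase] at hx hy
    rw [hf hx.1.symm hy.1.symm hxy hXe]
    have hx' := (hsub x hx.2).resolve_left hx.1
    have hy' := (hsub y hy.2).resolve_left hy.1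
    have sj : val w h j i = val w h i j := val_swap_right _ _ _ _
    have sk : val w h k i = val w h i k := val_swap_right _ _ _ _
    have sl : val w h l i = val w h i l := val_swap_right _ _ _ _
    have sjk : val w h k j = val w h j k := val_swap_right _ _ _ _
    have sjl : val w h l j = val w h j l := val_swap_right _ _ _ _
    have skl : val w h l k = val w h k l := val_swap_right _ _ _ _
    have eP : X.1 = {h, i, j} → X = P := fun e => Subtype.ext (e.trans hP.symm)
    have eQ : X.1 = {h, k, l} → X = Q := fun e => Subtype.ext (e.trans hQ.symm)
    rcases hx' with rfl | rfl | rfl | rfl <;> rcases hy' with rfl | rfl | rfl | rfl <;>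
      first
      | exact absurd rfl hxy
      | (refine ⟨by linarith, fun hB' hC' he => ?_⟩
         first
         | (exfalso; linarith)
         | exact Or.inl (eP hXe)
         | exact Or.inr (eQ hXe)
         | exact Or.inl (eP (hXe.trans (congrArg _ (Finset.pair_comm _ _))))
         | exact Or.inr (eQ (hXe.trans (congrArg _ (Finset.pair_comm _ _)))))
  obtain ⟨K0, hK0⟩ := (Set.finite_range fun X => A / 2 - (w X + shift a X)).bddAbove
  have hK0' : ∀ X, A / 2 - (w X + shift a X) < |K0| + 1 := fun X =>
    (hK0 ⟨X, rfl⟩).trans_lt (by linarith [le_abs_self K0])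
  set K := |K0| + 1 with hK
  have hKpos : 0 < K := by positivity
  classical
  -- The sum of `e` over a triple is -1 on the octahedron and nonnegative elsewhere. A large
  -- multiple `K` lifts all other triples above height `A / 2`, and the final constant moves that
  -- height to zero.
  set e : Fin n → ℝ := fun x => if x = h then -1 else
    if x = i ∨ x = j ∨ x = k ∨ x = l then 0 else 1 with he
  have eh : e h = -1 := by simp [he]
  have ge : ∀ x, x ≠ h → 0 ≤ e x := by
    intro x hx
    simp only [he, hx, if_false]
    split_ifs <;> norm_num
  have hsh : ∀ X : DSubset 3 n, h ∈ X.1 → shift e X = -1 + ∑ x ∈ X.1.erase h, e x := by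
    intro X hX
    rw [shift, ← Finset.add_sum_erase _ _ hX, eh]
  have hge : ∀ X : DSubset 3 n, 0 ≤ ∑ x ∈ X.1.erase h, e x := fun X =>
    Finset.sum_nonneg fun x hx => ge x (Finset.ne_of_mem_erase hx)
  have hcase : ∀ X : DSubset 3 n, 0 ≤ shift e X ∨ (shift e X = -1 ∧ h ∈ X.1 ∧
      ∀ x ∈ X.1, x = h ∨ x = i ∨ x = j ∨ x = k ∨ x = l) := by
    intro X
    by_cases hX : h ∈ X.1
    · by_cases hsub : ∀ x ∈ X.1, x = h ∨ x = i ∨ x = j ∨ x = k ∨ x = l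
      · right
        refine ⟨?_, hX, hsub⟩
        rw [hsh X hX, Finset.sum_eq_zero, add_zero]
        intro x hx
        rw [Finset.mem_erase] at hx
        have := (hsub x hx.2).resolve_left hx.1
        simp [he, hx.1, this]
      · left
        push Not at hsub
        obtain ⟨x, hx, hxh, hx'⟩ := hsub
        rw [hsh X hX]
        have h1 : e x ≤ ∑ x ∈ X.1.erase h, e x :=
          Finset.single_le_sum (f := e) (fun y hy => ge y (Finset.ne_of_mem_erase hy))
            (Finset.mem_erase.2 ⟨hxh, hx⟩)
        have : e x = 1 := by simp [he, hxh, hx']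
        linarith
    · left
      exact Finset.sum_nonneg fun x hx => ge x fun hxh => hX (hxh ▸ hx)
  have hform : ∀ X, w X + shift (fun x => a x + K * e x + (K - A / 2) / 3) X =
      (w X + shift a X - A / 2) + K * (shift e X + 1) := by
    intro X
    rw [shift_add (fun x => a x + K * e x) (fun _ => (K - A / 2) / 3), shift_add, shift_mul,
      shift_const]
    ring
  have heP : shift e P = -1 := by
    rw [shift_eq e h1 h2 i1 hP, eh]; simp [he, Ne.symm h1, Ne.symm h2]
  have heQ : shift e Q = -1 := by
    rw [shift_eq e h3 h4 k1 hQ, eh]; simp [he, Ne.symm h3, Ne.symm h4]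
  have hPz : w P + shift (fun x => a x + K * e x + (K - A / 2) / 3) P = 0 := by
    rw [hform, fP, heP]; ring
  have hQz : w Q + shift (fun x => a x + K * e x + (K - A / 2) / 3) Q = 0 := by
    rw [hform, fQ, heQ]; ring
  refine ⟨{X | w X + shift (fun x => a x + K * e x + (K - A / 2) / 3) X = 0},
    ⟨_, fun X => ?_, ⟨P, hPz⟩, fun X => Iff.rfl⟩, hPz, hQz, fun hB' hC' => ?_⟩
  · rw [hform]
    rcases hcase X with h0 | ⟨h0, hX, hsub⟩
    · have := hK0' X
      nlinarith
    · have := (hoct X hX hsub).1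
      rw [h0]
      linarith
  · ext X
    simp only [Set.mem_insert_iff, Set.mem_singleton_iff]
    refine ⟨fun hX0 => ?_, ?_⟩
    · have hX0' : w X + shift (fun x => a x + K * e x + (K - A / 2) / 3) X = 0 := hX0
      rw [hform] at hX0'
      rcases hcase X with h0 | ⟨h0, hX, hsub⟩
      · have := hK0' X
        nlinarith
      · refine (hoct X hX hsub).2 hB' hC' ?_
        rw [h0] at hX0'
        linarith
    · rintro (rfl | rfl)
      exacts [hPz, hQz]

/-- A violated relation has a unique lowest diagonal, which is a cell by `isCell_pair` and is
parallel to no edge of the hypersimplex. The converse is `IsCell.isMatroidBases`. -/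
lemma allCellsMatroidal_iff {n : ℕ} (hn : 3 ≤ n) (w : DSubset 3 n → ℝ) :
    AllCellsMatroidal 3 (regularSubdivision w) ↔ ThreeTerm (val w) := by
  rw [regularSubdivision_eq hn]
  constructor
  · intro H h i j k l nd
    by_contra! hlt
    have nd' := nd
    simp only [List.nodup_cons, List.mem_cons, not_or, List.not_mem_nil, not_false_eq_true] at nd'
    obtain ⟨⟨h1, h2, h3, h4, -⟩, ⟨i1, i2, i3, -⟩, ⟨j1, j2, -⟩, ⟨k1, -⟩, -⟩ := nd'
    obtain ⟨P, hP⟩ := exists_triple h1 h2 i1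
    obtain ⟨Q, hQ⟩ := exists_triple h3 h4 k1
    obtain ⟨M, hM, -, -, hMe⟩ := isCell_pair nd hP hQ hlt.1.le hlt.2.le
    obtain ⟨M', hM', hMM'⟩ := H _ ⟨M, hM, rfl⟩
    rw [← setPolytope_injective hMM', hMe hlt.1 hlt.2] at hM'
    exact not_isMatroidBases_pair nd hP hQ hM'
  · rintro hw _ ⟨M, hM, rfl⟩
    exact ⟨M, IsCell.isMatroidBases hw hM, rfl⟩

/-- Two points of the Dressian induce the same subdivision if and only if the same terms of the
three term relations are minimal. -/
lemma regularSubdivision_eq_iff_sameMin {n : ℕ} (hn : 3 ≤ n) {w w' : DSubset 3 n → ℝ}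
    (hw : ThreeTerm (val w)) (hw' : ThreeTerm (val w')) :
    regularSubdivision w = regularSubdivision w' ↔ SameMin w w' := by
  rw [regularSubdivision_eq_iff hn]
  refine ⟨fun H => ?_, fun H => isCell_iff_of_sameMin hw hw' H⟩
  -- If a term is lowest for `w`, its two triples share a cell. A supporting function of this cell
  -- for `w'` is zero at both and nonnegative on the other terms, so the term is lowest for `w'`.
  have key : ∀ w w' : DSubset 3 n → ℝ, (∀ M, IsCell w M → IsCell w' M) →
      ∀ h i j k l, [h, i, j, k, l].Nodup →
      (val w h i j + val w h k l ≤ val w h i k + val w h j l ∧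
      val w h i j + val w h k l ≤ val w h i l + val w h j k) →
      (val w' h i j + val w' h k l ≤ val w' h i k + val w' h j l ∧
      val w' h i j + val w' h k l ≤ val w' h i l + val w' h j k) := by
    intro w w' H h i j k l nd hmin
    have nd2 : [h, i, k, j, l].Nodup := by clear * - nd; grind
    have nd3 : [h, i, l, j, k].Nodup := by clear * - nd; grind
    have nd' := nd
    simp only [List.nodup_cons, List.mem_cons, not_or, List.not_mem_nil, not_false_eq_true] at nd'
    obtain ⟨⟨h1, h2, h3, h4, -⟩, ⟨i1, i2, i3, -⟩, ⟨j1, j2, -⟩, ⟨k1, -⟩, -⟩ := nd'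
    obtain ⟨P, hP⟩ := exists_triple h1 h2 i1
    obtain ⟨Q, hQ⟩ := exists_triple h3 h4 k1
    obtain ⟨M, hM, hPM, hQM, -⟩ := isCell_pair nd hP hQ hmin.1 hmin.2
    obtain ⟨a, ha, -, haM⟩ := H M hM
    have e := val_add_shift_pair w' a nd
    have e2 := val_add_shift_pair w' a nd2
    have e3 := val_add_shift_pair w' a nd3
    have z1 : val (fun X => w' X + shift a X) h i j = 0 := by rw [val_eq _ hP, (haM P).1 hPM]
    have z2 : val (fun X => w' X + shift a X) h k l = 0 := by rw [val_eq _ hQ, (haM Q).1 hQM]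
    have n1 := val_nonneg ha h i k
    have n2 := val_nonneg ha h j l
    have n3 := val_nonneg ha h i l
    have n4 := val_nonneg ha h j k
    constructor <;> linarith
  exact fun h i j k l nd => ⟨key w w' (fun M => (H M).1) h i j k l nd,
    key w' w (fun M => (H M).2) h i j k l nd⟩

/-! ### Initial forms of three term relations -/

/-- The monomial `m` of `f` has lowest weight. -/
def IsMinMonomial {σ K : Type*} [Field K] (w : σ → ℝ) (f : MvPolynomial σ K) (m : σ →₀ ℕ) : Prop :=
  ∀ m' ∈ f.support, Finsupp.weight w m ≤ Finsupp.weight w m'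

open Classical in
lemma coeff_initialForm {σ K : Type*} [Field K] (w : σ → ℝ) (f : MvPolynomial σ K) (m : σ →₀ ℕ) :
    (initialForm w f).coeff m = if m ∈ f.support ∧ IsMinMonomial w f m then f.coeff m else 0 := by
  rw [initialForm, MvPolynomial.coeff_sum]
  simp only [MvPolynomial.coeff_monomial, Finset.sum_ite_eq', Finset.mem_filter]
  unfold IsMinMonomial
  congr

open Classical in
lemma support_initialForm {σ K : Type*} [Field K] (w : σ → ℝ) (f : MvPolynomial σ K) :
    (initialForm w f).support = f.support.filter (IsMinMonomial w f) := by
  ext m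
  rw [MvPolynomial.mem_support_iff, coeff_initialForm, Finset.mem_filter]
  by_cases h : m ∈ f.support ∧ IsMinMonomial w f m
  · simp only [h, and_self, if_true, iff_true]
    exact MvPolynomial.mem_support_iff.1 h.1
  · simp only [h, if_false, ne_eq, not_true_eq_false]

lemma initialForm_eq_iff {σ K : Type*} [Field K] (w w' : σ → ℝ) (f : MvPolynomial σ K) :
    initialForm w' f = initialForm w f ↔
      ∀ m ∈ f.support, (IsMinMonomial w f m ↔ IsMinMonomial w' f m) := by
  classical
  constructor
  · intro h m hm
    have := congrArg MvPolynomial.support h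
    rw [support_initialForm, support_initialForm, Finset.ext_iff] at this
    have := this m
    simp only [Finset.mem_filter, hm, true_and] at this
    exact this.symm
  · intro h
    ext m
    rw [coeff_initialForm, coeff_initialForm]
    by_cases hm : m ∈ f.support
    · simp only [hm, true_and, h m hm]
    · simp only [hm, false_and, if_false]

lemma card_filter_three {α : Type*} [DecidableEq α] {x y z : α} (hxy : x ≠ y) (hxz : x ≠ z)
    (hyz : y ≠ z) (f : α → ℝ) (p : α → Prop) [DecidablePred p]
    (hp : ∀ m, p m ↔ f m ≤ f x ∧ f m ≤ f y ∧ f m ≤ f z) :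
    2 ≤ (({x, y, z} : Finset α).filter p).card ↔
      (f y ≤ f x ∨ f z ≤ f x) ∧ (f x ≤ f y ∨ f z ≤ f y) ∧ (f x ≤ f z ∨ f y ≤ f z) := by
  have hx := hp x
  have hy := hp y
  have hz := hp z
  rw [Finset.filter_insert, Finset.filter_insert, Finset.filter_singleton]
  by_cases h1 : p x <;> by_cases h2 : p y <;> by_cases h3 : p z <;>
    simp [h1, h2, h3, hxy, hxz, hyz] <;> grind

/-- The three term relation for `h, i, j, k, l`. -/
def relation (K : Type*) [Field K] {n : ℕ} (h i j k l : Fin n) : MvPolynomial (DSubset 3 n) K :=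
  pluckerVar K 3 ({h} ∪ {i, j}) * pluckerVar K 3 ({h} ∪ {k, l})
      - pluckerVar K 3 ({h} ∪ {i, k}) * pluckerVar K 3 ({h} ∪ {j, l})
      + pluckerVar K 3 ({h} ∪ {i, l}) * pluckerVar K 3 ({h} ∪ {j, k})

lemma mem_threeTermRelations {K : Type*} [Field K] {n : ℕ} {f : MvPolynomial (DSubset 3 n) K} :
    f ∈ threeTermRelations K 3 n ↔
      ∃ h i j k l : Fin n, [h, i, j, k, l].Nodup ∧ f = relation K h i j k l := by
  constructor
  · rintro ⟨S, i, j, k, l, hS, hi, hj, hk, hl, nd, rfl⟩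
    obtain ⟨h, rfl⟩ := Finset.card_eq_one.1 (by omega : S.card = 1)
    refine ⟨h, i, j, k, l, ?_, rfl⟩
    rw [Finset.mem_singleton] at hi hj hk hl
    rw [List.nodup_cons]
    refine ⟨?_, nd⟩
    simp [Ne.symm hi, Ne.symm hj, Ne.symm hk, Ne.symm hl]
  · rintro ⟨h, i, j, k, l, nd, rfl⟩
    rw [List.nodup_cons] at nd
    simp only [List.mem_cons, not_or, List.not_mem_nil, not_false_eq_true, and_true] at nd
    obtain ⟨⟨h1, h2, h3, h4⟩, nd⟩ := nd
    exact ⟨{h}, i, j, k, l, by simp, by simp [Ne.symm h1], by simp [Ne.symm h2],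
      by simp [Ne.symm h3], by simp [Ne.symm h4], nd, rfl⟩

lemma pluckerVar_eq (K : Type*) [Field K] {n : ℕ} {X : DSubset 3 n} {h i j : Fin n}
    (hX : X.1 = {h, i, j}) : pluckerVar K 3 ({h} ∪ {i, j}) = MvPolynomial.X X := by
  obtain ⟨X, hc⟩ := X
  simp only at hX
  subst hX
  exact dif_pos hc

/-- The three monomials are distinct and have coefficients ±1, so nothing cancels in any
characteristic; their weights are the sums that `ThreeTerm` compares. -/
lemma support_relation (K : Type*) [Field K] {n : ℕ} {h i j k l : Fin n}
    (nd : [h, i, j, k, l].Nodup) : ∃ m1 m2 m3 : DSubset 3 n →₀ ℕ, m1 ≠ m2 ∧ m1 ≠ m3 ∧ m2 ≠ m3 ∧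
      (relation K h i j k l).support = {m1, m2, m3} ∧
      ∀ w : DSubset 3 n → ℝ, Finsupp.weight w m1 = val w h i j + val w h k l ∧
        Finsupp.weight w m2 = val w h i k + val w h j l ∧
        Finsupp.weight w m3 = val w h i l + val w h j k := by
  classical
  simp only [List.nodup_cons, List.mem_cons, not_or, List.not_mem_nil, not_false_eq_true] at nd
  obtain ⟨⟨h1, h2, h3, h4, -⟩, ⟨i1, i2, i3, -⟩, ⟨j1, j2, -⟩, ⟨k1, -⟩, -⟩ := nd
  obtain ⟨A, hA⟩ := exists_triple h1 h2 i1
  obtain ⟨A', hA'⟩ := exists_triple h3 h4 k1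
  obtain ⟨B, hB⟩ := exists_triple h1 h3 i2
  obtain ⟨B', hB'⟩ := exists_triple h2 h4 j2
  obtain ⟨C, hC⟩ := exists_triple h1 h4 i3
  obtain ⟨C', hC'⟩ := exists_triple h2 h3 j1
  have ne : ∀ {P Q : DSubset 3 n} (x : Fin n), x ∈ P.1 → x ∉ Q.1 → P ≠ Q := by
    rintro P Q x hP hQ rfl
    exact hQ hP
  have AB : A ≠ B := ne j (by simp [hA]) (by simp [hB, Ne.symm h2, Ne.symm i1, j1])
  have AB' : A ≠ B' := ne i (by simp [hA]) (by simp [hB', Ne.symm h1, i1, i3])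
  have AC : A ≠ C := ne j (by simp [hA]) (by simp [hC, Ne.symm h2, Ne.symm i1, j2])
  have AC' : A ≠ C' := ne i (by simp [hA]) (by simp [hC', Ne.symm h1, i1, i2])
  have BC : B ≠ C := ne k (by simp [hB]) (by simp [hC, Ne.symm h3, Ne.symm i2, k1])
  have BC' : B ≠ C' := ne i (by simp [hB]) (by simp [hC', Ne.symm h1, i1, i2])
  set m : DSubset 3 n → DSubset 3 n → (DSubset 3 n →₀ ℕ) := fun P Q =>
    Finsupp.single P 1 + Finsupp.single Q 1 with hm
  have hne : ∀ {P P' Q Q'}, P ≠ Q → P ≠ Q' → m P P' ≠ m Q Q' := by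
    intro P P' Q Q' e1 e2 he
    have := DFunLike.congr_fun he P
    simp [hm, Finsupp.single_apply, e1.symm, e2.symm] at this
  have n12 := hne (P' := A') AB AB'
  have n13 := hne (P' := A') AC AC'
  have n23 := hne (P' := B') BC BC'
  have hrel : relation K h i j k l = MvPolynomial.monomial (m A A') 1
      - MvPolynomial.monomial (m B B') 1 + MvPolynomial.monomial (m C C') 1 := by
    simp only [relation, pluckerVar_eq K hA, pluckerVar_eq K hA', pluckerVar_eq K hB,
      pluckerVar_eq K hB', pluckerVar_eq K hC, pluckerVar_eq K hC', hm, MvPolynomial.X,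
      MvPolynomial.monomial_mul, one_mul]
  refine ⟨m A A', m B B', m C C', n12, n13, n23, ?_, fun w => ?_⟩
  · ext x
    rw [MvPolynomial.mem_support_iff, hrel]
    simp only [MvPolynomial.coeff_add, MvPolynomial.coeff_sub, MvPolynomial.coeff_monomial,
      Finset.mem_insert, Finset.mem_singleton]
    by_cases x1 : x = m A A'
    · subst x1; simp [n12.symm, n13.symm]
    by_cases x2 : x = m B B'
    · subst x2; simp [n12, n23.symm]
    by_cases x3 : x = m C C'
    · subst x3; simp [n13, n23]
    · simp [x1, x2, x3, Ne.symm x1, Ne.symm x2, Ne.symm x3]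
  · rw [val_eq w hA, val_eq w hA', val_eq w hB, val_eq w hB', val_eq w hC, val_eq w hC']
    simp [hm, Finsupp.weight_single]

lemma mem_dressian_iff {K : Type*} [Field K] {n : ℕ} {w : DSubset 3 n → ℝ} :
    w ∈ dressian K 3 n ↔ ThreeTerm (val w) := by
  classical
  have key : ∀ h i j k l : Fin n, [h, i, j, k, l].Nodup →
      (2 ≤ (initialForm w (relation K h i j k l)).support.card ↔
        (val w h i k + val w h j l ≤ val w h i j + val w h k l ∨
         val w h i l + val w h j k ≤ val w h i j + val w h k l) ∧
        (val w h i j + val w h k l ≤ val w h i k + val w h j l ∨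
         val w h i l + val w h j k ≤ val w h i k + val w h j l) ∧
        (val w h i j + val w h k l ≤ val w h i l + val w h j k ∨
         val w h i k + val w h j l ≤ val w h i l + val w h j k)) := by
    intro h i j k l nd
    obtain ⟨m1, m2, m3, n12, n13, n23, hs, hw⟩ := support_relation K nd
    obtain ⟨w1, w2, w3⟩ := hw w
    rw [support_initialForm, hs, card_filter_three n12 n13 n23 (Finsupp.weight w), w1, w2, w3]
    intro m
    simp [IsMinMonomial, hs]
  constructor
  · intro hw h i j k l nd
    exact ((key h i j k l nd).1 (hw _ (mem_threeTermRelations.2 ⟨h, i, j, k, l, nd, rfl⟩))).1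
  · rintro hw f hf
    obtain ⟨h, i, j, k, l, nd, rfl⟩ := mem_threeTermRelations.1 hf
    rw [key h i j k l nd]
    -- `ThreeTerm` only forbids the first term to be the unique minimum; permuting the indices
    -- covers the other two.
    have e1 := hw h i j k l nd
    have e2 := hw h i k j l (by clear * - nd; grind)
    have e3 := hw h i l j k (by clear * - nd; grind)
    rw [val_swap_right w h k j] at e2
    rw [val_swap_right w h l k, val_swap_right w h l j] at e3
    exact ⟨e1, e2, e3⟩

lemma initialForm_eq_iff_sameMin {K : Type*} [Field K] {n : ℕ} {w w' : DSubset 3 n → ℝ} :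
    (∀ f ∈ threeTermRelations K 3 n, initialForm w' f = initialForm w f) ↔ SameMin w w' := by
  classical
  have key : ∀ h i j k l : Fin n, [h, i, j, k, l].Nodup →
      (initialForm w' (relation K h i j k l) = initialForm w (relation K h i j k l) ↔
      ((val w h i j + val w h k l ≤ val w h i k + val w h j l ∧
        val w h i j + val w h k l ≤ val w h i l + val w h j k) ↔
      (val w' h i j + val w' h k l ≤ val w' h i k + val w' h j l ∧
        val w' h i j + val w' h k l ≤ val w' h i l + val w' h j k)) ∧
      ((val w h i k + val w h j l ≤ val w h i j + val w h k l ∧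
        val w h i k + val w h j l ≤ val w h i l + val w h j k) ↔
      (val w' h i k + val w' h j l ≤ val w' h i j + val w' h k l ∧
        val w' h i k + val w' h j l ≤ val w' h i l + val w' h j k)) ∧
      ((val w h i l + val w h j k ≤ val w h i j + val w h k l ∧
        val w h i l + val w h j k ≤ val w h i k + val w h j l) ↔
      (val w' h i l + val w' h j k ≤ val w' h i j + val w' h k l ∧
        val w' h i l + val w' h j k ≤ val w' h i k + val w' h j l))) := by
    intro h i j k l nd
    obtain ⟨m1, m2, m3, n12, n13, n23, hs, hw⟩ := support_relation K nd
    obtain ⟨w1, w2, w3⟩ := hw w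
    obtain ⟨w1', w2', w3'⟩ := hw w'
    rw [initialForm_eq_iff]
    simp [IsMinMonomial, hs, w1, w2, w3, w1', w2', w3']
  constructor
  · intro H h i j k l nd
    exact ((key h i j k l nd).1 (H _ (mem_threeTermRelations.2 ⟨h, i, j, k, l, nd, rfl⟩))).1
  · rintro H f hf
    obtain ⟨h, i, j, k, l, nd, rfl⟩ := mem_threeTermRelations.1 hf
    rw [key h i j k l nd]
    have e1 := H h i j k l nd
    have e2 := H h i k j l (by clear * - nd; grind)
    have e3 := H h i l j k (by clear * - nd; grind)
    rw [val_swap_right w h k j, val_swap_right w' h k j] at e2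
    rw [val_swap_right w h l k, val_swap_right w h l j, val_swap_right w' h l k,
      val_swap_right w' h l j] at e3
    exact ⟨e1, e2, e3⟩

/-- The secondary fan structure on the Dressian coincides with the Plücker fan structure. -/
lemma secondaryFan_eq_pluckerFan (K : Type*) [Field K] {n : ℕ} (hn : 3 ≤ n) :
    secondaryFan 3 n = pluckerFan K 3 n := by
  have key : ∀ w : DSubset 3 n → ℝ, ThreeTerm (val w) →
      {w' | regularSubdivision w' = regularSubdivision w} = {w' | w' ∈ dressian K 3 n ∧
        ∀ f ∈ threeTermRelations K 3 n, initialForm w' f = initialForm w f} := by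
    intro w hw
    ext w'
    simp only [Set.mem_ofPred_eq]
    rw [mem_dressian_iff, initialForm_eq_iff_sameMin]
    constructor
    · intro h
      have hw' : ThreeTerm (val w') := by
        rw [← allCellsMatroidal_iff hn, h, allCellsMatroidal_iff hn]
        exact hw
      exact ⟨hw', ((regularSubdivision_eq_iff_sameMin hn hw' hw).1 h).symm⟩
    · rintro ⟨hw', h⟩
      exact (regularSubdivision_eq_iff_sameMin hn hw' hw).2 h.symm
  ext C
  constructor
  · rintro ⟨⟨S, ⟨w, rfl⟩, hS⟩, rfl⟩
    rw [allCellsMatroidal_iff hn] at hS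
    exact ⟨w, mem_dressian_iff.2 hS, key w hS⟩
  · rintro ⟨w, hw, rfl⟩
    rw [mem_dressian_iff] at hw
    exact ⟨⟨_, ⟨w, rfl⟩, (allCellsMatroidal_iff hn w).2 hw⟩, (key w hw).symm⟩

/-! ### Sides of the edges of a tree -/

/-- The nodes that are on the side of `v` of the edge `uv`. -/
def side {V : Type*} (G : SimpleGraph V) (u v : V) : Set V :=
  {x | (G.deleteEdges {s(u, v)}).Reachable x v}

lemma mem_side_right {V : Type*} (G : SimpleGraph V) (u v : V) : v ∈ side G u v :=
  SimpleGraph.Reachable.refl _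

lemma mem_side_iff_of_adj {V : Type*} {G : SimpleGraph V} {u v x y : V} (h : G.Adj x y)
    (hne : s(x, y) ≠ s(u, v)) : x ∈ side G u v ↔ y ∈ side G u v := by
  have h' : (G.deleteEdges {s(u, v)}).Adj x y := by
    rw [SimpleGraph.deleteEdges_adj]
    exact ⟨h, hne⟩
  exact ⟨fun hx => h'.symm.reachable.trans hx, fun hy => h'.reachable.trans hy⟩

lemma notMem_side_left {V : Type*} {G : SimpleGraph V} (hG : G.IsTree) {u v : V} (h : G.Adj u v) :
    u ∉ side G u v :=
  SimpleGraph.isBridge_iff.1 (SimpleGraph.isAcyclic_iff_forall_adj_isBridge.1 hG.isAcyclic h)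

lemma mem_side_iff_of_walk {V : Type*} {G : SimpleGraph V} {u v x y : V} (p : G.Walk x y)
    (hp : s(u, v) ∉ p.edges) : x ∈ side G u v ↔ y ∈ side G u v := by
  induction p with
  | nil => rfl
  | cons h p ih =>
    rw [SimpleGraph.Walk.edges_cons, List.mem_cons, not_or] at hp
    rw [mem_side_iff_of_adj h (Ne.symm hp.1), ih hp.2]

lemma side_union {V : Type*} {G : SimpleGraph V} (hG : G.IsTree) (u v x : V) :
    x ∈ side G u v ∨ x ∈ side G v u := by
  obtain ⟨p⟩ := hG.connected.preconnected x v
  induction p with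
  | nil => exact Or.inl (mem_side_right _ _ _)
  | @cons x y z h p ih =>
    by_cases he : s(x, y) = s(u, z)
    · rcases Sym2.eq_iff.1 he with ⟨rfl, rfl⟩ | ⟨rfl, rfl⟩
      · exact Or.inr (mem_side_right _ _ _)
      · exact Or.inl (mem_side_right _ _ _)
    · rw [mem_side_iff_of_adj h he, mem_side_iff_of_adj h (by rwa [Sym2.eq_swap (a := z)])]
      exact ih

lemma notMem_side_iff {V : Type*} {G : SimpleGraph V} (hG : G.IsTree) {u v : V} (h : G.Adj u v)
    (x : V) : x ∉ side G u v ↔ x ∈ side G v u := by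
  refine ⟨(side_union hG u v x).resolve_left, fun hx hx' => notMem_side_left hG h ?_⟩
  have e : s(v, u) = s(u, v) := Sym2.eq_swap
  have h1 : (G.deleteEdges {s(u, v)}).Reachable x u := by
    have : (G.deleteEdges {s(v, u)}).Reachable x u := hx
    rwa [e] at this
  exact h1.symm.trans hx'

/-- The edges of a path in a tree are those that separate its end points. -/
lemma mem_edges_iff {V : Type*} {G : SimpleGraph V} (hG : G.IsTree) {u v x y : V} (h : G.Adj u v)
    {p : G.Walk x y} (hp : p.IsPath) :
    s(u, v) ∈ p.edges ↔ ¬ (x ∈ side G u v ↔ y ∈ side G u v) := by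
  classical
  refine ⟨fun he hs => ?_, fun hs => by_contra fun he => hs (mem_side_iff_of_walk p he)⟩
  -- End points on the same side are joined by a path that avoids the edge, and paths in a tree are
  -- unique.
  have hr : (G.deleteEdges {s(u, v)}).Reachable x y := by
    by_cases hx : x ∈ side G u v
    · have h1 : (G.deleteEdges {s(u, v)}).Reachable x v := hx
      have h2 : (G.deleteEdges {s(u, v)}).Reachable y v := hs.1 hx
      exact h1.trans h2.symm
    · have h1 : (G.deleteEdges {s(v, u)}).Reachable x u := (notMem_side_iff hG h x).1 hx
      have h2 : (G.deleteEdges {s(v, u)}).Reachable y u :=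
        (notMem_side_iff hG h y).1 fun hy => hx (hs.2 hy)
      rw [Sym2.eq_swap]
      exact h1.trans h2.symm
  obtain ⟨q, hq⟩ := hr.exists_isPath
  have hle := SimpleGraph.deleteEdges_le (G := G) {s(u, v)}
  have hq' : (q.mapLe hle).IsPath := (SimpleGraph.Walk.isPath_mapLe hle).2 hq
  have hpq := (hG.existsUnique_path x y).unique hp hq'
  rw [hpq, SimpleGraph.Walk.edges_mapLe_eq_edges] at he
  have := q.edges_subset_edgeSet he
  rw [SimpleGraph.mem_edgeSet, SimpleGraph.deleteEdges_adj] at this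
  exact this.2 rfl

/-- If an end point of an edge is on one side of `uv`, all nodes on the other side of `uv` are on
the same side of that edge. -/
lemma mem_side_iff_of_notMem {V : Type*} {G : SimpleGraph V} (hG : G.IsTree) {u v u' v' x : V}
    (h : G.Adj u v) (h' : G.Adj u' v') (hu' : u' ∈ side G u v) (hx : x ∉ side G u v) :
    x ∈ side G u' v' ↔ u ∈ side G u' v' := by
  classical
  obtain ⟨p, hp, -⟩ := hG.existsUnique_path x u
  have h1 : s(u, v) ∉ p.edges := by
    rw [mem_edges_iff hG h hp, not_not]
    simp [hx, notMem_side_left hG h]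
  apply mem_side_iff_of_walk p
  intro he
  have hsup := p.fst_mem_support_of_mem_edges he
  have h2 : s(u, v) ∉ (p.takeUntil u' hsup).edges := fun h =>
    h1 (p.edges_takeUntil_subset_edges hsup h)
  exact hx ((mem_side_iff_of_walk _ h2).2 hu')

lemma side_subset_side {V : Type*} {G : SimpleGraph V} (hG : G.IsTree) {u v z : V}
    (h : G.Adj u v) (hz : G.Adj v z) (hne : z ≠ u) : side G v z ⊆ side G u v := by
  intro x hx
  by_contra hxu
  rw [mem_side_iff_of_notMem hG h hz (mem_side_right _ _ _) hxu,
    mem_side_iff_of_adj h (by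
      intro e
      rcases Sym2.eq_iff.1 e with ⟨e1, -⟩ | ⟨e1, -⟩
      · exact h.ne e1
      · exact hne e1.symm)] at hx
  exact notMem_side_left hG hz hx

lemma mem_side_iff_mem_side {V : Type*} {G : SimpleGraph V} {u v u' v' : V}
    (h' : G.Adj u' v') (hne : s(u, v) ≠ s(u', v')) : u' ∈ side G u v ↔ v' ∈ side G u v :=
  mem_side_iff_of_adj h' hne.symm

/-! ### Leaves on the two sides of an edge -/

namespace LeafTree

variable {L : Type} (A : LeafTree L)

/-- The leaves on the side of `v` of the edge `uv`. -/
def leafSide (u v : A.V) : Set L := {j | A.leaf j ∈ side A.G u v}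

lemma compl_leafSide {u v : A.V} (h : A.G.Adj u v) : (A.leafSide u v)ᶜ = A.leafSide v u := by
  ext j
  exact notMem_side_iff A.isTree h _

lemma exists_ne_adj {u v : A.V} (h : A.G.Adj u v) (hv : v ∉ Set.range A.leaf) :
    ∃ z, A.G.Adj v z ∧ z ≠ u := by
  by_contra! hz
  apply hv
  rw [A.mem_range_leaf_iff, Set.ncard_eq_one]
  exact ⟨u, Set.eq_singleton_iff_unique_mem.2 ⟨h.symm, hz⟩⟩

/-- If `v` is not a leaf, one can walk on to a neighbour other than `u`. The side strictly shrinks,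
so the walk ends at a leaf. -/
lemma leafSide_nonempty {u v : A.V} (h : A.G.Adj u v) : (A.leafSide u v).Nonempty := by
  have := A.finite_V
  induction hm : (side A.G u v).ncard using Nat.strong_induction_on generalizing u v with
  | _ m ih =>
  subst hm
  by_cases hv : v ∈ Set.range A.leaf
  · obtain ⟨j, rfl⟩ := hv
    exact ⟨j, mem_side_right _ _ _⟩
  · obtain ⟨z, hz, hzu⟩ := A.exists_ne_adj h hv
    have hsub := side_subset_side A.isTree h hz hzu
    have hlt : (side A.G v z).ncard < (side A.G u v).ncard := by
      refine Set.ncard_lt_ncard ((Set.ssubset_iff_of_subset hsub).2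
        ⟨v, mem_side_right _ _ _, notMem_side_left A.isTree hz⟩) (Set.toFinite _)
    obtain ⟨j, hj⟩ := ih _ hlt hz rfl
    exact ⟨j, hsub hj⟩

/-- Between two edges there is always a leaf. -/
lemma exists_leaf_between {u v u' v' : A.V} (h : A.G.Adj u v) (h' : A.G.Adj u' v')
    (hne : s(u, v) ≠ s(u', v')) (hv' : v' ∈ side A.G u v) (hu : u ∉ side A.G u' v') :
    ∃ j, j ∈ A.leafSide u v ∧ j ∉ A.leafSide u' v' := by
  have hG := A.isTree
  have := A.finite_V
  have hv : v ∉ side A.G u' v' := by rwa [← mem_side_iff_mem_side h hne.symm]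
  by_cases hl : v ∈ Set.range A.leaf
  · obtain ⟨j, rfl⟩ := hl
    exact ⟨j, mem_side_right _ _ _, hv⟩
  obtain ⟨z1, hz1, hz1u⟩ := A.exists_ne_adj h hl
  -- This is where degree two is excluded: `v` has two branches besides the one of `u`. At most one
  -- of them contains `v'`, and the other one provides the leaf.
  obtain ⟨z2, hz2, hz2u, hz12⟩ : ∃ z2, A.G.Adj v z2 ∧ z2 ≠ u ∧ z1 ≠ z2 := by
    by_contra! hz
    apply A.ncard_ne_two v
    rw [Set.ncard_eq_two]
    refine ⟨u, z1, hz1u.symm, Set.Subset.antisymm (fun z hzv => ?_) ?_⟩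
    · by_cases hzu : z = u
      · exact Or.inl hzu
      · exact Or.inr (hz z hzv hzu).symm
    · rintro z (rfl | rfl)
      exacts [h.symm, hz1]
  obtain ⟨z, hz, hzu, hzv'⟩ : ∃ z, A.G.Adj v z ∧ z ≠ u ∧ v' ∉ side A.G v z := by
    by_cases h1 : v' ∈ side A.G v z1
    · refine ⟨z2, hz2, hz2u, fun h2 => ?_⟩
      have := side_subset_side hG hz1.symm hz2 hz12.symm h2
      exact (notMem_side_iff hG hz1 v').2 this h1
    · exact ⟨z1, hz1, hz1u, h1⟩
  obtain ⟨j, hj⟩ := A.leafSide_nonempty hz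
  refine ⟨j, side_subset_side hG h hz hzu hj, ?_⟩
  have hne' : s(v, z) ≠ s(v', u') := by
    intro e
    rcases Sym2.eq_iff.1 e with ⟨e1, -⟩ | ⟨-, e1⟩
    · exact hv (e1 ▸ mem_side_right _ _ _)
    · exact hzv' (e1 ▸ mem_side_right _ _ _)
  have hvv : v ∈ side A.G v' u' := (notMem_side_iff hG h' v).1 hv
  have hzz : z ∈ side A.G v' u' := (mem_side_iff_of_adj hz hne').1 hvv
  have hv'z : v' ∈ side A.G z v := (notMem_side_iff hG hz v').1 hzv'
  have hjz : A.leaf j ∉ side A.G z v := (notMem_side_iff hG hz.symm _).2 hj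
  have := (mem_side_iff_of_notMem hG hz.symm h'.symm hv'z hjz).2 hzz
  exact (notMem_side_iff hG h' _).2 this

/-- Two sides with a common node are nested or face each other. A nested side has a leaf of its own,
and edges facing each other have a leaf in between. -/
lemma inter_leafSide_nonempty {u v u' v' x : A.V} (h : A.G.Adj u v) (h' : A.G.Adj u' v')
    (hx : x ∈ side A.G u v) (hx' : x ∈ side A.G u' v') :
    (A.leafSide u v ∩ A.leafSide u' v').Nonempty := by
  have hG := A.isTree
  by_cases hne : s(u, v) = s(u', v')
  · rcases Sym2.eq_iff.1 hne with ⟨rfl, rfl⟩ | ⟨rfl, rfl⟩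
    · simpa using A.leafSide_nonempty h
    · exact absurd hx ((notMem_side_iff hG h x).2 hx')
  by_cases hv' : v' ∈ side A.G u v
  · by_cases hu : u ∈ side A.G u' v'
    · obtain ⟨j, hj, hj'⟩ := A.exists_leaf_between h h'.symm (by rwa [Sym2.eq_swap (a := v')])
        ((mem_side_iff_mem_side h' hne).2 hv') (by rwa [notMem_side_iff hG h'.symm])
      rw [← Set.mem_compl_iff, A.compl_leafSide h'.symm] at hj'
      exact ⟨j, hj, hj'⟩
    · obtain ⟨j, hj⟩ := A.leafSide_nonempty h'
      refine ⟨j, ?_, hj⟩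
      by_contra hju
      exact hu ((mem_side_iff_of_notMem hG h h' ((mem_side_iff_mem_side h' hne).2 hv') hju).1 hj)
  · have hu' : u' ∈ side A.G v u :=
      (notMem_side_iff hG h _).1 fun hc => hv' ((mem_side_iff_mem_side h' hne).1 hc)
    have key : ∀ y ∈ side A.G u v, (y ∈ side A.G u' v' ↔ v ∈ side A.G u' v') := fun y hy =>
      mem_side_iff_of_notMem hG h.symm h' hu' ((notMem_side_iff hG h.symm y).2 hy)
    obtain ⟨j, hj⟩ := A.leafSide_nonempty h
    exact ⟨j, hj, (key _ hj).2 ((key x hx).1 hx')⟩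

/-- If the sides differed in a node, `inter_leafSide_nonempty` would find a leaf in which they
differ as well. -/
lemma leafSide_injective {u v u' v' : A.V} (h : A.G.Adj u v) (h' : A.G.Adj u' v')
    (he : A.leafSide u v = A.leafSide u' v') : u = u' ∧ v = v' := by
  have hG := A.isTree
  have hdisj : ∀ j, j ∈ A.leafSide u v → j ∈ A.leafSide v' u' → False := by
    intro j hj hj'
    rw [he] at hj
    rw [← A.compl_leafSide h'] at hj'
    exact hj' hj
  have hdisj' : ∀ j, j ∈ A.leafSide v u → j ∈ A.leafSide u' v' → False := by
    intro j hj hj'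
    rw [← he] at hj'
    rw [← A.compl_leafSide h] at hj
    exact hj hj'
  have e1 : ∀ x, x ∈ side A.G u v → x ∈ side A.G u' v' := by
    intro x hx
    by_contra hx'
    obtain ⟨j, hj, hj'⟩ := A.inter_leafSide_nonempty h h'.symm hx ((notMem_side_iff hG h' x).1 hx')
    exact hdisj j hj hj'
  have e2 : ∀ x, x ∈ side A.G u' v' → x ∈ side A.G u v := by
    intro x hx
    by_contra hx'
    obtain ⟨j, hj, hj'⟩ := A.inter_leafSide_nonempty h.symm h' ((notMem_side_iff hG h x).1 hx') hx
    exact hdisj' j hj hj'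
  have hs : s(u, v) = s(u', v') := by
    by_contra hne
    have hv := e1 v (mem_side_right _ _ _)
    have hu := (mem_side_iff_mem_side h (Ne.symm hne)).2 hv
    exact notMem_side_left hG h (e2 u hu)
  rcases Sym2.eq_iff.1 hs with e | ⟨rfl, rfl⟩
  · exact e
  · exact absurd (e1 v (mem_side_right _ _ _)) (notMem_side_left hG h')

lemma side_leaf {j : L} {u : A.V} (h : A.G.Adj u (A.leaf j)) :
    side A.G u (A.leaf j) = {A.leaf j} := by
  have hG := A.isTree
  apply Set.eq_singleton_iff_unique_mem.2 ⟨mem_side_right _ _ _, fun x hx => ?_⟩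
  by_contra hne
  obtain ⟨y, hy⟩ := Set.ncard_eq_one.1 ((A.mem_range_leaf_iff (A.leaf j)).1 ⟨j, rfl⟩)
  obtain ⟨p, hp, -⟩ := hG.existsUnique_path (A.leaf j) x
  have : s(u, A.leaf j) ∈ p.edges := by
    cases p with
    | nil => exact absurd rfl hne
    | @cons _ z _ hz q =>
      have h1 : u = y := by
        have : u ∈ A.G.neighborSet (A.leaf j) := h.symm
        rwa [hy] at this
      have h2 : z = y := by
        have : z ∈ A.G.neighborSet (A.leaf j) := hz
        rwa [hy] at this
      have h3 : z = u := h2.trans h1.symm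
      subst h3
      rw [SimpleGraph.Walk.edges_cons, Sym2.eq_swap]
      exact List.mem_cons_self
  rw [mem_edges_iff hG h hp] at this
  exact this ⟨fun _ => hx, fun _ => mem_side_right _ _ _⟩

lemma leafSide_leaf {j : L} {u : A.V} (h : A.G.Adj u (A.leaf j)) :
    A.leafSide u (A.leaf j) = {j} := by
  ext k
  simp only [leafSide, Set.mem_ofPred_eq, A.side_leaf h, Set.mem_singleton_iff,
    A.leaf_injective.eq_iff]

lemma exists_adj_leaf (j : L) : ∃ u, A.G.Adj u (A.leaf j) := by
  obtain ⟨y, hy⟩ := Set.ncard_eq_one.1 ((A.mem_range_leaf_iff (A.leaf j)).1 ⟨j, rfl⟩)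
  refine ⟨y, ?_⟩
  have : y ∈ A.G.neighborSet (A.leaf j) := by rw [hy]; rfl
  exact this.symm

/-- The splits of the leaves induced by the edges of a tree. -/
def splits : Set (Set L) := {B | ∃ u v, A.G.Adj u v ∧ B = A.leafSide u v}

end LeafTree

/-! ### Split systems and their trees -/

/-- A system of pairwise compatible splits of `L` that contains all the trivial splits. A split is
represented by both of its parts. -/
structure IsSplitSystem {L : Type} (S : Set (Set L)) : Prop where
  compl_mem : ∀ B ∈ S, Bᶜ ∈ S
  singleton_mem : ∀ j, {j} ∈ S
  nonempty : ∀ B ∈ S, B.Nonempty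
  compat : ∀ B ∈ S, ∀ C ∈ S, B ⊆ C ∨ B ⊆ Cᶜ ∨ Bᶜ ⊆ C ∨ C ⊆ B

/-- A consistent choice of a part of each split. -/
structure IsOrientation {L : Type} (S σ : Set (Set L)) : Prop where
  subset : σ ⊆ S
  compl_mem_iff : ∀ B ∈ S, (Bᶜ ∈ σ ↔ B ∉ σ)
  inter_nonempty : ∀ B ∈ σ, ∀ C ∈ σ, (B ∩ C).Nonempty

/-- `τ` arises from `σ` by flipping the part `B`. -/
def FlipAt {L : Type} (σ τ : Set (Set L)) (B : Set L) : Prop :=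
  B ∈ σ ∧ B ∉ τ ∧ ∀ C ∈ σ, C ≠ B → C ∈ τ

namespace IsOrientation

variable {L : Type} {S σ τ ρ : Set (Set L)} {B C : Set L}

lemma compl_mem (hσ : IsOrientation S σ) (hB : B ∈ S) (h : B ∉ σ) : Bᶜ ∈ σ :=
  (hσ.compl_mem_iff B hB).2 h

lemma compl_notMem (hσ : IsOrientation S σ) (hB : B ∈ σ) : Bᶜ ∉ σ := fun h =>
  (hσ.compl_mem_iff B (hσ.subset hB)).1 h hB

lemma mem_of_subset (hσ : IsOrientation S σ) (hB : B ∈ σ) (hC : C ∈ S) (h : B ⊆ C) : C ∈ σ := by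
  by_contra hc
  obtain ⟨x, hx, hx'⟩ := hσ.inter_nonempty B hB _ (hσ.compl_mem hC hc)
  exact hx' (h hx)

lemma eq_of_subset (hσ : IsOrientation S σ) (hτ : IsOrientation S τ) (h : σ ⊆ τ) : σ = τ := by
  refine h.antisymm fun B hB => ?_
  by_contra hc
  exact hτ.compl_notMem hB (h (hσ.compl_mem (hτ.subset hB) hc))

lemma flipAt_symm (hS : IsSplitSystem S) (hσ : IsOrientation S σ) (hτ : IsOrientation S τ)
    (h : FlipAt σ τ B) : FlipAt τ σ Bᶜ := by
  refine ⟨hτ.compl_mem (hσ.subset h.1) h.2.1, hσ.compl_notMem h.1, fun C hC hne => ?_⟩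
  by_contra hc
  refine hτ.compl_notMem hC (h.2.2 _ (hσ.compl_mem (hτ.subset hC) hc) fun e => hne ?_)
  rw [← e, compl_compl]

lemma flipAt_minimal (hσ : IsOrientation S σ) (hτ : IsOrientation S τ)
    (h : FlipAt σ τ B) : ∀ C ∈ σ, C ⊆ B → C = B := by
  intro C hC hCB
  by_contra hne
  exact h.2.1 (hτ.mem_of_subset (h.2.2 C hC hne) (hσ.subset h.1) hCB)

/-- The new part `Bᶜ` meets every remaining part `C`, since otherwise `C ⊆ B`, against minimality.
-/
lemma exists_flipAt (hS : IsSplitSystem S) (hσ : IsOrientation S σ) (hB : B ∈ σ)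
    (hmin : ∀ C ∈ σ, C ⊆ B → C = B) : ∃ τ, IsOrientation S τ ∧ FlipAt σ τ B := by
  have hBc : Bᶜ ∈ S := hS.compl_mem B (hσ.subset hB)
  have hne : B ≠ Bᶜ := fun e => hσ.compl_notMem hB (e ▸ hB)
  have key : ∀ C ∈ σ, C ≠ B → (C ∩ Bᶜ).Nonempty := fun C hC hCB => by
    by_contra hc
    exact hCB (hmin C hC (Set.sdiff_eq_empty.1 (Set.not_nonempty_iff_eq_empty.1 hc)))
  refine ⟨{C | (C ∈ σ ∧ C ≠ B) ∨ C = Bᶜ}, ⟨?_, ?_, ?_⟩, hB, ?_, fun C hC hCB => Or.inl ⟨hC, hCB⟩⟩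
  · rintro C (hC | rfl)
    exacts [hσ.subset hC.1, hBc]
  · intro C hC
    simp only [Set.mem_ofPred_eq, hσ.compl_mem_iff C hC, compl_inj_iff]
    by_cases h1 : C = B
    · subst h1
      simp [hne]
    · by_cases h2 : C = Bᶜ
      · subst h2
        simp [hne, hne.symm, hB]
      · have h3 : Cᶜ ≠ B := fun e => h2 (by rw [← e, compl_compl])
        simp [h1, h2, h3]
  · rintro C (⟨hC, hCB⟩ | rfl) D (⟨hD, hDB⟩ | rfl)
    · exact hσ.inter_nonempty C hC D hD
    · exact key C hC hCB
    · rw [Set.inter_comm]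
      exact key D hD hDB
    · rw [Set.inter_self]
      exact hS.nonempty _ hBc
  · rintro (h | h)
    exacts [h.2 rfl, hne h]

lemma flipAt_unique (hS : IsSplitSystem S) (hσ : IsOrientation S σ) (hτ : IsOrientation S τ)
    (hρ : IsOrientation S ρ) (h : FlipAt σ τ B) (h' : FlipAt σ ρ B) : τ = ρ := by
  refine hτ.eq_of_subset hρ fun C hC => ?_
  by_cases hCσ : C ∈ σ
  · exact h'.2.2 C hCσ fun e => h.2.1 (e ▸ hC)
  · by_cases e : C = Bᶜ
    · exact e ▸ hρ.compl_mem (hσ.subset h.1) h'.2.1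
    · exact absurd ((flipAt_symm hS hσ hτ h).2.2 C hC e) hCσ

/-- A part is minimal in at most one orientation. -/
lemma eq_of_minimal (hS : IsSplitSystem S) (hσ : IsOrientation S σ) (hρ : IsOrientation S ρ)
    (hB : B ∈ σ) (hmin : ∀ C ∈ σ, C ⊆ B → C = B) (hB' : B ∈ ρ)
    (hmin' : ∀ C ∈ ρ, C ⊆ B → C = B) : σ = ρ := by
  refine hσ.eq_of_subset hρ fun C hC => ?_
  by_contra hc
  have hCS := hσ.subset hC
  have hCc := hρ.compl_mem hCS hc
  rcases hS.compat B (hσ.subset hB) C hCS with h | h | h | h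
  · exact hc (hρ.mem_of_subset hB' hCS h)
  · obtain ⟨x, hx, hx'⟩ := hσ.inter_nonempty B hB C hC
    exact h hx hx'
  · have := hmin' _ hCc (Set.compl_subset_comm.1 h)
    exact hσ.compl_notMem hC (this ▸ hB)
  · exact hc (hmin C hC h ▸ hB')

lemma eq_of_flipAt (hS : IsSplitSystem S) {σ' τ' : Set (Set L)} (hσ : IsOrientation S σ)
    (hτ : IsOrientation S τ) (hσ' : IsOrientation S σ') (hτ' : IsOrientation S τ')
    (h : FlipAt σ τ B) (h' : FlipAt σ' τ' B) : σ = σ' ∧ τ = τ' := by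
  have e := eq_of_minimal hS hσ hσ' h.1 (flipAt_minimal hσ hτ h) h'.1 (flipAt_minimal hσ' hτ' h')
  subst e
  exact ⟨rfl, flipAt_unique hS hσ hτ hτ' h h'⟩

end IsOrientation

namespace IsSplitSystem

variable {L : Type} {S : Set (Set L)}

/-- The graph of all orientations of a split system. -/
def graph (hS : IsSplitSystem S) : SimpleGraph {σ : Set (Set L) // IsOrientation S σ} where
  Adj σ τ := ∃ B, FlipAt σ.1 τ.1 B
  symm := ⟨fun σ τ ⟨B, h⟩ => ⟨Bᶜ, IsOrientation.flipAt_symm hS σ.2 τ.2 h⟩⟩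
  loopless := ⟨fun σ ⟨B, h⟩ => h.2.1 h.1⟩

/-- The orientation given by an element of `L`. -/
lemma isOrientation_leaf (hS : IsSplitSystem S) (j : L) :
    IsOrientation S {B | B ∈ S ∧ j ∈ B} := by
  refine ⟨fun B hB => hB.1, fun B hB => ?_, fun B hB C hC => ⟨j, hB.2, hC.2⟩⟩
  simp [hB, hS.compl_mem B hB]

lemma exists_minimal_subset [Finite L] (σ : Set (Set L)) {B : Set L} (hB : B ∈ σ) :
    ∃ A ∈ σ, A ⊆ B ∧ ∀ C ∈ σ, C ⊆ A → C = A := by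
  obtain ⟨A, hAB, hA⟩ := (Set.toFinite σ).exists_le_minimal hB
  exact ⟨A, hA.prop, hAB, fun C hC hCA => hCA.antisymm (hA.le_of_le hC hCA)⟩

/-- A minimal element of `σ \ τ` is minimal in `σ`, because `τ` is closed under larger parts.
Flipping it brings `σ` closer to `τ`. -/
lemma preconnected [Finite L] (hS : IsSplitSystem S) : hS.graph.Preconnected := by
  intro σ τ
  induction hm : (σ.1 \ τ.1).ncard using Nat.strong_induction_on generalizing σ with
  | _ m ih =>
  subst hm
  by_cases hne : (σ.1 \ τ.1).Nonempty
  · obtain ⟨B0, hB0⟩ := hne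
    obtain ⟨B, hB, -, hmin⟩ := exists_minimal_subset _ hB0
    have hmin' : ∀ C ∈ σ.1, C ⊆ B → C = B := fun C hC hCB =>
      hmin C ⟨hC, fun hC' => hB.2 (τ.2.mem_of_subset hC' (σ.2.subset hB.1) hCB)⟩ hCB
    obtain ⟨ρ, hρ, hf⟩ := IsOrientation.exists_flipAt hS σ.2 hB.1 hmin'
    have hadj : hS.graph.Adj σ ⟨ρ, hρ⟩ := ⟨B, hf⟩
    refine hadj.reachable.trans (ih _ ?_ ⟨ρ, hρ⟩ rfl)
    refine Set.ncard_lt_ncard ((Set.ssubset_iff_of_subset fun C hC => ?_).2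
      ⟨B, hB, fun h => hf.2.1 h.1⟩) (Set.toFinite _)
    refine ⟨?_, hC.2⟩
    by_contra hCσ
    by_cases e : C = Bᶜ
    · exact hC.2 (e ▸ τ.2.compl_mem (σ.2.subset hB.1) hB.2)
    · exact hCσ ((IsOrientation.flipAt_symm hS σ.2 hρ hf).2.2 C hC.1 e)
  · rw [Set.not_nonempty_iff_eq_empty, Set.sdiff_eq_empty] at hne
    rw [Subtype.ext (σ.2.eq_of_subset τ.2 hne)]

/-- Membership of `B` changes only at an edge that flips `B` or `Bᶜ`, and by
`IsOrientation.eq_of_flipAt` there is just one. This makes every edge a bridge. -/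
lemma mem_iff_of_reachable (hS : IsSplitSystem S)
    {σ τ x y : {σ : Set (Set L) // IsOrientation S σ}} {B : Set L} (h : FlipAt σ.1 τ.1 B)
    (hr : (hS.graph.deleteEdges {s(σ, τ)}).Reachable x y) : B ∈ x.1 ↔ B ∈ y.1 := by
  obtain ⟨p⟩ := hr
  induction p with
  | nil => rfl
  | @cons x y z hxy p ih =>
    rw [← ih]
    rw [SimpleGraph.deleteEdges_adj] at hxy
    obtain ⟨⟨C, hC⟩, hne⟩ := hxy
    have hCB : C ≠ B := fun e => by
      subst e
      obtain ⟨h1, h2⟩ := IsOrientation.eq_of_flipAt hS x.2 y.2 σ.2 τ.2 hC h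
      exact hne (by rw [Subtype.ext h1, Subtype.ext h2]; rfl)
    have hCB' : B ≠ Cᶜ := fun e => by
      have := IsOrientation.flipAt_symm hS x.2 y.2 hC
      rw [← e] at this
      obtain ⟨h1, h2⟩ := IsOrientation.eq_of_flipAt hS y.2 x.2 σ.2 τ.2 this h
      exact hne (by rw [Subtype.ext h1, Subtype.ext h2, Sym2.eq_swap]; rfl)
    exact ⟨fun hB => hC.2.2 B hB hCB.symm,
      fun hB => (IsOrientation.flipAt_symm hS x.2 y.2 hC).2.2 B hB hCB'⟩

lemma isTree_graph [Finite L] [Nonempty L] (hS : IsSplitSystem S) : hS.graph.IsTree := by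
  obtain ⟨j⟩ := ‹Nonempty L›
  have : Nonempty {σ : Set (Set L) // IsOrientation S σ} := ⟨⟨_, hS.isOrientation_leaf j⟩⟩
  refine ⟨⟨hS.preconnected⟩, SimpleGraph.isAcyclic_iff_forall_adj_isBridge.2 fun σ τ h => ?_⟩
  obtain ⟨B, hB⟩ := h
  rw [SimpleGraph.isBridge_iff]
  exact fun hr => hB.2.1 ((hS.mem_iff_of_reachable hB hr).1 hB.1)

lemma neighborSet_leaf (hS : IsSplitSystem S) (j : L) :
    (hS.graph.neighborSet ⟨_, hS.isOrientation_leaf j⟩).ncard = 1 := by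
  have hmin : ∀ C ∈ {B | B ∈ S ∧ j ∈ B}, C ⊆ {j} → C = {j} := fun C hC h =>
    h.antisymm (by simpa using hC.2)
  have hj : {j} ∈ {B | B ∈ S ∧ j ∈ B} := ⟨hS.singleton_mem j, rfl⟩
  obtain ⟨τ, hτ, hf⟩ := IsOrientation.exists_flipAt hS (hS.isOrientation_leaf j) hj hmin
  rw [Set.ncard_eq_one]
  refine ⟨⟨τ, hτ⟩, Set.eq_singleton_iff_unique_mem.2 ⟨⟨_, hf⟩, ?_⟩⟩
  rintro ρ ⟨B, hB⟩
  have e : {j} = B := IsOrientation.flipAt_minimal (hS.isOrientation_leaf j) ρ.2 hB _ hj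
    (by simpa using hB.1.2)
  subst e
  exact Subtype.ext (IsOrientation.flipAt_unique hS (hS.isOrientation_leaf j) ρ.2 hτ hB hf)

/-- The tree of a split system, due to Buneman. -/
def tree [Finite L] [Nonempty L] (hS : IsSplitSystem S) : LeafTree L where
  V := {σ : Set (Set L) // IsOrientation S σ}
  finite_V := inferInstance
  G := hS.graph
  isTree := hS.isTree_graph
  leaf j := ⟨_, hS.isOrientation_leaf j⟩
  leaf_injective j k h := by
    have h1 : {j} ∈ {B | B ∈ S ∧ j ∈ B} := ⟨hS.singleton_mem j, rfl⟩
    have h2 : {B | B ∈ S ∧ j ∈ B} = {B | B ∈ S ∧ k ∈ B} := Subtype.ext_iff.1 h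
    rw [h2] at h1
    exact h1.2.symm
  mem_range_leaf_iff σ := by
    constructor
    · rintro ⟨j, rfl⟩
      exact hS.neighborSet_leaf j
    -- With a single neighbour there is a single minimal part `A`, contained in all others. Any
    -- element of `A` is then the label of the node.
    · intro h
      obtain ⟨τ, hτ⟩ := Set.ncard_eq_one.1 h
      obtain ⟨A, hA⟩ : τ ∈ hS.graph.neighborSet σ := by rw [hτ]; rfl
      obtain ⟨j, hj⟩ := hS.nonempty A (σ.2.subset hA.1)
      refine ⟨j, Subtype.ext (σ.2.eq_of_subset (hS.isOrientation_leaf j) fun C hC => ?_).symm⟩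
      obtain ⟨D, hD, hDC, hmin⟩ := exists_minimal_subset _ hC
      obtain ⟨ρ, hρ, hf⟩ := IsOrientation.exists_flipAt hS σ.2 hD hmin
      have h1 : (⟨ρ, hρ⟩ : {σ : Set (Set L) // IsOrientation S σ}) ∈ hS.graph.neighborSet σ :=
        ⟨D, hf⟩
      rw [hτ] at h1
      have h2 : ρ = τ.1 := Subtype.ext_iff.1 h1
      subst h2
      have h3 : A = D := by
        by_contra hne
        exact hf.2.1 (hA.2.2 D hD (Ne.symm hne))
      subst h3
      exact ⟨σ.2.subset hC, hDC hj⟩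
  ncard_ne_two σ := by
    intro h
    obtain ⟨τ, τ', hne, hτ⟩ := Set.ncard_eq_two.1 h
    obtain ⟨A, hA⟩ : τ ∈ hS.graph.neighborSet σ := by rw [hτ]; simp
    obtain ⟨A', hA'⟩ : τ' ∈ hS.graph.neighborSet σ := by rw [hτ]; simp
    have hAA : A ≠ A' := by
      rintro rfl
      exact hne (Subtype.ext (IsOrientation.flipAt_unique hS σ.2 τ.2 τ'.2 hA hA'))
    -- With exactly two minimal parts, an element `i` common to both lies in every part. So `{i}`
    -- belongs to the orientation, and both minimal parts equal it.
    obtain ⟨i, hi, hi'⟩ := σ.2.inter_nonempty A hA.1 A' hA'.1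
    have key : ∀ C ∈ σ.1, i ∈ C := by
      intro C hC
      obtain ⟨D, hD, hDC, hmin⟩ := exists_minimal_subset _ hC
      obtain ⟨ρ, hρ, hf⟩ := IsOrientation.exists_flipAt hS σ.2 hD hmin
      have h1 : (⟨ρ, hρ⟩ : {σ : Set (Set L) // IsOrientation S σ}) ∈ hS.graph.neighborSet σ :=
        ⟨D, hf⟩
      rw [hτ] at h1
      rcases h1 with h1 | h1
      · have h2 : ρ = τ.1 := Subtype.ext_iff.1 h1
        subst h2
        have h3 : A = D := by
          by_contra hne
          exact hf.2.1 (hA.2.2 D hD (Ne.symm hne))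
        exact hDC (h3 ▸ hi)
      · have h2 : ρ = τ'.1 := Subtype.ext_iff.1 h1
        subst h2
        have h3 : A' = D := by
          by_contra hne
          exact hf.2.1 (hA'.2.2 D hD (Ne.symm hne))
        exact hDC (h3 ▸ hi')
    by_cases h1 : {i} ∈ σ.1
    · have e := IsOrientation.flipAt_minimal σ.2 τ.2 hA _ h1 (by simpa using hi)
      have e' := IsOrientation.flipAt_minimal σ.2 τ'.2 hA' _ h1 (by simpa using hi')
      exact hAA (e.symm.trans e')
    · exact key _ (σ.2.compl_mem (hS.singleton_mem i) h1) rfl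

variable [Finite L] [Nonempty L]

lemma leafSide_tree (hS : IsSplitSystem S) {σ τ : hS.tree.V} {B : Set L}
    (h : FlipAt σ.1 τ.1 B) : hS.tree.leafSide σ τ = Bᶜ := by
  have hadj : hS.tree.G.Adj σ τ := ⟨B, h⟩
  have h1 : ∀ x : hS.tree.V, x ∈ side hS.tree.G σ τ → B ∉ x.1 := fun x hx hB =>
    h.2.1 ((hS.mem_iff_of_reachable h hx).1 hB)
  have h2 : ∀ x : hS.tree.V, x ∈ side hS.tree.G τ σ → B ∈ x.1 := fun x hx => by
    by_contra hB
    have h' := IsOrientation.flipAt_symm hS σ.2 τ.2 h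
    have hB' := x.2.compl_mem (σ.2.subset h.1) hB
    exact h'.2.1 ((hS.mem_iff_of_reachable h' hx).1 hB')
  ext j
  constructor
  · intro hj hjB
    exact h1 _ hj ⟨σ.2.subset h.1, hjB⟩
  · intro hj
    by_contra hc
    exact hj (h2 _ ((notMem_side_iff hS.tree.isTree hadj _).1 hc)).2

lemma exists_flipAt_tree (hS : IsSplitSystem S) {B : Set L} (hB : B ∈ S) :
    ∃ σ τ : hS.tree.V, FlipAt σ.1 τ.1 B := by
  obtain ⟨j, hj⟩ := hS.nonempty B hB
  obtain ⟨k, hk⟩ := hS.nonempty _ (hS.compl_mem B hB)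
  obtain ⟨p⟩ := hS.preconnected ⟨_, hS.isOrientation_leaf j⟩ ⟨_, hS.isOrientation_leaf k⟩
  have key : ∀ {x y} (p : hS.graph.Walk x y), B ∈ x.1 → B ∉ y.1 →
      ∃ σ τ : hS.tree.V, FlipAt σ.1 τ.1 B := by
    intro x y p hx hy
    induction p with
    | nil => exact absurd hx hy
    | @cons x y z hxy p ih =>
      by_cases hB' : B ∈ y.1
      · exact ih hB' hy
      · obtain ⟨C, hC⟩ := hxy
        refine ⟨x, y, ?_⟩
        by_cases e : B = C
        · exact e ▸ hC
        · exact absurd (hC.2.2 B hx e) hB'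
  exact key p ⟨hB, hj⟩ fun h => hk h.2

end IsSplitSystem

/-! ### Trees and their split systems -/

namespace LeafTree

variable {L : Type} (A : LeafTree L)

lemma nonempty_of_isSplit {B : Set L} (hB : B ∈ A.splits) : B.Nonempty := by
  obtain ⟨u, v, h, rfl⟩ := hB
  exact A.leafSide_nonempty h

lemma isSplitSystem_splits : IsSplitSystem A.splits where
  compl_mem := by
    rintro _ ⟨u, v, h, rfl⟩
    exact ⟨v, u, h.symm, A.compl_leafSide h⟩
  singleton_mem j := by
    obtain ⟨u, h⟩ := A.exists_adj_leaf j
    exact ⟨u, _, h, (A.leafSide_leaf h).symm⟩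
  nonempty B hB := A.nonempty_of_isSplit hB
  compat := by
    rintro _ ⟨u, v, h, rfl⟩ _ ⟨u', v', h', rfl⟩
    have hG := A.isTree
    by_cases hne : s(u, v) = s(u', v')
    · rcases Sym2.eq_iff.1 hne with ⟨rfl, rfl⟩ | ⟨rfl, rfl⟩
      · exact Or.inl subset_rfl
      · exact Or.inr (Or.inl (A.compl_leafSide h').ge)
    by_cases hu' : u' ∈ side A.G u v
    · by_cases hu : u ∈ side A.G u' v'
      · exact Or.inr (Or.inr (Or.inl fun j hj => (mem_side_iff_of_notMem hG h h' hu' hj).2 hu))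
      · refine Or.inr (Or.inr (Or.inr fun j hj => ?_))
        by_contra hc
        exact hu ((mem_side_iff_of_notMem hG h h' hu' hc).1 hj)
    · have hu1 := (notMem_side_iff hG h _).1 hu'
      have key : ∀ j ∈ A.leafSide u v, (j ∈ A.leafSide u' v' ↔ v ∈ side A.G u' v') := fun j hj =>
        mem_side_iff_of_notMem hG h.symm h' hu1 ((notMem_side_iff hG h.symm _).2 hj)
      by_cases hv : v ∈ side A.G u' v'
      · exact Or.inl fun j hj => (key j hj).2 hv
      · exact Or.inr (Or.inl fun j hj hc => hv ((key j hj).1 hc))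

/-- The parts of the splits of a tree that contain a node. -/
def orientation (v : A.V) : Set (Set L) :=
  {B | ∃ u w, A.G.Adj u w ∧ v ∈ side A.G u w ∧ B = A.leafSide u w}

lemma leafSide_mem_orientation_iff {u w : A.V} (h : A.G.Adj u w) (v : A.V) :
    A.leafSide u w ∈ A.orientation v ↔ v ∈ side A.G u w := by
  refine ⟨?_, fun hv => ⟨u, w, h, hv, rfl⟩⟩
  rintro ⟨u', w', h', hv, e⟩
  obtain ⟨rfl, rfl⟩ := A.leafSide_injective h h' e
  exact hv

lemma isOrientation_orientation (v : A.V) : IsOrientation A.splits (A.orientation v) where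
  subset := by
    rintro _ ⟨u, w, h, -, rfl⟩
    exact ⟨u, w, h, rfl⟩
  compl_mem_iff := by
    rintro _ ⟨u, w, h, rfl⟩
    rw [A.compl_leafSide h, A.leafSide_mem_orientation_iff h, A.leafSide_mem_orientation_iff h.symm,
      notMem_side_iff A.isTree h]
  inter_nonempty := by
    rintro _ ⟨u, w, h, hv, rfl⟩ _ ⟨u', w', h', hv', rfl⟩
    exact A.inter_leafSide_nonempty h h' hv hv'

lemma flipAt_orientation {v w : A.V} (h : A.G.Adj v w) :
    FlipAt (A.orientation v) (A.orientation w) (A.leafSide w v) := by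
  refine ⟨(A.leafSide_mem_orientation_iff h.symm v).2 (mem_side_right _ _ _),
    fun hc => notMem_side_left A.isTree h.symm ((A.leafSide_mem_orientation_iff h.symm w).1 hc), ?_⟩
  rintro _ ⟨x, y, hxy, hv, rfl⟩ hne
  rw [A.leafSide_mem_orientation_iff hxy, ← mem_side_iff_mem_side h]
  · exact hv
  · intro e
    rcases Sym2.eq_iff.1 e with ⟨rfl, rfl⟩ | ⟨rfl, rfl⟩
    · exact notMem_side_left A.isTree hxy hv
    · exact hne rfl

/-- The first edge of the path between two distinct nodes separates them, so its split is oriented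
differently. -/
lemma orientation_injective : Function.Injective A.orientation := by
  intro v w hvw
  by_contra hne
  obtain ⟨p, hp, -⟩ := A.isTree.existsUnique_path v w
  cases p with
  | nil => exact hne rfl
  | @cons _ z _ hz q =>
    have h1 := (mem_edges_iff A.isTree hz hp).1 (by simp)
    have h2 : v ∉ side A.G v z := notMem_side_left A.isTree hz
    apply h1
    rw [← A.leafSide_mem_orientation_iff hz, ← A.leafSide_mem_orientation_iff hz, hvw]

/-- A tree is determined by its splits. -/
lemma same_tree [Finite L] [Nonempty L] {S : Set (Set L)} (hS : IsSplitSystem S)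
    (h : A.splits = S) : A.Same hS.tree := by
  subst h
  have hor := A.isOrientation_orientation
  let f : A.V → hS.tree.V := fun v => ⟨A.orientation v, hor v⟩
  have hinj : Function.Injective f := fun v w h => A.orientation_injective (Subtype.ext_iff.1 h)
  -- A flip at the image of a node comes from an edge at that node, so the image is closed under
  -- neighbours; connectedness gives surjectivity.
  have key : ∀ (v : A.V) (τ : hS.tree.V) (B : Set L), FlipAt (A.orientation v) τ.1 B →
      ∃ w, A.G.Adj v w ∧ f w = τ := by
    intro v τ B hB
    obtain ⟨x, y, hxy, -, rfl⟩ := hB.1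
    obtain ⟨h1, h2⟩ := IsOrientation.eq_of_flipAt hS (hor v) τ.2 (hor y) (hor x) hB
      (A.flipAt_orientation hxy.symm)
    have := A.orientation_injective h1
    subst this
    exact ⟨x, hxy.symm, Subtype.ext h2.symm⟩
  have hsurj : Function.Surjective f := by
    intro τ
    obtain ⟨v0⟩ := A.isTree.connected.nonempty
    obtain ⟨p⟩ := hS.preconnected (f v0) τ
    have : ∀ {x y} (p : hS.graph.Walk x y), x ∈ Set.range f → y ∈ Set.range f := by
      intro x y p hx
      induction p with
      | nil => exact hx
      | @cons x y z hxy p ih =>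
        obtain ⟨v, rfl⟩ := hx
        obtain ⟨B, hB⟩ := hxy
        obtain ⟨w, -, hw⟩ := key v _ B hB
        exact ih ⟨w, hw⟩
    exact this p ⟨v0, rfl⟩
  refine ⟨⟨Equiv.ofBijective f ⟨hinj, hsurj⟩, fun {v w} => ⟨?_, fun h => ?_⟩⟩, fun j => ?_⟩
  · rintro ⟨B, hB⟩
    obtain ⟨w', h, hw⟩ := key v (f w) B hB
    exact hinj hw ▸ h
  · exact ⟨_, A.flipAt_orientation h⟩
  · refine Subtype.ext (Set.ext fun B => ⟨?_, ?_⟩)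
    · rintro ⟨u, w, h, hj, rfl⟩
      exact ⟨⟨u, w, h, rfl⟩, hj⟩
    · rintro ⟨⟨u, w, h, rfl⟩, hj⟩
      exact ⟨u, w, h, hj, rfl⟩

lemma splits_subset_of_same {A B : LeafTree L} (h : A.Same B) : A.splits ⊆ B.splits := by
  obtain ⟨φ, hφ⟩ := h
  have key : ∀ u v x, x ∈ side A.G u v → φ x ∈ side B.G (φ u) (φ v) := by
    intro u v x hx
    let ψ : A.G.deleteEdges {s(u, v)} →g B.G.deleteEdges {s(φ u, φ v)} :=
      ⟨φ, fun {x y} hxy => by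
        rw [SimpleGraph.deleteEdges_adj] at hxy ⊢
        refine ⟨φ.map_adj_iff.2 hxy.1, fun e => hxy.2 ?_⟩
        rcases Sym2.eq_iff.1 e with ⟨h1, h2⟩ | ⟨h1, h2⟩
        · rw [φ.injective h1, φ.injective h2]; rfl
        · rw [φ.injective h1, φ.injective h2, Sym2.eq_swap]; rfl⟩
    exact SimpleGraph.Reachable.map ψ hx
  rintro _ ⟨u, v, hadj, rfl⟩
  have hadj' : B.G.Adj (φ u) (φ v) := φ.map_adj_iff.2 hadj
  refine ⟨φ u, φ v, hadj', Set.Subset.antisymm (fun j hj => ?_) fun j hj => ?_⟩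
  · have := key u v _ hj
    rwa [hφ] at this
  · by_contra hc
    have := key v u _ ((notMem_side_iff A.isTree hadj _).1 hc)
    rw [hφ] at this
    exact (notMem_side_iff B.isTree hadj' _).2 this hj

lemma Same.symm {A B : LeafTree L} (h : A.Same B) : B.Same A := by
  obtain ⟨φ, hφ⟩ := h
  exact ⟨φ.symm, fun j => by rw [← hφ j]; exact φ.symm_apply_apply _⟩

lemma same_iff [Finite L] [Nonempty L] {A B : LeafTree L} :
    A.Same B ↔ A.splits = B.splits := by
  refine ⟨fun h => (splits_subset_of_same h).antisymm (splits_subset_of_same h.symm), fun h => ?_⟩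
  obtain ⟨φ, hφ⟩ := A.same_tree B.isSplitSystem_splits h
  obtain ⟨ψ, hψ⟩ := B.same_tree B.isSplitSystem_splits rfl
  refine ⟨φ.trans ψ.symm, fun j => ?_⟩
  rw [SimpleGraph.Iso.coe_comp, Function.comp_apply, hφ, ← hψ]
  exact ψ.symm_apply_apply _

end LeafTree

/-- Some split separates `i` and `j` from `k` and `l`. -/
def Separates {L : Type} (S : Set (Set L)) (i j k l : L) : Prop :=
  ∃ B ∈ S, i ∈ B ∧ j ∈ B ∧ k ∉ B ∧ l ∉ B

/-- Quartets determine splits. With `i` in `B` and `k` outside fixed, the parts of `S'` that contain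
`i` but not `k` form a chain, and `B` is recovered from its extremal members. -/
lemma IsSplitSystem.subset_of_separates {L : Type} [Finite L] {S S' : Set (Set L)}
    (hS : IsSplitSystem S) (hS' : IsSplitSystem S')
    (h : ∀ i j k l, [i, j, k, l].Nodup → Separates S i j k l → Separates S' i j k l) :
    S ⊆ S' := by
  intro B hB
  have hsep : ∀ i ∈ B, ∀ j ∈ B, ∀ k ∉ B, ∀ l ∉ B, Separates S' i j k l := by
    intro i hi j hj k hk l hl
    by_cases hij : i = j
    · subst hij
      refine ⟨_, hS'.singleton_mem i, rfl, rfl, ?_, ?_⟩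
      · rintro rfl; exact hk hi
      · rintro rfl; exact hl hi
    by_cases hkl : k = l
    · subst hkl
      refine ⟨_, hS'.compl_mem _ (hS'.singleton_mem k), ?_, ?_, by simp, by simp⟩
      · rintro rfl; exact hk hi
      · rintro rfl; exact hk hj
    refine h i j k l ?_ ⟨B, hB, hi, hj, hk, hl⟩
    have h1 : ∀ {x y}, x ∈ B → y ∉ B → x ≠ y := fun hx hy e => hy (e ▸ hx)
    simp [hij, hkl, h1 hi hk, h1 hi hl, h1 hj hk, h1 hj hl]
  obtain ⟨i, hi⟩ := hS.nonempty B hB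
  obtain ⟨k, hk⟩ := hS.nonempty _ (hS.compl_mem B hB)
  have nested : ∀ D ∈ S', ∀ E ∈ S', i ∈ D → k ∉ D → i ∈ E → k ∉ E → D ⊆ E ∨ E ⊆ D := by
    intro D hD E hE hi1 hk1 hi2 hk2
    rcases hS'.compat D hD E hE with h | h | h | h
    · exact Or.inl h
    · exact absurd hi2 (h hi1)
    · exact absurd (h hk1) hk2
    · exact Or.inr h
  -- The largest part of the chain that avoids `l` contains all of `B`, since each element of `B`
  -- lies in such a part. The smallest part containing `B` then avoids every `l` outside `B`.
  have hcut : ∀ l ∉ B, ∃ D ∈ S', B ⊆ D ∧ k ∉ D ∧ l ∉ D := by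
    intro l hl
    obtain ⟨D0, hD0⟩ : {D | D ∈ S' ∧ i ∈ D ∧ k ∉ D ∧ l ∉ D}.Nonempty := by
      obtain ⟨D, hD, h1, -, h2, h3⟩ := hsep i hi i hi k hk l hl
      exact ⟨D, hD, h1, h2, h3⟩
    obtain ⟨D, -, hD⟩ := (Set.toFinite _).exists_le_maximal hD0
    refine ⟨D, hD.prop.1, fun j hj => ?_, hD.prop.2.2⟩
    obtain ⟨E, hE, h1, h2, h3, h4⟩ := hsep i hi j hj k hk l hl
    rcases nested D hD.prop.1 E hE hD.prop.2.1 hD.prop.2.2.1 h1 h3 with h | h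
    · exact hD.le_of_ge ⟨hE, h1, h3, h4⟩ h h2
    · exact h h2
  obtain ⟨D0, hD0⟩ : {D | D ∈ S' ∧ B ⊆ D ∧ k ∉ D}.Nonempty := by
    obtain ⟨D, hD, h1, h2, -⟩ := hcut k hk
    exact ⟨D, hD, h1, h2⟩
  obtain ⟨D, -, hD⟩ := (Set.toFinite _).exists_le_minimal hD0
  have : D = B := by
    refine Set.Subset.antisymm (fun z hz => ?_) hD.prop.2.1
    by_contra hzB
    obtain ⟨E, hE, h1, h2, h3⟩ := hcut z hzB
    rcases nested D hD.prop.1 E hE (hD.prop.2.1 hi) hD.prop.2.2 (h1 hi) h2 with h | h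
    · exact h3 (h hz)
    · exact h3 (hD.le_of_le ⟨hE, h1, h2⟩ h hz)
  exact this ▸ hD.prop.1

lemma IsSplitSystem.not_separates {L : Type} {S : Set (Set L)} (hS : IsSplitSystem S)
    {i j k l : L} (h : Separates S i j k l) : ¬ Separates S i k j l := by
  rintro ⟨C, hC, c1, c2, c3, c4⟩
  obtain ⟨B, hB, b1, b2, b3, b4⟩ := h
  rcases hS.compat B hB C hC with h | h | h | h
  exacts [c3 (h b2), h b1 c1, c4 (h b4), b3 (h c2)]

lemma Separates.swap_right {L : Type} {S : Set (Set L)} {i j k l : L}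
    (h : Separates S i j k l) : Separates S i j l k := by
  obtain ⟨B, hB, b1, b2, b3, b4⟩ := h
  exact ⟨B, hB, b1, b2, b4, b3⟩

/-! ### Metrics given by weighted splits -/

section
open Classical

/-- The metric of the weights `ω` on splits. -/
def splitDist {L : Type} [Fintype L] (ω : Set L → ℝ) (j k : L) : ℝ :=
  -- Both parts of a split occur in the sum; the condition selects one of them, so each separating
  -- split counts once.
  ∑ B : Set L, if j ∈ B ∧ k ∉ B then ω B else 0

/-- The total weight of the splits that separate `i` and `j` from `k` and `l`. -/
def quartetWeight {L : Type} [Fintype L] (ω : Set L → ℝ) (i j k l : L) : ℝ :=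
  ∑ B : Set L, if i ∈ B ∧ j ∈ B ∧ k ∉ B ∧ l ∉ B then ω B else 0

/-- Admissible weights on the splits of `S`. -/
structure IsSplitWeight {L : Type} (S : Set (Set L)) (ω : Set L → ℝ) : Prop where
  compl : ∀ B, ω Bᶜ = ω B
  nonneg : ∀ B, 0 ≤ ω B
  eq_zero : ∀ B ∉ S, ω B = 0
  pos : ∀ B ∈ S, (∀ j, B ≠ {j}) → (∀ j, B ≠ {j}ᶜ) → 0 < ω B

lemma sum_compl {L : Type} [Fintype L] (f : Set L → ℝ) : ∑ B : Set L, f Bᶜ = ∑ B : Set L, f B :=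
  Equiv.sum_comp (Equiv.ofBijective (fun B : Set L => Bᶜ) compl_bijective) f

lemma splitDist_comm {L : Type} [Fintype L] {ω : Set L → ℝ} (h : ∀ B, ω Bᶜ = ω B) (j k : L) :
    splitDist ω j k = splitDist ω k j := by
  unfold splitDist
  rw [← sum_compl]
  refine Finset.sum_congr rfl fun B _ => ?_
  simp [h, and_comm]

lemma quartetWeight_swap {L : Type} [Fintype L] {ω : Set L → ℝ} (h : ∀ B, ω Bᶜ = ω B)
    (i j k l : L) : quartetWeight ω k l i j = quartetWeight ω i j k l := by
  unfold quartetWeight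
  rw [← sum_compl]
  refine Finset.sum_congr rfl fun B _ => ?_
  simp only [h, Set.mem_compl_iff, not_not]
  congr 1
  exact propext (by tauto)

lemma quartetWeight_swap_right {L : Type} [Fintype L] (ω : Set L → ℝ)
    (i j k l : L) : quartetWeight ω i j l k = quartetWeight ω i j k l := by
  unfold quartetWeight
  refine Finset.sum_congr rfl fun B _ => ?_
  congr 1
  exact propext (by tauto)

lemma splitDist_add_sub {L : Type} [Fintype L] {ω : Set L → ℝ} (h : ∀ B, ω Bᶜ = ω B)
    (i j k l : L) :
    splitDist ω i k + splitDist ω j l - (splitDist ω i j + splitDist ω k l) =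
      2 * (quartetWeight ω i j k l - quartetWeight ω i k j l) := by
  have key : (splitDist ω i k + splitDist ω k i) + (splitDist ω j l + splitDist ω l j) -
      ((splitDist ω i j + splitDist ω j i) + (splitDist ω k l + splitDist ω l k)) =
      2 * ((quartetWeight ω i j k l + quartetWeight ω k l i j) -
        (quartetWeight ω i k j l + quartetWeight ω j l i k)) := by
    simp only [splitDist, quartetWeight, ← Finset.sum_add_distrib, ← Finset.sum_sub_distrib,
      Finset.mul_sum]
    refine Finset.sum_congr rfl fun B _ => ?_
    by_cases hi : i ∈ B <;> by_cases hj : j ∈ B <;> by_cases hk : k ∈ B <;> by_cases hl : l ∈ B <;>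
      simp [hi, hj, hk, hl] <;> ring
  rw [splitDist_comm h k i, splitDist_comm h l j, splitDist_comm h j i, splitDist_comm h l k,
    quartetWeight_swap h i j k l, quartetWeight_swap h i k j l] at key
  linarith

namespace IsSplitWeight

variable {L : Type} [Fintype L] {S : Set (Set L)} {ω : Set L → ℝ}

lemma quartetWeight_nonneg (hω : IsSplitWeight S ω) (i j k l : L) :
    0 ≤ quartetWeight ω i j k l :=
  Finset.sum_nonneg fun B _ => by
    split_ifs
    exacts [hω.nonneg B, le_rfl]

lemma quartetWeight_pos_iff (hω : IsSplitWeight S ω) {i j k l : L} (nd : [i, j, k, l].Nodup) :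
    0 < quartetWeight ω i j k l ↔ Separates S i j k l := by
  constructor
  · intro h
    obtain ⟨B, -, hB⟩ := Finset.exists_ne_zero_of_sum_ne_zero h.ne'
    rw [ne_eq, ite_eq_right_iff, Classical.not_imp] at hB
    refine ⟨B, ?_, hB.1⟩
    by_contra hc
    exact hB.2 (hω.eq_zero B hc)
  · rintro ⟨B, hB, h⟩
    refine Finset.sum_pos' (fun C _ => ?_) ⟨B, Finset.mem_univ _, ?_⟩
    · split_ifs
      exacts [hω.nonneg C, le_rfl]
    · rw [if_pos h]
      apply hω.pos B hB
      · rintro m rfl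
        have h1 : i = m := h.1
        have h2 : j = m := h.2.1
        simp [h1, h2] at nd
      · rintro m rfl
        have h1 : k = m := by simpa using h.2.2.1
        have h2 : l = m := by simpa using h.2.2.2
        simp [h1, h2] at nd

lemma splitDist_add_le_iff (hω : IsSplitWeight S ω) (i j k l : L) :
    splitDist ω i k + splitDist ω j l ≤ splitDist ω i j + splitDist ω k l ↔
      quartetWeight ω i j k l ≤ quartetWeight ω i k j l := by
  have := splitDist_add_sub hω.compl i j k l
  constructor <;> intro h <;> linarith

/-- The sum `D(i,j) + D(k,l)` is the largest one if and only if no split separates `i` and `j` from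
`k` and `l`. -/
lemma le_and_le_iff (hS : IsSplitSystem S) (hω : IsSplitWeight S ω) {i j k l : L}
    (nd : [i, j, k, l].Nodup) :
    (splitDist ω i k + splitDist ω j l ≤ splitDist ω i j + splitDist ω k l ∧
      splitDist ω i l + splitDist ω j k ≤ splitDist ω i j + splitDist ω k l) ↔
      ¬ Separates S i j k l := by
  have nd2 : [i, k, j, l].Nodup := by clear * - nd; grind
  have nd3 : [i, l, j, k].Nodup := by clear * - nd; grind
  have h2 := hω.splitDist_add_le_iff i j l k
  rw [splitDist_comm hω.compl l k, quartetWeight_swap_right] at h2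
  rw [hω.splitDist_add_le_iff, h2, ← hω.quartetWeight_pos_iff nd]
  constructor
  · rintro ⟨h1, -⟩ h
    have h3 := (hω.quartetWeight_pos_iff nd2).1 (h.trans_le h1)
    exact hS.not_separates h3 ((hω.quartetWeight_pos_iff nd).1 h)
  · intro h
    have h0 := not_lt.1 h
    exact ⟨h0.trans (hω.quartetWeight_nonneg _ _ _ _), h0.trans (hω.quartetWeight_nonneg _ _ _ _)⟩

/-- If the inequality failed twice, two different pairings of the quartet would be separated, which
compatibility forbids. -/
lemma four_point (hS : IsSplitSystem S) (hω : IsSplitWeight S ω) {i j k l : L}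
    (nd : [i, j, k, l].Nodup) :
    splitDist ω i j + splitDist ω k l ≤ splitDist ω i k + splitDist ω j l ∨
      splitDist ω i j + splitDist ω k l ≤ splitDist ω i l + splitDist ω j k := by
  have nd2 : [i, k, j, l].Nodup := by clear * - nd; grind
  have nd3 : [i, l, j, k].Nodup := by clear * - nd; grind
  have h1 := hω.splitDist_add_le_iff i k j l
  have h2 := hω.splitDist_add_le_iff i l j k
  rw [splitDist_comm hω.compl l k] at h2
  rw [h1, h2]
  by_contra! hc
  have p2 := (hω.quartetWeight_pos_iff nd2).1 ((hω.quartetWeight_nonneg _ _ _ _).trans_lt hc.1)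
  have p3 := (hω.quartetWeight_pos_iff nd3).1 ((hω.quartetWeight_nonneg _ _ _ _).trans_lt hc.2)
  exact hS.not_separates p2.swap_right p3.swap_right

end IsSplitWeight

namespace MetricTree

variable {L : Type} (A : MetricTree L)

/-- The length of the edge that induces a split. -/
def splitLen (B : Set L) : ℝ :=
  if h : ∃ u v, A.G.Adj u v ∧ B = A.leafSide u v then A.len s(h.choose, h.choose_spec.choose) else 0

lemma splitLen_leafSide {u v : A.V} (h : A.G.Adj u v) :
    A.splitLen (A.leafSide u v) = A.len s(u, v) := by
  have h' : ∃ u' v', A.G.Adj u' v' ∧ A.leafSide u v = A.leafSide u' v' := ⟨u, v, h, rfl⟩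
  obtain ⟨h1, h2⟩ := h'.choose_spec.choose_spec
  obtain ⟨e1, e2⟩ := A.leafSide_injective h h1 h2
  rw [splitLen, dif_pos h']
  exact congrArg A.len (congrArg₂ (fun a b => s(a, b)) e1.symm e2.symm)

lemma splitLen_of_notMem {B : Set L} (h : B ∉ A.splits) : A.splitLen B = 0 :=
  dif_neg h

lemma isSplitWeight_splitLen : IsSplitWeight A.splits A.splitLen where
  compl B := by
    by_cases hB : B ∈ A.splits
    · obtain ⟨u, v, h, rfl⟩ := hB
      rw [A.compl_leafSide h, A.splitLen_leafSide h, A.splitLen_leafSide h.symm, Sym2.eq_swap]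
    · rw [A.splitLen_of_notMem hB, A.splitLen_of_notMem]
      intro hc
      have := A.isSplitSystem_splits.compl_mem _ hc
      rw [compl_compl] at this
      exact hB this
  nonneg B := by
    by_cases hB : B ∈ A.splits
    · obtain ⟨u, v, h, rfl⟩ := hB
      rw [A.splitLen_leafSide h]
      exact A.len_nonneg _ h
    · rw [A.splitLen_of_notMem hB]
  eq_zero B hB := A.splitLen_of_notMem hB
  pos := by
    rintro _ ⟨u, v, h, rfl⟩ h1 h2
    rw [A.splitLen_leafSide h]
    refine A.len_pos u v h ?_ ?_
    · rintro ⟨j, rfl⟩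
      apply h2 j
      rw [← A.leafSide_leaf h.symm, A.compl_leafSide h.symm]
    · rintro ⟨j, rfl⟩
      exact h1 j (A.leafSide_leaf h)

/-- The edges of the path correspond to the splits separating `j` from `k`, each represented by the
part that contains `j`. -/
lemma dist_eq_splitDist [Fintype L] (j k : L) : A.dist j k = splitDist A.splitLen j k := by
  have hp : (A.path (A.leaf j) (A.leaf k)).IsPath :=
    (A.isTree.existsUnique_path (A.leaf j) (A.leaf k)).choose_spec.1
  unfold dist
  generalize A.path (A.leaf j) (A.leaf k) = p at hp
  rw [← List.sum_toFinset _ hp.isTrail.edges_nodup]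
  have h1 : splitDist A.splitLen j k =
      ∑ B : Set L with B ∈ A.splits ∧ j ∈ B ∧ k ∉ B, A.splitLen B := by
    rw [splitDist, Finset.sum_filter]
    refine Finset.sum_congr rfl fun B _ => ?_
    by_cases hB : B ∈ A.splits
    · simp [hB]
    · simp [hB, A.splitLen_of_notMem hB]
  rw [h1]
  symm
  have hspec : ∀ B ∈ Finset.univ.filter fun B => B ∈ A.splits ∧ j ∈ B ∧ k ∉ B,
      ∃ e : Sym2 A.V, ∃ u v, e = s(u, v) ∧ A.G.Adj u v ∧ B = A.leafSide u v := by
    intro B hB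
    obtain ⟨u, v, h⟩ := (Finset.mem_filter.1 hB).2.1
    exact ⟨_, u, v, rfl, h⟩
  refine Finset.sum_bij (fun B hB => (hspec B hB).choose) ?_ ?_ ?_ ?_
  · intro B hB
    obtain ⟨u, v, he, h, hBe⟩ := (hspec B hB).choose_spec
    rw [he, List.mem_toFinset, mem_edges_iff A.isTree h hp]
    have h2 := (Finset.mem_filter.1 hB).2.2
    rw [hBe] at h2
    exact fun hc => h2.2 (hc.1 h2.1)
  · intro B hB C hC hBC
    obtain ⟨u, v, he, h, hBe⟩ := (hspec B hB).choose_spec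
    obtain ⟨u', v', he', h', hCe⟩ := (hspec C hC).choose_spec
    have h2 := (Finset.mem_filter.1 hB).2.2
    have h3 := (Finset.mem_filter.1 hC).2.2
    rcases Sym2.eq_iff.1 (he.symm.trans (hBC.trans he')) with ⟨rfl, rfl⟩ | ⟨rfl, rfl⟩
    · rw [hBe, hCe]
    · rw [hCe, ← A.compl_leafSide h, ← hBe] at h3
      exact absurd h2.1 h3.1
  · intro e he
    rw [List.mem_toFinset] at he
    induction e using Sym2.ind with
    | _ u v =>
    have h := p.edges_subset_edgeSet he
    rw [SimpleGraph.mem_edgeSet] at h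
    have hsep := (mem_edges_iff A.isTree h hp).1 he
    obtain ⟨B, hB, hBe⟩ : ∃ B ∈ Finset.univ.filter fun B => B ∈ A.splits ∧ j ∈ B ∧ k ∉ B,
        B = A.leafSide u v ∨ B = A.leafSide v u := by
      by_cases hj : j ∈ A.leafSide u v
      · refine ⟨_, Finset.mem_filter.2 ⟨Finset.mem_univ _, ⟨u, v, h, rfl⟩, hj, fun hk => ?_⟩,
          Or.inl rfl⟩
        exact hsep ⟨fun _ => hk, fun _ => hj⟩
      · refine ⟨_, Finset.mem_filter.2 ⟨Finset.mem_univ _, ⟨v, u, h.symm, rfl⟩, ?_, ?_⟩,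
          Or.inr rfl⟩
        · rw [← A.compl_leafSide h]
          exact hj
        · rw [← A.compl_leafSide h, Set.mem_compl_iff, not_not]
          by_contra hk
          exact hsep ⟨fun h => absurd h hj, fun h => absurd h hk⟩
    refine ⟨B, hB, ?_⟩
    obtain ⟨u', v', he', h', hBe'⟩ := (hspec B hB).choose_spec
    rw [he']
    rcases hBe with hBe | hBe
    · obtain ⟨rfl, rfl⟩ := A.leafSide_injective h' h (hBe'.symm.trans hBe)
      rfl
    · obtain ⟨rfl, rfl⟩ := A.leafSide_injective h' h.symm (hBe'.symm.trans hBe)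
      exact Sym2.eq_swap
  · intro B hB
    obtain ⟨u, v, he, h, hBe⟩ := (hspec B hB).choose_spec
    rw [he, ← A.splitLen_leafSide h, ← hBe]

/-- A tree with weights on its splits as a metric tree. -/
def ofWeight (A : LeafTree L) {ω : Set L → ℝ} (hω : IsSplitWeight A.splits ω) : MetricTree L where
  toLeafTree := A
  -- The average makes the length symmetric on all unordered pairs; on an edge both weights agree.
  len := Sym2.lift ⟨fun u v => (ω (A.leafSide u v) + ω (A.leafSide v u)) / 2,
    fun u v => congrArg (· / 2) (add_comm _ _)⟩
  len_nonneg e _ := by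
    induction e using Sym2.ind with
    | _ u v =>
    have h1 := hω.nonneg (A.leafSide u v)
    have h2 := hω.nonneg (A.leafSide v u)
    rw [Sym2.lift_mk]
    positivity
  len_pos u v h hu hv := by
    change 0 < (ω (A.leafSide u v) + ω (A.leafSide v u)) / 2
    rw [← A.compl_leafSide h, hω.compl, add_self_div_two]
    refine hω.pos _ ⟨u, v, h, rfl⟩ (fun j hj => hv ?_) fun j hj => hu ?_
    · obtain ⟨w, hw⟩ := A.exists_adj_leaf j
      obtain ⟨-, rfl⟩ := A.leafSide_injective h hw (hj.trans (A.leafSide_leaf hw).symm)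
      exact ⟨j, rfl⟩
    · obtain ⟨w, hw⟩ := A.exists_adj_leaf j
      rw [← A.leafSide_leaf hw, A.compl_leafSide hw] at hj
      obtain ⟨rfl, -⟩ := A.leafSide_injective h hw.symm hj
      exact ⟨j, rfl⟩

lemma dist_ofWeight [Fintype L] (A : LeafTree L) {ω : Set L → ℝ} (hω : IsSplitWeight A.splits ω) (j k : L) :
    (ofWeight A hω).dist j k = splitDist ω j k := by
  rw [dist_eq_splitDist]
  congr 1
  funext B
  by_cases hB : B ∈ A.splits
  · obtain ⟨u, v, h, rfl⟩ := hB
    refine ((ofWeight A hω).splitLen_leafSide h).trans ?_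
    change (ω (A.leafSide u v) + ω (A.leafSide v u)) / 2 = _
    rw [← A.compl_leafSide h, hω.compl, add_self_div_two]
  · rw [hω.eq_zero B hB]
    exact (ofWeight A hω).splitLen_of_notMem hB

end MetricTree

end

/-! ### From the four point condition to weighted splits -/

section
open Classical

/-- A finite set of reals as the partial sums of nonnegative increments. -/
lemma exists_increments (V : Finset ℝ) (m : ℝ) (hm : ∀ x ∈ V, m ≤ x) :
    ∃ d : ℝ → ℝ, (∀ v, 0 ≤ d v) ∧ ∀ x ∈ V, x = m + ∑ v ∈ V, if v ≤ x then d v else 0 := by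
  induction V using Finset.induction_on_max with
  | empty => exact ⟨0, fun _ => le_rfl, by simp⟩
  | insert a s ha ih =>
    obtain ⟨d, hd, hs⟩ := ih fun x hx => hm x (Finset.mem_insert_of_mem hx)
    have has : a ∉ s := fun h => (ha a h).false
    have hle : ∑ v ∈ s, d v ≤ a - m := by
      rcases s.eq_empty_or_nonempty with rfl | hne
      · simpa using hm a (Finset.mem_insert_self _ _)
      · have h1 := hs _ (s.max'_mem hne)
        rw [Finset.sum_congr rfl fun v hv => if_pos (s.le_max' v hv)] at h1
        linarith [ha _ (s.max'_mem hne)]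
    have hne : ∀ v ∈ s, v ≠ a := fun v hv => (ha v hv).ne
    -- The new maximum `a` receives what the earlier increments leave of `a - m`.
    refine ⟨Function.update d a (a - m - ∑ v ∈ s, d v), fun v => ?_, fun x hx => ?_⟩
    · by_cases hv : v = a
      · subst hv
        simpa using hle
      · simpa [hv] using hd v
    · rw [Finset.sum_insert has]
      have hup : ∀ x : ℝ, (∑ v ∈ s, if v ≤ x then
          Function.update d a (a - m - ∑ v ∈ s, d v) v else 0) =
          ∑ v ∈ s, if v ≤ x then d v else 0 := fun x =>
        Finset.sum_congr rfl fun v hv => by rw [Function.update_of_ne (hne v hv)]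
      rw [hup]
      rcases Finset.mem_insert.1 hx with rfl | hx
      · rw [Finset.sum_congr rfl fun v hv => if_pos (ha v hv).le]
        simp
      · rw [if_neg (not_le.2 (ha x hx)), zero_add]
        exact hs x hx

/-- The cluster of `i` at level `v` of the similarity `u`. -/
def cluster {L : Type} (u : L → L → ℝ) (r : L) (v : ℝ) (i : L) : Set L :=
  {j | j ≠ r ∧ (j = i ∨ v ≤ u i j)}

/-- `u` is an ultrametric similarity away from `r`. -/
structure IsSimilarity {L : Type} (u : L → L → ℝ) (r : L) : Prop where
  comm : ∀ i j, u i j = u j i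
  trans : ∀ i j k v, i ≠ r → j ≠ r → k ≠ r → i ≠ j → j ≠ k → i ≠ k → v ≤ u i j → v ≤ u j k →
    v ≤ u i k

namespace IsSimilarity

variable {L : Type} {u : L → L → ℝ} {r : L}

lemma cluster_subset (hu : IsSimilarity u r) {v : ℝ} {i j : L} (hi : i ≠ r)
    (hj : j ∈ cluster u r v i) : cluster u r v j ⊆ cluster u r v i := by
  rintro k ⟨hk, hkj⟩
  refine ⟨hk, ?_⟩
  obtain ⟨hjr, hj⟩ := hj
  by_cases h1 : k = i
  · exact Or.inl h1
  rcases hj with rfl | hj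
  · exact hkj
  rcases hkj with rfl | hkj
  · exact Or.inr hj
  by_cases h2 : j = i
  · subst h2
    exact Or.inr hkj
  by_cases h3 : k = j
  · subst h3
    exact Or.inr hj
  exact Or.inr (hu.trans i j k v hi hjr hk (Ne.symm h2) (Ne.symm h3) (Ne.symm h1) hj hkj)

lemma mem_cluster_comm (hu : IsSimilarity u r) {v : ℝ} {i j : L} (hi : i ≠ r)
    (hj : j ∈ cluster u r v i) : i ∈ cluster u r v j := by
  obtain ⟨-, rfl | hj⟩ := hj
  · exact ⟨hi, Or.inl rfl⟩
  · exact ⟨hi, Or.inr (hu.comm i j ▸ hj)⟩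

lemma cluster_eq (hu : IsSimilarity u r) {v : ℝ} {i j : L} (hi : i ≠ r)
    (hj : j ∈ cluster u r v i) : cluster u r v j = cluster u r v i :=
  (hu.cluster_subset hi hj).antisymm (hu.cluster_subset hj.1 (hu.mem_cluster_comm hi hj))

/-- At one level the clusters are equivalence classes away from `r`, and a lower level gives coarser
classes. -/
lemma cluster_laminar (hu : IsSimilarity u r) {v v' : ℝ} {i i' : L} (hi : i ≠ r) (hi' : i' ≠ r) :
    cluster u r v i ⊆ cluster u r v' i' ∨ cluster u r v' i' ⊆ cluster u r v i ∨
      cluster u r v i ⊆ (cluster u r v' i')ᶜ := by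
  by_cases h : ∃ x, x ∈ cluster u r v i ∧ x ∈ cluster u r v' i'
  · obtain ⟨x, hx, hx'⟩ := h
    rw [← hu.cluster_eq hi hx, ← hu.cluster_eq hi' hx']
    rcases le_total v v' with hv | hv
    · exact Or.inr (Or.inl fun k hk => ⟨hk.1, hk.2.imp_right hv.trans⟩)
    · exact Or.inl fun k hk => ⟨hk.1, hk.2.imp_right hv.trans⟩
  · push Not at h
    exact Or.inr (Or.inr h)

end IsSimilarity

lemma splitDist_compl {L : Type} [Fintype L] (f : Set L → ℝ) (i j : L) :
    splitDist (fun B => f Bᶜ) i j = splitDist f j i := by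
  unfold splitDist
  rw [← sum_compl]
  refine Finset.sum_congr rfl fun B _ => ?_
  simp [and_comm]

lemma splitDist_add {L : Type} [Fintype L] (f g : Set L → ℝ) (i j : L) :
    splitDist (fun B => f B + g B) i j = splitDist f i j + splitDist g i j := by
  unfold splitDist
  rw [← Finset.sum_add_distrib]
  exact Finset.sum_congr rfl fun B _ => by split_ifs <;> simp

lemma splitDist_sum {L ι : Type} [Fintype L] (s : Finset ι) (f : ι → Set L → ℝ) (i j : L) :
    splitDist (fun B => ∑ v ∈ s, f v B) i j = ∑ v ∈ s, splitDist (f v) i j := by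
  unfold splitDist
  rw [Finset.sum_comm]
  exact Finset.sum_congr rfl fun B _ => by split_ifs <;> simp

lemma splitDist_eq_of_unique {L : Type} [Fintype L] {f : Set L → ℝ} {i j : L} (C : Set L)
    (h : ∀ B, i ∈ B → j ∉ B → B ≠ C → f B = 0) :
    splitDist f i j = if i ∈ C ∧ j ∉ C then f C else 0 := by
  unfold splitDist
  refine Finset.sum_eq_single_of_mem C (Finset.mem_univ C) fun B _ hB => ?_
  split_ifs with hij
  exacts [h B hij.1 hij.2 hB, rfl]

lemma splitDist_cluster {L : Type} [Fintype L] {u : L → L → ℝ} {r : L} (hu : IsSimilarity u r)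
    (x v : ℝ) (i j : L) :
    splitDist (fun B => if ∃ m, m ≠ r ∧ B = cluster u r v m then x else 0) i j =
      if i ≠ r ∧ j ∉ cluster u r v i then x else 0 := by
  rw [splitDist_eq_of_unique (cluster u r v i)]
  · by_cases hi : i = r
    · simp [hi, cluster]
    · have h1 : i ∈ cluster u r v i := ⟨hi, Or.inl rfl⟩
      have h2 : ∃ m, m ≠ r ∧ cluster u r v i = cluster u r v m := ⟨i, hi, rfl⟩
      simp only [h1, h2, hi, if_true, ne_eq, not_false_eq_true]
  · intro B hB _ hne
    rw [if_neg]
    rintro ⟨m, hm, rfl⟩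
    exact hne (hu.cluster_eq hm hB).symm

lemma splitDist_singleton {L : Type} [Fintype L] (b : L → ℝ) {i j : L} (hij : i ≠ j) :
    splitDist (fun B => ∑ m, if B = {m} then b m else 0) i j = b i := by
  rw [splitDist_sum, Finset.sum_eq_single_of_mem i (Finset.mem_univ i)]
  · rw [splitDist_eq_of_unique {i}]
    · simp [hij.symm]
    · intro B _ _ hB
      simp [hB]
  · intro m _ hm
    rw [splitDist_eq_of_unique {m}]
    · simp [hm.symm]
    · intro B _ _ hB
      simp [hB]

/-- A pairwise compatible family of sets gives, with the trivial splits, a split system. -/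
lemma IsSplitSystem.of_family {L : Type} [Nontrivial L] (F : Set (Set L)) (r : L)
    (hne : ∀ B ∈ F, B.Nonempty) (hr : ∀ B ∈ F, r ∉ B)
    (hF : ∀ B ∈ F, ∀ C ∈ F, B ⊆ C ∨ C ⊆ B ∨ B ⊆ Cᶜ) :
    IsSplitSystem {B | (B ∈ F ∨ Bᶜ ∈ F) ∨ ∃ j, B = {j} ∨ B = {j}ᶜ} := by
  have hFF : ∀ B ∈ F, ∀ C ∈ F, B ⊆ C ∨ B ⊆ Cᶜ ∨ Bᶜ ⊆ C ∨ C ⊆ B := fun B hB C hC => by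
    rcases hF B hB C hC with h | h | h
    exacts [Or.inl h, Or.inr (Or.inr (Or.inr h)), Or.inr (Or.inl h)]
  have left : ∀ B C : Set L, (Bᶜ ⊆ C ∨ Bᶜ ⊆ Cᶜ ∨ Bᶜᶜ ⊆ C ∨ C ⊆ Bᶜ) →
      (B ⊆ C ∨ B ⊆ Cᶜ ∨ Bᶜ ⊆ C ∨ C ⊆ B) := by
    intro B C h
    rw [compl_compl, Set.compl_subset_compl, Set.subset_compl_comm] at h
    tauto
  have right : ∀ B C : Set L, (B ⊆ Cᶜ ∨ B ⊆ Cᶜᶜ ∨ Bᶜ ⊆ Cᶜ ∨ Cᶜ ⊆ B) →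
      (B ⊆ C ∨ B ⊆ Cᶜ ∨ Bᶜ ⊆ C ∨ C ⊆ B) := by
    intro B C h
    rw [compl_compl, Set.compl_subset_compl, Set.compl_subset_comm (s := C)] at h
    tauto
  have sl : ∀ (j : L) (C : Set L), {j} ⊆ C ∨ {j} ⊆ Cᶜ ∨ {j}ᶜ ⊆ C ∨ C ⊆ {j} := by
    intro j C
    by_cases h : j ∈ C
    · exact Or.inl (by simpa using h)
    · exact Or.inr (Or.inl (by simpa using h))
  have sr : ∀ (j : L) (B : Set L), B ⊆ {j} ∨ B ⊆ {j}ᶜ ∨ Bᶜ ⊆ {j} ∨ {j} ⊆ B := by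
    intro j B
    by_cases h : j ∈ B
    · exact Or.inr (Or.inr (Or.inr (by simpa using h)))
    · exact Or.inr (Or.inl (by simpa using h))
  constructor
  · rintro B (h | ⟨j, rfl | rfl⟩)
    · refine Or.inl ?_
      rw [compl_compl]
      exact h.symm
    · exact Or.inr ⟨j, Or.inr rfl⟩
    · exact Or.inr ⟨j, Or.inl (compl_compl _)⟩
  · exact fun j => Or.inr ⟨j, Or.inl rfl⟩
  · rintro B ((h | h) | ⟨j, rfl | rfl⟩)
    · exact hne B h
    · exact ⟨r, by simpa using hr _ h⟩
    · exact Set.singleton_nonempty j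
    · obtain ⟨k, hk⟩ := exists_ne j
      exact ⟨k, hk⟩
  · rintro B ((hB | hB) | ⟨j, rfl | rfl⟩) C ((hC | hC) | ⟨k, rfl | rfl⟩)
    · exact hFF B hB C hC
    · exact right _ _ (hFF B hB _ hC)
    · exact sr _ _
    · exact right _ _ (by rw [compl_compl]; exact sr k B)
    · exact left _ _ (hFF _ hB C hC)
    · exact left _ _ (right _ _ (hFF _ hB _ hC))
    · exact sr _ _
    · exact right _ _ (by rw [compl_compl]; exact sr k B)
    all_goals first | exact sl _ _ | exact left _ _ (by rw [compl_compl]; exact sl _ _)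

/-- A symmetric function with the four point condition is, up to a constant, the metric of a
weighted split system. -/
lemma exists_splitDist_eq {L : Type} [Fintype L] [Nontrivial L] (D : L → L → ℝ)
    (hD : ∀ i j, D i j = D j i)
    (h4 : ∀ i j k l, [i, j, k, l].Nodup →
      D i j + D k l ≤ D i k + D j l ∨ D i j + D k l ≤ D i l + D j k) :
    ∃ c₀ : ℝ, ∀ c ≥ c₀, ∃ (S : Set (Set L)) (ω : Set L → ℝ), IsSplitSystem S ∧
      IsSplitWeight S ω ∧ ∀ i j, i ≠ j → splitDist ω i j = D i j + c := by
  obtain ⟨r⟩ : Nonempty L := inferInstance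
  -- This is the Farris transform at `r`: the four point condition for quadruples containing `r`
  -- says that `u` is an ultrametric similarity.
  set u : L → L → ℝ := fun i j => D r i + D r j - D i j with hu_def
  have hu : IsSimilarity u r := by
    refine ⟨fun i j => by simp only [hu_def]; rw [hD i j]; ring, ?_⟩
    intro i j k v hi hj hk hij hjk hik h1 h2
    simp only [hu_def] at h1 h2 ⊢
    have nd : [i, k, j, r].Nodup := by
      simp [hi, hj, hk, hij, hik, hjk.symm]
    rw [hD j k] at h2
    rcases h4 i k j r nd with h | h
    · rw [hD j r, hD k r] at h
      linarith
    · rw [hD j r, hD i r] at h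
      linarith
  set V : Finset ℝ := Finset.univ.image fun p : L × L => u p.1 p.2
  obtain ⟨m, hm⟩ := V.bddBelow
  obtain ⟨d, hd, hV⟩ := exists_increments V m fun x hx => hm hx
  have huV : ∀ i j, u i j = m + ∑ v ∈ V, if v ≤ u i j then d v else 0 := fun i j =>
    hV _ (Finset.mem_image.2 ⟨(i, j), Finset.mem_univ _, rfl⟩)
  set t : ℝ := ∑ v ∈ V, d v
  -- Clusters separate two leaves other than `r` by `t - (u i j - m)`, and a leaf from `r` by `t /
  -- 2`. The pendant lengths `a i + c / 2` supply the rest of `D i j + c`, and they are nonnegative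
  -- for large `c`.
  set a : L → ℝ := fun i => if i = r then m / 2 else D r i - m / 2 - t / 2
  obtain ⟨c₁, hc₁⟩ := (Finset.univ.image fun i => -2 * a i).exists_le
  have hc₁' : ∀ i, -2 * a i ≤ c₁ := fun i =>
    hc₁ _ (Finset.mem_image.2 ⟨i, Finset.mem_univ _, rfl⟩)
  refine ⟨c₁, fun c hc => ?_⟩
  have hb : ∀ i, 0 ≤ a i + c / 2 := fun i => by
    have h1 : -2 * a i ≤ c := (hc₁' i).trans hc
    linarith
  set e : ℝ → Set L → ℝ := fun v B => if ∃ m, m ≠ r ∧ B = cluster u r v m then d v / 2 else 0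
    with he_def
  set p : Set L → ℝ := fun B => ∑ m, if B = {m} then a m + c / 2 else 0 with hp_def
  set ω₀ : Set L → ℝ := fun B => ∑ v ∈ V, (e v B + e v Bᶜ) with hω₀
  have he0 : ∀ v B, 0 ≤ e v B := fun v B => by
    simp only [he_def]
    split_ifs
    exacts [div_nonneg (hd v) zero_le_two, le_rfl]
  have hp0 : ∀ B, 0 ≤ p B := fun B => Finset.sum_nonneg fun m _ => by
    split_ifs
    exacts [hb m, le_rfl]
  have hω0 : ∀ B, 0 ≤ ω₀ B := fun B => Finset.sum_nonneg fun v _ => add_nonneg (he0 v B) (he0 v _)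
  set F : Set (Set L) := {B | ∃ v m, m ≠ r ∧ B = cluster u r v m}
  have hS : IsSplitSystem {B | (B ∈ F ∨ Bᶜ ∈ F) ∨ ∃ j, B = {j} ∨ B = {j}ᶜ} := by
    refine IsSplitSystem.of_family F r ?_ ?_ ?_
    · rintro _ ⟨v, m, hm, rfl⟩
      exact ⟨m, hm, Or.inl rfl⟩
    · rintro _ ⟨v, m, hm, rfl⟩ h
      exact h.1 rfl
    · rintro _ ⟨v, m, hm, rfl⟩ _ ⟨v', m', hm', rfl⟩
      exact hu.cluster_laminar hm hm'
  have hωF : ∀ B, ω₀ B ≠ 0 → B ∈ F ∨ Bᶜ ∈ F := by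
    intro B hB
    obtain ⟨v, -, hv⟩ := Finset.exists_ne_zero_of_sum_ne_zero hB
    by_contra! hc
    apply hv
    simp only [he_def]
    rw [if_neg fun ⟨m, h⟩ => hc.1 ⟨v, m, h⟩, if_neg fun ⟨m, h⟩ => hc.2 ⟨v, m, h⟩, add_zero]
  -- Clusters of weight zero are discarded, as nontrivial splits need positive weight.
  refine ⟨{B | ω₀ B ≠ 0 ∨ ∃ j, B = {j} ∨ B = {j}ᶜ}, fun B => ω₀ B + (p B + p Bᶜ), ?_, ?_, ?_⟩
  · have hsub : {B | ω₀ B ≠ 0 ∨ ∃ j, B = {j} ∨ B = {j}ᶜ} ⊆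
        {B | (B ∈ F ∨ Bᶜ ∈ F) ∨ ∃ j, B = {j} ∨ B = {j}ᶜ} := fun B hB => hB.imp_left (hωF B)
    refine ⟨?_, fun j => Or.inr ⟨j, Or.inl rfl⟩, fun B hB => hS.nonempty B (hsub hB),
      fun B hB C hC => hS.compat B (hsub hB) C (hsub hC)⟩
    rintro B (h | ⟨j, rfl | rfl⟩)
    · refine Or.inl ?_
      have : ω₀ Bᶜ = ω₀ B := Finset.sum_congr rfl fun v _ => by rw [compl_compl, add_comm]
      rwa [this]
    · exact Or.inr ⟨j, Or.inr rfl⟩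
    · exact Or.inr ⟨j, Or.inl (compl_compl _)⟩
  · refine ⟨fun B => ?_, fun B => add_nonneg (hω0 B) (add_nonneg (hp0 B) (hp0 _)), fun B hB => ?_,
      fun B hB h1 h2 => ?_⟩
    · have : ω₀ Bᶜ = ω₀ B := Finset.sum_congr rfl fun v _ => by rw [compl_compl, add_comm]
      simp only [this, compl_compl, add_comm (p Bᶜ)]
    · rw [Set.mem_ofPred_eq] at hB
      push Not at hB
      have h1 : p B = 0 := Finset.sum_eq_zero fun m _ => if_neg (hB.2 m).1
      have h2 : p Bᶜ = 0 := Finset.sum_eq_zero fun m _ =>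
        if_neg fun h => (hB.2 m).2 (by rw [← h, compl_compl])
      simp only [hB.1, h1, h2, add_zero]
    · rcases hB with hB | ⟨j, hB | hB⟩
      · exact add_pos_of_pos_of_nonneg ((hω0 B).lt_of_ne' hB) (add_nonneg (hp0 B) (hp0 _))
      · exact absurd hB (h1 j)
      · exact absurd hB (h2 j)
  · intro i j hij
    have hmem : ∀ v, i ≠ r → j ≠ r → (j ∉ cluster u r v i ↔ ¬ v ≤ u i j) := fun v hi hj => by
      simp [cluster, hj, hij.symm]
    rw [splitDist_add ω₀ (fun B => p B + p Bᶜ), splitDist_add p (fun B => p Bᶜ),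
      splitDist_compl p, splitDist_singleton _ hij, splitDist_singleton _ hij.symm,
      splitDist_sum V (fun v B => e v B + e v Bᶜ)]
    have h1 : ∀ v, splitDist (fun B => e v B + e v Bᶜ) i j =
        (if i ≠ r ∧ j ∉ cluster u r v i then d v / 2 else 0) +
        (if j ≠ r ∧ i ∉ cluster u r v j then d v / 2 else 0) := fun v => by
      rw [splitDist_add (e v) (fun B => e v Bᶜ), splitDist_compl (e v), splitDist_cluster hu,
        splitDist_cluster hu]
    simp only [h1]
    by_cases hi : i = r
    · have hj : j ≠ r := fun h => hij (hi.trans h.symm)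
      have h2 : ∀ v, i ∉ cluster u r v j := fun v h => h.1 hi
      simp only [hi, hj, a, h2, if_true, if_false, ne_eq, not_true, not_false_eq_true, false_and,
        true_and, zero_add]
      have h3 : ∀ v, r ∉ cluster u r v j := fun v h => h.1 rfl
      simp only [h3, if_true, not_false_eq_true, ← Finset.sum_div]
      change t / 2 + _ = _
      ring
    by_cases hj : j = r
    · have h2 : ∀ v, r ∉ cluster u r v i := fun v h => h.1 rfl
      simp only [hi, hj, a, h2, if_true, if_false, ne_eq, not_true, not_false_eq_true, false_and,
        true_and, add_zero, ← Finset.sum_div]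
      change t / 2 + _ = _
      rw [hD i r]
      ring
    · have h2 : ∀ v, (i ∉ cluster u r v j ↔ ¬ v ≤ u i j) := fun v => by
        rw [hu.comm i j]
        simp [cluster, hi, hij]
      have h3 : ∀ v, ((if ¬ v ≤ u i j then d v / 2 else 0) + if ¬ v ≤ u i j then d v / 2 else 0) =
          d v - if v ≤ u i j then d v else 0 := fun v => by
        by_cases h : v ≤ u i j <;> simp [h]
      simp only [ne_eq, hi, hj, hmem _ hi hj, h2, not_false_eq_true, true_and, h3,
        Finset.sum_sub_distrib, a, if_false]
      have h5 := huV i j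
      have h6 : u i j = D r i + D r j - D i j := rfl
      change t - _ + _ = _
      linarith

end

/-! ### Arrangements of metric trees -/

lemma IsSplitSystem.splits_tree {L : Type} [Finite L] [Nonempty L] {S : Set (Set L)}
    (hS : IsSplitSystem S) : hS.tree.splits = S := by
  ext B
  constructor
  · rintro ⟨σ, τ, ⟨C, hC⟩, rfl⟩
    rw [hS.leafSide_tree hC]
    exact hS.compl_mem C (σ.2.subset hC.1)
  · intro hB
    obtain ⟨σ, τ, h⟩ := hS.exists_flipAt_tree (hS.compl_mem B hB)
    refine ⟨σ, τ, ⟨_, h⟩, ?_⟩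
    rw [hS.leafSide_tree h, compl_compl]

lemma MetricTree.dist_comm {L : Type} [Fintype L] (A : MetricTree L) (j k : L) :
    A.dist j k = A.dist k j := by
  rw [A.dist_eq_splitDist, A.dist_eq_splitDist, splitDist_comm A.isSplitWeight_splitLen.compl]

namespace TreeArrangement

variable {n : ℕ} (T : TreeArrangement n)

/-- The weight of an arrangement in terms of an arbitrary one of its trees. -/
lemma val_weight {h i j : Fin n} (hi : i ≠ h) (hj : j ≠ h) (hij : i ≠ j) :
    val T.weight h i j = -(T.tree h).dist ⟨i, hi⟩ ⟨j, hj⟩ := by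
  have key : ∀ x y z : Fin n, ∀ (hy : y ≠ x) (hz : z ≠ x), y ≠ z → (x = h ∨ x = i ∨ x = j) →
      (y = h ∨ y = i ∨ y = j) → (z = h ∨ z = i ∨ z = j) →
      (T.tree x).dist ⟨y, hy⟩ ⟨z, hz⟩ = (T.tree h).dist ⟨i, hi⟩ ⟨j, hj⟩ := by
    have h1 := T.compat h i j hi.symm hij hj
    have h2 := T.compat h j i hj.symm hij.symm hi
    intro x y z hy hz hyz hx' hy' hz'
    rcases hx' with rfl | rfl | rfl <;> rcases hy' with rfl | rfl | rfl <;>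
      rcases hz' with rfl | rfl | rfl <;> first
        | exact absurd rfl hy
        | exact absurd rfl hz
        | exact absurd rfl hyz
        | rfl
        | exact h1.1.symm
        | exact (h1.1.trans h1.2).symm
        | exact (h2.1.symm.trans (MetricTree.dist_comm _ _ _))
        | exact ((h2.1.trans h2.2).symm.trans (MetricTree.dist_comm _ _ _))
        | exact MetricTree.dist_comm _ _ _
  obtain ⟨X, hX⟩ := exists_triple hi.symm hj.symm hij
  rw [val_eq _ hX, weight, neg_inj]
  have hmem : ∀ m, X.1.orderEmbOfFin X.2 m = h ∨ X.1.orderEmbOfFin X.2 m = i ∨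
      X.1.orderEmbOfFin X.2 m = j := fun m => by
    simpa using (Finset.ext_iff.1 hX _).1 (X.1.orderEmbOfFin_mem X.2 m)
  exact key _ _ _ _ _ ((X.1.orderEmbOfFin X.2).injective.ne (by decide)) (hmem _) (hmem _) (hmem _)

lemma val_weight_eq_splitDist {h : Fin n} {i j : {j : Fin n // j ≠ h}} (hij : i ≠ j) :
    val T.weight h i j = -splitDist (T.tree h).splitLen i j := by
  rw [T.val_weight i.2 j.2 (Subtype.coe_injective.ne hij), MetricTree.dist_eq_splitDist]

lemma nodup_lift {h i j k l : Fin n} (nd : [h, i, j, k, l].Nodup) :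
    ∃ i' j' k' l' : {j : Fin n // j ≠ h}, (i' : Fin n) = i ∧ (j' : Fin n) = j ∧
      (k' : Fin n) = k ∧ (l' : Fin n) = l ∧ [i', j', k', l'].Nodup := by
  refine ⟨⟨i, ?_⟩, ⟨j, ?_⟩, ⟨k, ?_⟩, ⟨l, ?_⟩, rfl, rfl, rfl, rfl, ?_⟩
  · rintro rfl; simp at nd
  · rintro rfl; simp at nd
  · rintro rfl; simp at nd
  · rintro rfl; simp at nd
  · simp only [List.nodup_cons, List.mem_cons, List.not_mem_nil, or_false, Subtype.mk.injEq] at nd ⊢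
    tauto

lemma nodup_coe {h : Fin n} {i j k l : {j : Fin n // j ≠ h}} (nd : [i, j, k, l].Nodup) :
    [h, (i : Fin n), j, k, l].Nodup := by
  have := i.2; have := j.2; have := k.2; have := l.2
  simp only [List.nodup_cons, List.mem_cons, List.not_mem_nil, or_false, Subtype.ext_iff] at nd ⊢
  tauto

lemma threeTerm_val_weight : ThreeTerm (val T.weight) := by
  intro h i j k l nd
  obtain ⟨i, j, k, l, rfl, rfl, rfl, rfl, nd'⟩ := nodup_lift nd
  have h4 := (T.tree h).isSplitWeight_splitLen.four_point (T.tree h).isSplitSystem_splits nd'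
  simp only [List.nodup_cons, List.mem_cons, List.not_mem_nil, or_false, not_or] at nd'
  rw [T.val_weight_eq_splitDist nd'.1.1, T.val_weight_eq_splitDist nd'.1.2.1,
    T.val_weight_eq_splitDist nd'.1.2.2, T.val_weight_eq_splitDist nd'.2.1.1,
    T.val_weight_eq_splitDist nd'.2.1.2, T.val_weight_eq_splitDist nd'.2.2.1]
  exact h4.imp (fun h => by linarith) fun h => by linarith

lemma val_weight_le_and_le_iff {h : Fin n} {i j k l : {j : Fin n // j ≠ h}}
    (nd : [i, j, k, l].Nodup) :
    (val T.weight h i j + val T.weight h k l ≤ val T.weight h i k + val T.weight h j l ∧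
      val T.weight h i j + val T.weight h k l ≤ val T.weight h i l + val T.weight h j k) ↔
      ¬ Separates (T.tree h).splits i j k l := by
  rw [← (T.tree h).isSplitWeight_splitLen.le_and_le_iff (T.tree h).isSplitSystem_splits nd]
  simp only [List.nodup_cons, List.mem_cons, List.not_mem_nil, or_false, not_or] at nd
  rw [T.val_weight_eq_splitDist nd.1.1, T.val_weight_eq_splitDist nd.1.2.1,
    T.val_weight_eq_splitDist nd.1.2.2, T.val_weight_eq_splitDist nd.2.1.1,
    T.val_weight_eq_splitDist nd.2.1.2, T.val_weight_eq_splitDist nd.2.2.1]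
  constructor <;> rintro ⟨h1, h2⟩ <;> constructor <;> linarith

lemma sameMin_weight_iff (hn : 3 ≤ n) (T T' : TreeArrangement n) :
    SameMin T.weight T'.weight ↔ ∀ i, (T.tree i).toLeafTree.Same (T'.tree i).toLeafTree := by
  have hne : ∀ i : Fin n, Nonempty {j : Fin n // j ≠ i} := fun i => by
    have : Nontrivial (Fin n) := Fin.nontrivial_iff_two_le.2 (by omega)
    obtain ⟨j, hj⟩ := exists_ne i
    exact ⟨⟨j, hj⟩⟩
  have hsep : SameMin T.weight T'.weight ↔
      ∀ (h : Fin n) (i j k l : {j : Fin n // j ≠ h}), [i, j, k, l].Nodup →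
        (Separates (T.tree h).splits i j k l ↔ Separates (T'.tree h).splits i j k l) := by
    constructor
    · intro H h i j k l nd
      have := H h i j k l (nodup_coe nd)
      rw [T.val_weight_le_and_le_iff nd, T'.val_weight_le_and_le_iff nd] at this
      exact not_iff_not.1 this
    · intro H h i j k l nd
      obtain ⟨i, j, k, l, rfl, rfl, rfl, rfl, nd'⟩ := nodup_lift nd
      rw [T.val_weight_le_and_le_iff nd', T'.val_weight_le_and_le_iff nd', H h i j k l nd']
  rw [hsep]
  refine forall_congr' fun h => ?_
  have := hne h
  rw [LeafTree.same_iff]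
  constructor
  · intro H
    have h1 := (T.tree h).isSplitSystem_splits
    have h2 := (T'.tree h).isSplitSystem_splits
    exact (h1.subset_of_separates h2 fun i j k l nd => (H i j k l nd).1).antisymm
      (h2.subset_of_separates h1 fun i j k l nd => (H i j k l nd).2)
  · intro H i j k l _
    rw [H]

/-- Up to a constant, each weight with the three term condition comes from an arrangement. -/
lemma exists_weight_eq (hn : 3 ≤ n) {w : DSubset 3 n → ℝ} (hw : ThreeTerm (val w)) :
    ∃ (T : TreeArrangement n) (c : ℝ), ∀ h i j, i ≠ h → j ≠ h → i ≠ j →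
      val T.weight h i j = val w h i j - c := by
  have hnt : ∀ h : Fin n, Nontrivial {j : Fin n // j ≠ h} := fun h => by
    have hcard : Fintype.card {j : Fin n // j ≠ h} = n - 1 := by simp
    exact Fintype.one_lt_card_iff_nontrivial.1 (by omega)
  have key : ∀ h : Fin n, ∃ c₀ : ℝ, ∀ c ≥ c₀,
      ∃ (S : Set (Set {j : Fin n // j ≠ h})) (ω : Set {j : Fin n // j ≠ h} → ℝ),
        IsSplitSystem S ∧ IsSplitWeight S ω ∧
        ∀ i j, i ≠ j → splitDist ω i j = -val w h i j + c := fun h => by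
    have := hnt h
    refine exists_splitDist_eq (fun i j : {j : Fin n // j ≠ h} => -val w h i j)
      (fun i j => by rw [val_swap_right]) fun i j k l nd => ?_
    exact (hw h i j k l (nodup_coe nd)).imp (fun h => by linarith) fun h => by linarith
  choose c₀ hc₀ using key
  -- The same constant is used for all trees, since `compat` compares distances in different trees.
  obtain ⟨c, hc⟩ := (Finset.univ.image c₀).exists_le
  choose S ω hS hω hd using fun h => hc₀ h c (hc _ (Finset.mem_image_of_mem c₀ (Finset.mem_univ h)))
  have hω' : ∀ h, IsSplitWeight (hS h).tree.splits (ω h) := fun h => by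
    rw [(hS h).splits_tree]
    exact hω h
  have hdist : ∀ h i j, i ≠ j →
      (MetricTree.ofWeight (hS h).tree (hω' h)).dist i j = -val w h i j + c := fun h i j hij => by
    rw [MetricTree.dist_ofWeight, hd h i j hij]
  refine ⟨⟨fun h => MetricTree.ofWeight (hS h).tree (hω' h), ?_⟩, c, ?_⟩
  · intro i j k hij hjk hki
    rw [hdist _ _ _ (by simpa using hjk), hdist _ _ _ (by simpa using hki),
      hdist _ _ _ (by simpa using hij)]
    constructor
    · rw [val_swap_left w i j k, val_swap_right w j i k]
    · rw [val_swap_left w j k i, val_swap_right w k j i]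
  · intro h i j hi hj hij
    rw [val_weight _ hi hj hij, hdist _ _ _ (by simpa using hij)]
    ring

end TreeArrangement

/-- The regular matroid subdivision induced by an arrangement. -/
def TreeArrangement.subdivision {n : ℕ} (hn : 3 ≤ n) (T : TreeArrangement n) :
    RegularMatroidSubdivision 3 n :=
  ⟨regularSubdivision T.weight, ⟨_, rfl⟩,
    (allCellsMatroidal_iff hn _).2 T.threeTerm_val_weight⟩

lemma TreeArrangement.subdivision_eq_iff {n : ℕ} (hn : 3 ≤ n) (T T' : TreeArrangement n) :
    T.subdivision hn = T'.subdivision hn ↔ (TreeArrangement.setoid n).r T T' := by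
  refine Subtype.ext_iff.trans ?_
  exact (regularSubdivision_eq_iff_sameMin hn T.threeTerm_val_weight T'.threeTerm_val_weight).trans
    (TreeArrangement.sameMin_weight_iff hn T T')

lemma TreeArrangement.subdivision_surjective {n : ℕ} (hn : 3 ≤ n) :
    Function.Surjective (TreeArrangement.subdivision (n := n) hn) := by
  rintro ⟨_, ⟨w, rfl⟩, hw⟩
  have hw' := (allCellsMatroidal_iff hn w).1 hw
  obtain ⟨T, c, hT⟩ := TreeArrangement.exists_weight_eq hn hw'
  refine ⟨T, Subtype.ext ?_⟩
  refine (regularSubdivision_eq_iff_sameMin hn T.threeTerm_val_weight hw').2 ?_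
  intro h i j k l nd
  simp only [List.nodup_cons, List.mem_cons, List.not_mem_nil, or_false, not_or] at nd
  obtain ⟨⟨n1, n2, n3, n4⟩, ⟨n5, n6, n7⟩, ⟨n8, n9⟩, n10, -⟩ := nd
  rw [hT h i j (Ne.symm n1) (Ne.symm n2) n5, hT h i k (Ne.symm n1) (Ne.symm n3) n6,
    hT h i l (Ne.symm n1) (Ne.symm n4) n7, hT h j k (Ne.symm n2) (Ne.symm n3) n8,
    hT h j l (Ne.symm n2) (Ne.symm n4) n9, hT h k l (Ne.symm n3) (Ne.symm n4) n10]
  constructor <;> rintro ⟨h1, h2⟩ <;> constructor <;> linarith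

end

theorem theorem4p4 (K : Type*) [Field K] (n : ℕ) (hn : 4 ≤ n) :
    (∃ e : TreeArrangementClass n ≃ RegularMatroidSubdivision 3 n,
      ∀ T : TreeArrangement n, (e T.toClass).1 = regularSubdivision T.weight) ∧
    secondaryFan 3 n = pluckerFan K 3 n := by
  have hn' : 3 ≤ n := by omega
  refine ⟨⟨Equiv.ofBijective (Quotient.lift (s := TreeArrangement.setoid n)
    (fun T => T.subdivision hn') fun T T' h => (T.subdivision_eq_iff hn' T').2 h) ⟨?_, ?_⟩,
    fun T => rfl⟩, secondaryFan_eq_pluckerFan K hn'⟩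
  · intro q q'
    induction q using Quotient.inductionOn
    induction q' using Quotient.inductionOn
    exact fun h => Quotient.sound ((TreeArrangement.subdivision_eq_iff hn' _ _).1 h)
  · intro S
    obtain ⟨T, hT⟩ := TreeArrangement.subdivision_surjective hn' S
    exact ⟨Quotient.mk _ T, hT⟩
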